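/- Let $\gamma:\mathbb R\to\mathbb R^2$ be a smooth injective curve with $|\gamma'(t)|=1$ for all $t$, such that for some constants $C_0,\beta>0$ $$|\gamma''(t)|^2+|\gamma'''(t)|\le C_0e^{-\beta|t|}\quad(t\in\mathbb R),\qquad \lim_{t\to\infty}|\gamma(\pm t)|=\infty,\qquad \lim_{t\to\infty}|\gamma(t)-\gamma(-t)|=\infty .$$ Fix $m>0$. For $E\in(-m,m)\setminus\{0\}$ put $\omega=\sqrt{m^2-E^2}$ and $G_\omega(x,y)=\frac1{2\pi}K_0(\omega|x-y|)$, where $K_0(r)=\int_0^\infty e^{-r\cosh s}\,ds$ is the modified Bessel function of the second kind of order $0$, and define $$\mathcal L\mu(t)=\mu(t)-2m\int_{\mathbb R}G_\omega(\gamma(t),\gamma(t'))\,\mu(t')\,dt',\qquad \mathcal P\rho(t)=\rho(t)+\frac{m^2}{E}\int_{\mathbb R}e^{iE|t-t'|}\rho(t')\,dt'.$$ For an integrable, compactly supported source $f:\mathbb R^2\to\mathbb C$ let $u_i(x)=\int_{\mathbb R^2}G_\omega(x,y)f(y)\,dy$. For $\alpha>0$ let $L^2_\alpha=\{\rho\in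 L^2(\mathbb R;\mathbb C): e^{\alpha|\cdot|}\rho\in L^2(\mathbb R;\mathbb C)\}$. Then for every $\epsilon>0$ there is $\alpha_0>0$ (depending on $\gamma$, $m$ and $\epsilon$) such that for every $\alpha\in(0,\alpha_0)$ the following holds for all but finitely many $E\in[-m+\epsilon,-\epsilon]\cup[\epsilon,m-\epsilon]$: for every integrable, compactly supported $f$, the equation $$\mathcal L\mathcal P\rho(t)=2m\,u_i(\gamma(t))\qquad\text{for a.e. }t\in\mathbb R$$ has exactly one solution $\rho\in L^2_\alpha$. -/

import Mathlib

namespace SingularWaveguide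

noncomputable section

/-- The Euclidean plane `ℝ²`. -/
abbrev Plane : Type := EuclideanSpace ℝ (Fin 2)

/-- `γ` is an arclength parameterization of a smooth simple curve in the plane that is
asymptotically flat in both directions and has a positive opening angle at infinity. -/
structure IsInterface (γ : ℝ → Plane) : Prop where
  smooth : ContDiff ℝ ((⊤ : ℕ∞) : WithTop ℕ∞) γ
  injective : Function.Injective γ
  unit_speed : ∀ t : ℝ, ‖deriv γ t‖ = 1
  curvature_decay : ∃ C₀ : ℝ, 0 < C₀ ∧ ∃ β : ℝ, 0 < β ∧ ∀ t : ℝ,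
    ‖iteratedDeriv 2 γ t‖ ^ 2 + ‖iteratedDeriv 3 γ t‖ ≤ C₀ * Real.exp (-β * |t|)
  tendsto_norm_atTop : Filter.Tendsto (fun t : ℝ => ‖γ t‖) Filter.atTop Filter.atTop
  tendsto_norm_atBot : Filter.Tendsto (fun t : ℝ => ‖γ (-t)‖) Filter.atTop Filter.atTop
  tendsto_norm_sub : Filter.Tendsto (fun t : ℝ => ‖γ t - γ (-t)‖) Filter.atTop Filter.atTop

/-- The modified Bessel function of the second kind of order zero, for `0 < re z`, by its
integral representation `K₀(z) = ∫₀^∞ exp (-z cosh s) ds`. -/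
def besselK0 (z : ℂ) : ℂ :=
  ∫ s in Set.Ioi (0 : ℝ), Complex.exp (-z * (Real.cosh s : ℂ))

/-- The decaying Green's function `G_ω(x, y) = K₀(ω |x - y|) / (2π)` of `-Δ + ω²` in the plane. -/
def green (ω : ℂ) (x y : Plane) : ℂ :=
  (1 / (2 * (Real.pi : ℂ))) * besselK0 (ω * (‖x - y‖ : ℂ))

/-- The single-layer operator on the curve, `(𝒮_ω μ)(t) = ∫ G_ω(γ(t), γ(t')) μ(t') dt'`. -/
def singleLayer (γ : ℝ → Plane) (ω : ℂ) (μ : ℝ → ℂ) (t : ℝ) : ℂ :=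
  ∫ t' : ℝ, green ω (γ t) (γ t') * μ t'

/-- `ℒ = 1 - 2 m 𝒮_ω`. -/
def opL (γ : ℝ → Plane) (m : ℝ) (ω : ℂ) (μ : ℝ → ℂ) (t : ℝ) : ℂ :=
  μ t - 2 * (m : ℂ) * singleLayer γ ω μ t

/-- `(Q ρ)(t) = (m² / E) ∫ exp (i E |t - t'|) ρ(t') dt'`. -/
def opQ (m : ℝ) (E : ℂ) (ρ : ℝ → ℂ) (t : ℝ) : ℂ :=
  ((m : ℂ) ^ 2 / E) * ∫ t' : ℝ, Complex.exp (Complex.I * E * (|t - t'| : ℝ)) * ρ t'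

/-- `𝒫 = 1 + Q`. -/
def opP (m : ℝ) (E : ℂ) (ρ : ℝ → ℂ) (t : ℝ) : ℂ :=
  ρ t + opQ m E ρ t

/-- The incident field `u_i(x) = ∫_{ℝ²} G_ω(x, y) f(y) dy` generated by the source `f`. -/
def incidentField (ω : ℂ) (f : Plane → ℂ) (x : Plane) : ℂ :=
  ∫ y : Plane, green ω x y * f y

/-- The space `L²_α` of all `ρ ∈ L²(ℝ)` such that `exp (α |t|) ρ(t)` is in `L²(ℝ)`. -/
def weightedL2 (α : ℝ) : Set (MeasureTheory.Lp ℂ 2 (MeasureTheory.volume : MeasureTheory.Measure ℝ)) :=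
  {ρ | MeasureTheory.MemLp (fun t : ℝ => ((Real.exp (α * |t|) : ℝ) : ℂ) * ρ t) 2
    MeasureTheory.volume}

/-- `ρ` solves the boundary integral equation `ℒ 𝒫 ρ = 2 m u_i` on the interface (as an identity
of functions of the arclength parameter, up to null sets), where `ω = √(m² - E²)`. -/
def SolvesBIE (γ : ℝ → Plane) (m E : ℝ) (f : Plane → ℂ) (ρ : ℝ → ℂ) : Prop :=
  ∀ᵐ t : ℝ, opL γ m (Real.sqrt (m ^ 2 - E ^ 2) : ℂ) (opP m (E : ℂ) ρ) t =
    2 * (m : ℂ) * incidentField (Real.sqrt (m ^ 2 - E ^ 2) : ℂ) f (γ t)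

end

end SingularWaveguide

open Filter Topology

namespace SingularWaveguide

/-! ### Analytic Fredholm alternative for finite-rank perturbations. -/

section Fredholm

variable {V W : Type*} [NormedAddCommGroup V] [NormedSpace ℂ V] [NormedAddCommGroup W]
  [NormedSpace ℂ W]

/-! Conjugated by the weight `e^{α|t|}`, the product `ℒ𝒫` becomes a bounded operator `bieOp` on
`L²(ℝ)` that is holomorphic in `E` on an open strip around each energy window. By
`analytic_fredholm_finite` such a family is invertible off a finite subset of every compact set,
provided that at each `E` it is a finite-rank perturbation of an invertible operator, and that it is
invertible for one `E`.

The invertible part is the operator of the straight line. With `v = √(ξ² + ω²)` the symbol of `ℒ`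
there is `(v - m)/v`, and that of `𝒫` is `1 - 2im²/(ξ² - E²)`. Since `ξ² - E² = v² - m²`, the zeros
of the first cancel the poles of the second (`Admissible.outgoing_opQ`), and the product is `(ξ² +
θ²)/(v(v + m))` with `θ² = -(E² + 2im²)`. Its inverse `(1 + m/v)(1 + (ω² - θ²)/(ξ² + θ²))` comes
from exponentially decaying kernels, so it is bounded in the weighted space once `α < Re θ`
(`Config.isUnit_lineOp`).

The correction comes from the difference between the Green's function on the curve and on the line.
On one side of the origin chord and arc agree up to a relative error decaying exponentially away
from it; across the origin the kernels themselves decay, the curve being bi-Lipschitz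
(`IsInterface.exists_geometry`). Hence the difference decays in both variables: it sends even the
non-decaying field `Qρ` back into the weighted space, and it is Hilbert–Schmidt, so a norm limit of
finite-rank operators (`Config.norm_defectKernel_le`, `KBound.exists_finiteRank_approx`).

High up in the strip `Re ω ≥ Im E` is large, every correction to the identity is small, and a
Neumann series gives the required point of invertibility. Finally `e^{α|t|} u_i(γ(t))` lies in `L²`,
so invertibility of `bieOp` gives existence and uniqueness in `L²_α`
(`Config.existsUnique_of_isUnit`). -/

theorem isUnit_one_add_comp_of_swap (A : V →L[ℂ] W) (L : W →L[ℂ] V)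
    (h : IsUnit (1 + A.comp L)) : IsUnit (1 + L.comp A) := by
  obtain ⟨u, hu⟩ := h
  set N : W →L[ℂ] W := ((u⁻¹ : (W →L[ℂ] W)ˣ) : W →L[ℂ] W) with hN
  have h1 : ∀ w, N w + N (A (L w)) = w := fun w => by
    have : N * (1 + A.comp L) = 1 := by rw [← hu, hN, Units.inv_mul]
    simpa using DFunLike.congr_fun this w
  have h2 : ∀ w, N w + A (L (N w)) = w := fun w => by
    have : (1 + A.comp L) * N = 1 := by rw [← hu, hN, Units.mul_inv]
    simpa using DFunLike.congr_fun this w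
  -- The inverse is `(1 + LA)⁻¹ = 1 - L(1 + AL)⁻¹A`.
  refine ⟨⟨1 + L.comp A, 1 - L.comp (N.comp A), ?_, ?_⟩, rfl⟩
  · ext v
    have := congrArg L (h2 (A v))
    simp only [map_add] at this
    simp only [mul_apply_eq_comp, add_apply,
      sub_apply, one_apply_eq_self, ContinuousLinearMap.comp_apply,
      map_sub, ← this]
    abel
  · ext v
    have := congrArg L (h1 (A v))
    simp only [map_add] at this
    simp only [mul_apply_eq_comp, add_apply,
      sub_apply, one_apply_eq_self, ContinuousLinearMap.comp_apply,
      map_add]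
    linear_combination (norm := module) -this

theorem isUnit_one_add_comp_iff (A : V →L[ℂ] W) (L : W →L[ℂ] V) :
    IsUnit (1 + L.comp A) ↔ IsUnit (1 + A.comp L) :=
  ⟨isUnit_one_add_comp_of_swap L A, isUnit_one_add_comp_of_swap A L⟩

theorem isUnit_iff_det_toMatrix'_ne_zero {n : ℕ} (M : (Fin n → ℂ) →L[ℂ] (Fin n → ℂ)) :
    IsUnit M ↔ (LinearMap.toMatrix' (M : (Fin n → ℂ) →ₗ[ℂ] (Fin n → ℂ))).det ≠ 0 := by
  rw [LinearMap.det_toMatrix', ← isUnit_iff_ne_zero, ← LinearMap.isUnit_iff_isUnit_det]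
  constructor
  · intro h
    exact h.map (ContinuousLinearMap.toLinearMapRingHom (R₁ := ℂ) (M₁ := Fin n → ℂ))
  · rintro ⟨u, hu⟩
    refine ⟨⟨M, LinearMap.toContinuousLinearMap ((u⁻¹ : _ˣ) : (Fin n → ℂ) →ₗ[ℂ] (Fin n → ℂ)),
      ?_, ?_⟩, rfl⟩
    · ext1 v
      have : (M : (Fin n → ℂ) →ₗ[ℂ] (Fin n → ℂ)) * ((u⁻¹ : _ˣ) : (Fin n → ℂ) →ₗ[ℂ] (Fin n → ℂ)) = 1 := by
        rw [← hu, Units.mul_inv]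
      simpa using DFunLike.congr_fun this v
    · ext1 v
      have : ((u⁻¹ : _ˣ) : (Fin n → ℂ) →ₗ[ℂ] (Fin n → ℂ)) * (M : (Fin n → ℂ) →ₗ[ℂ] (Fin n → ℂ)) = 1 := by
        rw [← hu, Units.inv_mul]
      simpa using DFunLike.congr_fun this v

variable [CompleteSpace V] {T : ℂ → V →L[ℂ] V}

/-- With `B = T - LA`, invertible near `z₀`, one has `T = B(1 + B⁻¹LA)`. Swapping the factors turns
invertibility of `T` into nonvanishing of the determinant of the finite matrix `1 + AB⁻¹L`, which is
analytic, so its zeros near `z₀` are isolated or fill a neighbourhood. -/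
theorem eventually_isUnit_or_eventually_not_isUnit {z₀ : ℂ} (hT : AnalyticAt ℂ T z₀)
    {n : ℕ} (A : V →L[ℂ] (Fin n → ℂ)) (L : (Fin n → ℂ) →L[ℂ] V)
    (hu : IsUnit (T z₀ - L.comp A)) :
    (∀ᶠ z in 𝓝[≠] z₀, IsUnit (T z)) ∨ ∀ᶠ z in 𝓝 z₀, ¬ IsUnit (T z) := by
  set B : ℂ → V →L[ℂ] V := fun z => T z - L.comp A with hB
  have hBan : AnalyticAt ℂ B z₀ := hT.sub analyticAt_const
  have hBunit : ∀ᶠ z in 𝓝 z₀, IsUnit (B z) :=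
    hBan.continuousAt.eventually (Units.isOpen.mem_nhds hu)
  have hinv : AnalyticAt ℂ (fun z => Ring.inverse (B z)) z₀ := by
    obtain ⟨u, hu'⟩ := hu
    have h1 : AnalyticAt ℂ (Ring.inverse : (V →L[ℂ] V) → V →L[ℂ] V) (B z₀) := by
      simp only [hB, ← hu']
      exact analyticAt_inverse u
    exact h1.comp hBan
  set M : ℂ → (Fin n → ℂ) →L[ℂ] (Fin n → ℂ) :=
    fun z => 1 + A.comp ((Ring.inverse (B z)).comp L) with hM
  set d : ℂ → ℂ := fun z =>
    (LinearMap.toMatrix' (M z : (Fin n → ℂ) →ₗ[ℂ] (Fin n → ℂ))).det with hd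
  have hiff : ∀ᶠ z in 𝓝 z₀, (IsUnit (T z) ↔ d z ≠ 0) := by
    filter_upwards [hBunit] with z hz
    rw [hd, ← isUnit_iff_det_toMatrix'_ne_zero, hM, ← isUnit_one_add_comp_iff]
    have : T z = B z * (1 + ((Ring.inverse (B z)).comp L).comp A) := by
      have h1 : B z * ((Ring.inverse (B z)).comp L).comp A = L.comp A := by
        have := Ring.mul_inverse_cancel _ hz
        ext v
        simpa using DFunLike.congr_fun this (L (A v))
      rw [mul_add, h1, mul_one]
      simp [hB]
    rw [this]
    obtain ⟨u, hu⟩ := hz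
    rw [← hu]
    exact Units.isUnit_units_mul u _
  have hdan : AnalyticAt ℂ d z₀ := by
    have hentry : ∀ i j, AnalyticAt ℂ (fun z =>
        LinearMap.toMatrix' (M z : (Fin n → ℂ) →ₗ[ℂ] (Fin n → ℂ)) i j) z₀ := by
      intro i j
      have : (fun z => LinearMap.toMatrix' (M z : (Fin n → ℂ) →ₗ[ℂ] (Fin n → ℂ)) i j) =
          fun z => (Pi.single j (1 : ℂ) : Fin n → ℂ) i +
            ((ContinuousLinearMap.proj (R := ℂ) (φ := fun _ : Fin n => ℂ) i).comp A)
              (Ring.inverse (B z) (L (Pi.single j 1))) := by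
        ext z
        simp [LinearMap.toMatrix'_apply, hM]
      rw [this]
      refine analyticAt_const.add ?_
      exact ((((ContinuousLinearMap.proj (R := ℂ) (φ := fun _ : Fin n => ℂ) i).comp A).comp
        (ContinuousLinearMap.apply ℂ V (L (Pi.single j 1)))).analyticAt _).comp hinv
    simp only [hd, Matrix.det_apply]
    refine Finset.analyticAt_fun_sum _ fun σ _ => ?_
    exact (Finset.analyticAt_fun_prod _ fun i _ => hentry _ _).const_smul
  rcases hdan.eventually_eq_zero_or_eventually_ne_zero with h | h
  · right
    filter_upwards [h, hiff] with z hz hz'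
    simp [hz', hz]
  · left
    filter_upwards [h, hiff.filter_mono nhdsWithin_le_nhds] with z hz hz'
    exact hz'.2 hz

/-- The analytic Fredholm theorem for families that are, at each point, a finite rank perturbation
of an invertible operator. -/
theorem analytic_fredholm_finite {Ω : Set ℂ} (hΩ : IsOpen Ω) (hc : IsPreconnected Ω)
    (hT : DifferentiableOn ℂ T Ω)
    (hF : ∀ z ∈ Ω, ∃ (n : ℕ) (A : V →L[ℂ] (Fin n → ℂ)) (L : (Fin n → ℂ) →L[ℂ] V),
      IsUnit (T z - L.comp A))
    (hu : ∃ z ∈ Ω, IsUnit (T z)) {K : Set ℂ} (hK : IsCompact K) (hKΩ : K ⊆ Ω) :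
    {z ∈ K | ¬ IsUnit (T z)}.Finite := by
  set U : Set ℂ := {z | ∀ᶠ w in 𝓝[≠] z, IsUnit (T w)} with hUdef
  set N : Set ℂ := {z | ∀ᶠ w in 𝓝 z, ¬ IsUnit (T w)} with hNdef
  have hUo : IsOpen U := by
    rw [isOpen_iff_mem_nhds]
    intro z hz
    obtain ⟨O, hO, hzO, hOu⟩ := mem_nhdsWithin.1 hz
    filter_upwards [hO.mem_nhds hzO] with w hw
    by_cases hwz : w = z
    · rw [hwz]; exact hz
    · refine mem_nhdsWithin_of_mem_nhds ?_
      filter_upwards [hO.mem_nhds hw, isOpen_ne.mem_nhds hwz] with x hx hxz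
      exact hOu ⟨hx, hxz⟩
  have hNo : IsOpen N := isOpen_iff_mem_nhds.2 fun z hz => eventually_eventually_nhds.2 hz
  have hcover : Ω ⊆ U ∪ N := by
    intro z hz
    obtain ⟨n, A, L, h⟩ := hF z hz
    exact eventually_isUnit_or_eventually_not_isUnit (hT.analyticAt (hΩ.mem_nhds hz)) A L h
  have hdisj : U ∩ N = ∅ := by
    ext z
    simp only [Set.mem_inter_iff, Set.mem_empty_iff_false, iff_false, not_and]
    intro h1 h2
    obtain ⟨w, hw⟩ := (Filter.Eventually.and (f := 𝓝[≠] z) h1 (Filter.Eventually.filter_mono (f₁ := 𝓝[≠] z) nhdsWithin_le_nhds h2)).exists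
    exact hw.2 hw.1
  -- `U` and `N` are open, disjoint and cover the connected set `Ω`, and `U` contains the given
  -- point of invertibility.
  have hΩU : Ω ⊆ U := by
    refine hc.subset_left_of_subset_union hUo hNo (Set.disjoint_iff_inter_eq_empty.2 hdisj) hcover ?_
    obtain ⟨z, hz, hzu⟩ := hu
    refine ⟨z, hz, ?_⟩
    refine mem_nhdsWithin_of_mem_nhds ?_
    exact ((hT.differentiableAt (hΩ.mem_nhds hz)).continuousAt).eventually
      (Units.isOpen.mem_nhds hzu)
  -- Infinitely many bad points would accumulate in `K`, against invertibility on a punctured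
  -- neighbourhood of the limit.
  by_contra hinf
  obtain ⟨z, hzK, hz⟩ := Set.Infinite.exists_accPt_of_subset_isCompact hinf hK (fun z hz => hz.1)
  have h1 : ∃ᶠ w in 𝓝[≠] z, w ∈ {z ∈ K | ¬ IsUnit (T z)} := accPt_iff_frequently_nhdsNE.1 hz
  obtain ⟨w, hw⟩ := (h1.and_eventually (hΩU (hKΩ hzK))).exists
  exact hw.1.2 hw.2

end Fredholm

end SingularWaveguide

open Filter Topology MeasureTheory
open scoped ENNReal FourierTransform

namespace SingularWaveguide

noncomputable section

/-! ### Integral operators on `L²(ℝ)` with kernels dominated by a convolution. -/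

section Schur

/-- Cauchy–Schwarz for the measure `a dμ`, obtained by splitting `a = a^{1/2} a^{1/2}`. -/
theorem sq_lintegral_mul_le {X : Type*} [MeasurableSpace X] (μ : Measure X) {a b : X → ℝ≥0∞}
    (ha : AEMeasurable a μ) (hb : AEMeasurable b μ) :
    (∫⁻ x, a x * b x ∂μ) ^ 2 ≤ (∫⁻ x, a x ∂μ) * ∫⁻ x, a x * b x ^ 2 ∂μ := by
  have hsplit : ∀ y : ℝ≥0∞, y ^ (1 / 2 : ℝ) * y ^ (1 / 2 : ℝ) = y := fun y => by
    rw [← ENNReal.rpow_add_of_nonneg _ _ (by norm_num) (by norm_num)]; norm_num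
  have hsq : ∀ y : ℝ≥0∞, (y ^ (1 / 2 : ℝ)) ^ 2 = y := fun y => by rw [sq, hsplit]
  have h := ENNReal.lintegral_mul_le_Lp_mul_Lq μ (Real.HolderConjugate.two_two)
    (f := fun x => a x ^ (1 / 2 : ℝ)) (g := fun x => a x ^ (1 / 2 : ℝ) * b x)
    (ha.pow_const _) ((ha.pow_const _).mul hb)
  simp only [Pi.mul_apply, ← mul_assoc, hsplit] at h
  calc (∫⁻ x, a x * b x ∂μ) ^ 2 ≤ _ := pow_le_pow_left' h 2
    _ = (∫⁻ x, a x ∂μ) * ∫⁻ x, a x * b x ^ 2 ∂μ := by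
      rw [mul_pow, hsq, hsq]
      simp only [ENNReal.rpow_two, mul_pow, hsq]

theorem eLpNorm_two_eq {X E : Type*} [MeasurableSpace X] [NormedAddCommGroup E] (μ : Measure X)
    (f : X → E) : eLpNorm f 2 μ = (∫⁻ x, ‖f x‖ₑ ^ 2 ∂μ) ^ (1 / 2 : ℝ) := by
  rw [eLpNorm_eq_lintegral_rpow_enorm_toReal (by norm_num) (by norm_num)]
  simp

theorem memLp_two_of_lintegral_lt_top {X E : Type*} [MeasurableSpace X] [NormedAddCommGroup E]
    {μ : Measure X} {f : X → E} (hf : AEStronglyMeasurable f μ)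
    (h : ∫⁻ x, ‖f x‖ₑ ^ 2 ∂μ < ∞) : MemLp f 2 μ :=
  ⟨hf, by rw [eLpNorm_two_eq]; exact ENNReal.rpow_lt_top_of_nonneg (by norm_num) h.ne⟩

theorem lintegral_sq_lt_top_of_memLp {X E : Type*} [MeasurableSpace X] [NormedAddCommGroup E]
    {μ : Measure X} {f : X → E} (h : MemLp f 2 μ) : ∫⁻ x, ‖f x‖ₑ ^ 2 ∂μ < ∞ := by
  have := h.2
  rw [eLpNorm_two_eq] at this
  exact (ENNReal.rpow_lt_top_iff_of_pos (by norm_num)).1 this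

/-- `k` is a measurable kernel on the line dominated by the convolution kernel of the integrable
function `g`. -/
structure KBound (k : ℝ → ℝ → ℂ) (g : ℝ → ℝ) : Prop where
  meas : Measurable (Function.uncurry k)
  int : Integrable g
  bound : ∀ t u, t ≠ u → ‖k t u‖ ≤ g (t - u)

variable {k k₁ k₂ k₃ : ℝ → ℝ → ℂ} {g g₁ g₂ g₃ : ℝ → ℝ}

theorem KBound.enorm_le (h : KBound k g) {t u : ℝ} (htu : t ≠ u) : ‖k t u‖ₑ ≤ ‖g (t - u)‖ₑ := by
  rw [← ofReal_norm, ← ofReal_norm]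
  exact ENNReal.ofReal_le_ofReal ((h.bound t u htu).trans (le_abs_self _))

theorem KBound.lintegral_right (h : KBound k g) (t : ℝ) :
    ∫⁻ u, ‖k t u‖ₑ ≤ ∫⁻ x, ‖g x‖ₑ := by
  calc ∫⁻ u, ‖k t u‖ₑ ≤ ∫⁻ u, ‖g (t - u)‖ₑ := by
        refine lintegral_mono_ae ?_
        filter_upwards [compl_mem_ae_iff.2 (measure_singleton t : volume {t} = 0)] with u hu
        exact h.enorm_le (fun e => hu (by simp [e]))
    _ = ∫⁻ x, ‖g x‖ₑ := lintegral_sub_left_eq_self (fun x => ‖g x‖ₑ) t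

theorem KBound.lintegral_left (h : KBound k g) (u : ℝ) :
    ∫⁻ t, ‖k t u‖ₑ ≤ ∫⁻ x, ‖g x‖ₑ := by
  calc ∫⁻ t, ‖k t u‖ₑ ≤ ∫⁻ t, ‖g (t - u)‖ₑ := by
        refine lintegral_mono_ae ?_
        filter_upwards [compl_mem_ae_iff.2 (measure_singleton u : volume {u} = 0)] with t ht
        exact h.enorm_le (fun e => ht (by simp [e]))
    _ = ∫⁻ x, ‖g x‖ₑ := lintegral_sub_right_eq_self (fun x => ‖g x‖ₑ) u

theorem KBound.lintegral_ne_top (h : KBound k g) : ∫⁻ x, ‖g x‖ₑ ≠ ∞ := h.int.2.ne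

theorem KBound.measurable_enorm (h : KBound k g) :
    Measurable (fun p : ℝ × ℝ => ‖k p.1 p.2‖ₑ) := h.meas.enorm

/-- Schur's test for dominated kernels. -/
theorem KBound.lintegral_sq_le (h : KBound k g) {φ : ℝ → ℝ≥0∞} (hφ : AEMeasurable φ) :
    ∫⁻ t, (∫⁻ u, ‖k t u‖ₑ * φ u) ^ 2 ≤ (∫⁻ x, ‖g x‖ₑ) ^ 2 * ∫⁻ u, φ u ^ 2 := by
  set A := ∫⁻ x, ‖g x‖ₑ
  have hkm := h.measurable_enorm
  calc ∫⁻ t, (∫⁻ u, ‖k t u‖ₑ * φ u) ^ 2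
      ≤ ∫⁻ t, A * ∫⁻ u, ‖k t u‖ₑ * φ u ^ 2 := by
        refine lintegral_mono fun t => ?_
        refine (sq_lintegral_mul_le _ ?_ hφ).trans ?_
        · exact (hkm.comp measurable_prodMk_left).aemeasurable
        · gcongr
          exact h.lintegral_right t
    _ = A * ∫⁻ t, ∫⁻ u, ‖k t u‖ₑ * φ u ^ 2 := lintegral_const_mul' _ _ h.lintegral_ne_top
    _ = A * ∫⁻ u, ∫⁻ t, ‖k t u‖ₑ * φ u ^ 2 := by
        rw [lintegral_lintegral_swap]
        exact hkm.aemeasurable.mul ((hφ.comp_snd).pow_const 2)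
    _ ≤ A * ∫⁻ u, A * φ u ^ 2 := by
        gcongr with u
        rw [lintegral_mul_const _ (by exact hkm.comp measurable_prodMk_right)]
        gcongr
        exact h.lintegral_left u
    _ = A ^ 2 * ∫⁻ u, φ u ^ 2 := by
        rw [lintegral_const_mul' _ _ h.lintegral_ne_top]; ring

theorem KBound.lintegral_mul_lt_top (h : KBound k g) {φ : ℝ → ℂ} (hφ : MemLp φ 2) :
    ∀ᵐ t, ∫⁻ u, ‖k t u‖ₑ * ‖φ u‖ₑ < ∞ := by
  have h1 := h.lintegral_sq_le hφ.1.enorm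
  have h2 : ∫⁻ t, (∫⁻ u, ‖k t u‖ₑ * ‖φ u‖ₑ) ^ 2 < ∞ :=
    h1.trans_lt (ENNReal.mul_lt_top (ENNReal.pow_lt_top h.lintegral_ne_top.lt_top)
      (lintegral_sq_lt_top_of_memLp hφ))
  have hm : AEMeasurable (fun t => (∫⁻ u, ‖k t u‖ₑ * ‖φ u‖ₑ) ^ 2) := by
    refine AEMeasurable.pow_const ?_ 2
    exact (h.measurable_enorm.aemeasurable.mul (hφ.1.enorm.comp_snd)).lintegral_prod_right'
  filter_upwards [ae_lt_top' hm h2.ne] with t ht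
  exact lt_of_not_ge fun hge => by simp [top_le_iff.1 hge] at ht

theorem KBound.ae_integrable (h : KBound k g) {φ : ℝ → ℂ} (hφ : MemLp φ 2) :
    ∀ᵐ t, Integrable (fun u => k t u * φ u) := by
  filter_upwards [h.lintegral_mul_lt_top hφ] with t ht
  refine ⟨?_, ?_⟩
  · exact (h.meas.comp measurable_prodMk_left).aestronglyMeasurable.mul hφ.1
  · simpa [HasFiniteIntegral, enorm_mul] using ht

theorem KBound.eLpNorm_le (h : KBound k g) {φ : ℝ → ℂ} (hφ : MemLp φ 2) :
    eLpNorm (fun t => ∫ u, k t u * φ u) 2 ≤ (∫⁻ x, ‖g x‖ₑ) * eLpNorm φ 2 := by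
  rw [eLpNorm_two_eq, eLpNorm_two_eq]
  have h1 : ∫⁻ t, ‖∫ u, k t u * φ u‖ₑ ^ 2 ≤ (∫⁻ x, ‖g x‖ₑ) ^ 2 * ∫⁻ u, ‖φ u‖ₑ ^ 2 := by
    refine le_trans (lintegral_mono fun t => ?_) (h.lintegral_sq_le hφ.1.enorm)
    refine pow_le_pow_left' ?_ 2
    refine (enorm_integral_le_lintegral_enorm _).trans_eq ?_
    simp [enorm_mul]
  calc _ ≤ ((∫⁻ x, ‖g x‖ₑ) ^ 2 * ∫⁻ u, ‖φ u‖ₑ ^ 2) ^ (1 / 2 : ℝ) := by gcongr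
    _ = _ := by
      rw [ENNReal.mul_rpow_of_nonneg _ _ (by norm_num), ← ENNReal.rpow_natCast,
        ← ENNReal.rpow_mul]
      norm_num

theorem KBound.aestronglyMeasurable (h : KBound k g) {φ : ℝ → ℂ} (hφ : AEStronglyMeasurable φ) :
    AEStronglyMeasurable (fun t => ∫ u, k t u * φ u) := by
  exact (h.meas.aestronglyMeasurable.mul (hφ.comp_snd)).integral_prod_right'

theorem KBound.memLp (h : KBound k g) {φ : ℝ → ℂ} (hφ : MemLp φ 2) :
    MemLp (fun t => ∫ u, k t u * φ u) 2 :=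
  ⟨h.aestronglyMeasurable hφ.1,
    (h.eLpNorm_le hφ).trans_lt (ENNReal.mul_lt_top h.lintegral_ne_top.lt_top hφ.2)⟩

abbrev L2 : Type := Lp ℂ 2 (volume : Measure ℝ)

theorem KBound.toLp_add (h : KBound k g) (φ ψ : L2) :
    (h.memLp (Lp.memLp (φ + ψ))).toLp = (h.memLp (Lp.memLp φ)).toLp + (h.memLp (Lp.memLp ψ)).toLp := by
  rw [← MemLp.toLp_add]
  refine MemLp.toLp_congr _ _ ?_
  filter_upwards [h.ae_integrable (Lp.memLp φ), h.ae_integrable (Lp.memLp ψ)] with t h1 h2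
  rw [Pi.add_apply, ← integral_add h1 h2]
  refine integral_congr_ae ?_
  filter_upwards [Lp.coeFn_add φ ψ] with u hu
  rw [hu, Pi.add_apply, mul_add]

theorem KBound.toLp_smul (h : KBound k g) (c : ℂ) (φ : L2) :
    (h.memLp (Lp.memLp (c • φ))).toLp = c • (h.memLp (Lp.memLp φ)).toLp := by
  rw [← MemLp.toLp_const_smul]
  refine MemLp.toLp_congr _ _ ?_
  refine Eventually.of_forall fun t => ?_
  rw [Pi.smul_apply, smul_eq_mul, ← integral_const_mul]
  refine integral_congr_ae ?_
  filter_upwards [Lp.coeFn_smul c φ] with u hu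
  rw [hu, Pi.smul_apply, smul_eq_mul]; ring

theorem KBound.norm_toLp_le (h : KBound k g) (φ : L2) :
    ‖(h.memLp (Lp.memLp φ)).toLp‖ ≤ (∫ x, ‖g x‖) * ‖φ‖ := by
  rw [Lp.norm_toLp, Lp.norm_def]
  refine (ENNReal.toReal_mono (ENNReal.mul_ne_top h.lintegral_ne_top (Lp.eLpNorm_ne_top φ))
    (h.eLpNorm_le (Lp.memLp φ))).trans_eq ?_
  rw [ENNReal.toReal_mul, integral_norm_eq_lintegral_enorm h.int.1]

open Classical in
/-- The integral operator on `L²(ℝ)` with kernel `k`. -/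
def kop (k : ℝ → ℝ → ℂ) : L2 →L[ℂ] L2 :=
  -- The choice of majorant is immaterial: `KBound.kop_eq` gives the same value for every one. The
  -- value `0` is a default for kernels without a majorant.
  if h : ∃ g, KBound k g then
    LinearMap.mkContinuous
      { toFun := fun φ => (h.choose_spec.memLp (Lp.memLp φ)).toLp
        map_add' := h.choose_spec.toLp_add
        map_smul' := h.choose_spec.toLp_smul } (∫ x, ‖h.choose x‖) h.choose_spec.norm_toLp_le
  else 0

theorem KBound.kop_eq (h : KBound k g) (φ : L2) : kop k φ = (h.memLp (Lp.memLp φ)).toLp := by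
  have h' : ∃ g, KBound k g := ⟨g, h⟩
  rw [kop, dif_pos h']
  rfl

theorem KBound.kop_ae (h : KBound k g) (φ : L2) : kop k φ =ᵐ[volume] fun t => ∫ u, k t u * φ u := by
  rw [h.kop_eq]; exact MemLp.coeFn_toLp _

theorem KBound.norm_kop_le (h : KBound k g) : ‖kop k‖ ≤ ∫ x, ‖g x‖ := by
  refine ContinuousLinearMap.opNorm_le_bound _ (integral_nonneg fun _ => norm_nonneg _) fun φ => ?_
  rw [h.kop_eq]; exact h.norm_toLp_le φ

theorem KBound.add (h₁ : KBound k₁ g₁) (h₂ : KBound k₂ g₂) :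
    KBound (fun t u => k₁ t u + k₂ t u) (fun x => g₁ x + g₂ x) :=
  ⟨h₁.meas.add h₂.meas, h₁.int.add h₂.int, fun t u htu =>
    (norm_add_le _ _).trans (add_le_add (h₁.bound t u htu) (h₂.bound t u htu))⟩

theorem KBound.const_mul (h : KBound k g) (c : ℂ) :
    KBound (fun t u => c * k t u) (fun x => ‖c‖ * g x) :=
  ⟨h.meas.const_mul c, h.int.const_mul _, fun t u htu => by
    rw [norm_mul]; exact mul_le_mul_of_nonneg_left (h.bound t u htu) (norm_nonneg _)⟩

theorem KBound.kop_const_mul (h : KBound k g) (c : ℂ) :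
    kop (fun t u => c * k t u) = c • kop k := by
  ext1 φ
  apply Lp.ext
  filter_upwards [(h.const_mul c).kop_ae φ, h.kop_ae φ, Lp.coeFn_smul c (kop k φ)] with t h1 h2 h3
  rw [h1, smul_apply, h3, Pi.smul_apply, h2, smul_eq_mul, ← integral_const_mul]
  simp only [mul_assoc]

theorem KBound.kop_add (h₁ : KBound k₁ g₁) (h₂ : KBound k₂ g₂) :
    kop (fun t u => k₁ t u + k₂ t u) = kop k₁ + kop k₂ := by
  ext1 φ
  apply Lp.ext
  filter_upwards [(h₁.add h₂).kop_ae φ, h₁.kop_ae φ, h₂.kop_ae φ,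
    Lp.coeFn_add (kop k₁ φ) (kop k₂ φ), h₁.ae_integrable (Lp.memLp φ),
    h₂.ae_integrable (Lp.memLp φ)] with t h1 h2 h3 h4 h5 h6
  rw [h1, add_apply, h4, Pi.add_apply, h2, h3, ← integral_add h5 h6]
  simp only [add_mul]

theorem KBound.kop_sub (h₁ : KBound k₁ g₁) (h₂ : KBound k₂ g₂) :
    kop (fun t u => k₁ t u - k₂ t u) = kop k₁ - kop k₂ := by
  have := h₁.kop_add (h₂.const_mul (-1))
  rw [h₂.kop_const_mul] at this
  simpa [sub_eq_add_neg] using this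

/-- Composition of integral operators. -/
theorem KBound.kop_comp (h₁ : KBound k₁ g₁) (h₂ : KBound k₂ g₂) (h₃ : KBound k₃ g₃)
    (h : ∀ t, ∀ᵐ v, ∫ u, k₁ t u * k₂ u v = k₃ t v) : kop k₁ * kop k₂ = kop k₃ := by
  ext1 φ
  apply Lp.ext
  have hφ := Lp.memLp φ
  -- The integral of `|k₂| |φ|` is again in `L²`, so integrating it against `|k₁|` is finite almost
  -- everywhere. This is the joint integrability that Fubini needs below.
  have habs : MemLp (fun u => (∫⁻ v, ‖k₂ u v‖ₑ * ‖φ v‖ₑ).toReal) 2 := by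
    have hm : AEMeasurable (fun u => ∫⁻ v, ‖k₂ u v‖ₑ * ‖φ v‖ₑ) :=
      (h₂.measurable_enorm.aemeasurable.mul (hφ.1.enorm.comp_snd)).lintegral_prod_right'
    refine memLp_two_of_lintegral_lt_top hm.ennreal_toReal.aestronglyMeasurable ?_
    refine lt_of_le_of_lt (lintegral_mono fun u => ?_)
      ((h₂.lintegral_sq_le hφ.1.enorm).trans_lt (ENNReal.mul_lt_top
        (ENNReal.pow_lt_top h₂.lintegral_ne_top.lt_top) (lintegral_sq_lt_top_of_memLp hφ)))
    refine pow_le_pow_left' ?_ 2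
    rw [Real.enorm_eq_ofReal ENNReal.toReal_nonneg]
    exact ENNReal.ofReal_toReal_le
  have hfin : ∀ᵐ t, ∫⁻ u, ∫⁻ v, ‖k₁ t u‖ₑ * (‖k₂ u v‖ₑ * ‖φ v‖ₑ) < ∞ := by
    filter_upwards [h₁.lintegral_mul_lt_top habs.ofReal (φ := fun u => ((∫⁻ v, ‖k₂ u v‖ₑ * ‖φ v‖ₑ).toReal : ℂ))] with t ht
    refine lt_of_le_of_lt (lintegral_mono_ae ?_) ht
    filter_upwards [h₂.lintegral_mul_lt_top hφ] with u hu
    rw [lintegral_const_mul' _ _ enorm_ne_top]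
    refine mul_le_mul_right (le_of_eq ?_) _
    rw [← ofReal_norm, Complex.norm_real, Real.norm_of_nonneg ENNReal.toReal_nonneg,
      ENNReal.ofReal_toReal hu.ne]
  filter_upwards [h₁.kop_ae (kop k₂ φ), h₃.kop_ae φ, hfin] with t h4 h5 h6
  rw [mul_apply_eq_comp, h4, h5]
  have hmeas : AEStronglyMeasurable (fun p : ℝ × ℝ => k₁ t p.1 * (k₂ p.1 p.2 * φ p.2))
      (volume.prod volume) := by
    refine AEStronglyMeasurable.mul ?_ (h₂.meas.aestronglyMeasurable.mul hφ.1.comp_snd)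
    exact ((h₁.meas.comp measurable_prodMk_left).comp measurable_fst).aestronglyMeasurable
  have hint : Integrable (fun p : ℝ × ℝ => k₁ t p.1 * (k₂ p.1 p.2 * φ p.2))
      (volume.prod volume) := by
    refine ⟨hmeas, ?_⟩
    rw [HasFiniteIntegral, lintegral_prod _ hmeas.enorm]
    simpa [enorm_mul] using h6
  calc ∫ u, k₁ t u * (kop k₂ φ) u = ∫ u, ∫ v, k₁ t u * (k₂ u v * φ v) := by
        refine integral_congr_ae ?_
        filter_upwards [h₂.kop_ae φ] with u hu
        rw [hu, integral_const_mul]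
    _ = ∫ v, ∫ u, k₁ t u * (k₂ u v * φ v) := integral_integral_swap hint
    _ = ∫ v, k₃ t v * φ v := by
        refine integral_congr_ae ?_
        filter_upwards [h t] with v hv
        rw [← hv, ← integral_mul_const]
        simp only [mul_assoc]

end Schur

/-! ### Holomorphic dependence of integral operators on a parameter. -/

section Analytic

/-- A common majorant upgrades pointwise holomorphy to holomorphy in operator norm. On a ball of
radius `R` the Cauchy estimate bounds the derivative and the higher-order Schwarz lemma bounds the
Taylor remainder of each kernel value by `4 g (‖z - z₀‖ / R)²`; the Schur bound makes this an
operator bound of order `‖z - z₀‖²`. -/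
theorem kop_differentiableOn {U : Set ℂ} (hU : IsOpen U) {k : ℂ → ℝ → ℝ → ℂ} {g : ℝ → ℝ}
    (hk : ∀ z ∈ U, KBound (k z) g)
    (hd : ∀ t u, t ≠ u → DifferentiableOn ℂ (fun z => k z t u) U) :
    DifferentiableOn ℂ (fun z => kop (k z)) U := by
  intro z₀ hz₀
  obtain ⟨R, hR, hRU⟩ := Metric.isOpen_iff.1 hU z₀ hz₀
  -- The shift by `2` keeps the sample points inside the open ball, also for `n = 0`.
  have hmem : ∀ n : ℕ, z₀ + ((R / (n + 2) : ℝ) : ℂ) ∈ U := fun n => hRU <| by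
    rw [Metric.mem_ball, dist_eq_norm, add_sub_cancel_left, Complex.norm_real,
      Real.norm_of_nonneg (by positivity)]
    exact div_lt_self hR (by have : (0 : ℝ) ≤ n := n.cast_nonneg
                             linarith)
  set k' : ℝ → ℝ → ℂ := fun t u => if t = u then 0 else deriv (fun z => k z t u) z₀ with hk'
  have hmaps : ∀ t u, t ≠ u → Set.MapsTo (fun z => k z t u) (Metric.ball z₀ R)
      (Metric.closedBall (k z₀ t u) (2 * g (t - u))) := by
    intro t u htu z hz
    rw [mem_closedBall_iff_norm, two_mul]
    exact (norm_sub_le _ _).trans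
      (add_le_add ((hk z (hRU hz)).bound t u htu) ((hk z₀ hz₀).bound t u htu))
  have hderiv : ∀ t u, t ≠ u → HasDerivAt (fun z => k z t u) (k' t u) z₀ := by
    intro t u htu
    simp only [hk', if_neg htu]
    exact ((hd t u htu).differentiableAt (hU.mem_nhds hz₀)).hasDerivAt
  have hk'b : ∀ t u, t ≠ u → ‖k' t u‖ ≤ 2 * g (t - u) / R := by
    intro t u htu
    rw [← (hderiv t u htu).deriv]
    exact Complex.norm_deriv_le_div_of_mapsTo_ball ((hd t u htu).mono hRU) (hmaps t u htu) hR
  -- The derivative is the pointwise limit of difference quotients off the diagonal, where nothing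
  -- is assumed on the kernel.
  have hk'm : Measurable (Function.uncurry k') := by
    have hdiag : MeasurableSet {p : ℝ × ℝ | p.1 = p.2} := measurableSet_eq_fun (by fun_prop) (by fun_prop)
    refine measurable_of_tendsto_metrizable (f := fun n : ℕ => fun p : ℝ × ℝ =>
      {p : ℝ × ℝ | p.1 = p.2}ᶜ.indicator (fun p : ℝ × ℝ => (((R / (n + 2) : ℝ) : ℂ))⁻¹ *
        (Function.uncurry (k (z₀ + ((R / (n + 2) : ℝ) : ℂ))) p - Function.uncurry (k z₀) p)) p) ?_ ?_
    · intro n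
      refine Measurable.indicator ?_ hdiag.compl
      exact (((hk _ (hmem n)).meas).sub (hk _ hz₀).meas).const_mul _
    · rw [tendsto_pi_nhds]
      rintro ⟨t, u⟩
      by_cases htu : t = u
      · simp [htu, hk']
      · have hs := (hasDerivAt_iff_tendsto_slope_zero.1 (hderiv t u htu))
        have ht0 : Tendsto (fun n : ℕ => ((R / (n + 2) : ℝ) : ℂ)) atTop (𝓝[≠] 0) := by
          rw [tendsto_nhdsWithin_iff]
          refine ⟨?_, Eventually.of_forall fun n => ?_⟩
          · rw [← Complex.ofReal_zero]
            refine (Complex.continuous_ofReal.tendsto 0).comp ?_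
            exact tendsto_const_nhds.div_atTop
              (tendsto_atTop_add_const_right _ _ tendsto_natCast_atTop_atTop)
          · rw [Set.mem_compl_iff, Set.mem_singleton_iff, Complex.ofReal_eq_zero]
            positivity
        have := hs.comp ht0
        simpa [Set.indicator, htu, Function.uncurry, Function.comp_def] using this
  have hK' : KBound k' (fun x => 2 * g x / R) :=
    ⟨hk'm, ((hk z₀ hz₀).int.const_mul 2).div_const R, fun t u htu => hk'b t u htu⟩
  refine (HasDerivAt.differentiableAt (f' := kop k') ?_).differentiableWithinAt
  rw [hasDerivAt_iff_isLittleO]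
  refine Asymptotics.IsBigO.trans_isLittleO (g := fun z => ‖z - z₀‖ ^ 2) ?_
    (Asymptotics.isLittleO_pow_sub_sub z₀ one_lt_two)
  refine Asymptotics.IsBigO.of_bound (4 * (∫ x, ‖g x‖) / R ^ 2) ?_
  filter_upwards [Metric.ball_mem_nhds z₀ hR] with z hz
  have hq : ∀ t u, t ≠ u → ‖k z t u - k z₀ t u - (z - z₀) * k' t u‖ ≤
      4 * g (t - u) * (‖z - z₀‖ / R) ^ 2 := by
    intro t u htu
    have hgn : 0 ≤ g (t - u) := (norm_nonneg _).trans ((hk z₀ hz₀).bound t u htu)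
    have h0 := hderiv t u htu
    set f : ℂ → ℂ := fun w => k w t u - k z₀ t u - (w - z₀) * k' t u with hf
    have hfz : f z₀ = 0 := by simp [hf]
    have h := Complex.dist_le_mul_div_pow_of_mapsTo_ball_of_isLittleO (f := f) (c := z₀) (z := z)
      (R₁ := R) (R₂ := 4 * g (t - u)) (n := 1) ?_ ?_ ?_ hz
    · simpa [hfz, dist_eq_norm] using h
    · exact (((hd t u htu).mono hRU).sub_const _).sub (by fun_prop)
    · intro w hw
      rw [mem_closedBall_iff_norm, hfz, sub_zero]
      have h1 := mem_closedBall_iff_norm.1 (hmaps t u htu hw)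
      have h2 : ‖(w - z₀) * k' t u‖ ≤ R * (2 * g (t - u) / R) := by
        rw [norm_mul]
        exact mul_le_mul (mem_ball_iff_norm.1 hw).le (hk'b t u htu) (norm_nonneg _) hR.le
      rw [mul_div_cancel₀ _ hR.ne'] at h2
      exact (norm_sub_le _ _).trans (by linarith)
    · have := hasDerivAt_iff_isLittleO.1 h0
      simp only [hfz, sub_zero, pow_one]
      refine Asymptotics.IsLittleO.norm_right ?_
      simpa [hf] using this
  have hKB : KBound (fun t u => (k z t u - k z₀ t u) - (z - z₀) * k' t u)
      (fun x => 4 * g x * (‖z - z₀‖ / R) ^ 2) :=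
    ⟨((hk z (hRU hz)).meas.sub (hk z₀ hz₀).meas).sub (hk'm.const_mul _),
      ((hk z₀ hz₀).int.const_mul 4).mul_const _, hq⟩
  have hop : kop (k z) - kop (k z₀) - (z - z₀) • kop k' =
      kop (fun t u => (k z t u - k z₀ t u) - (z - z₀) * k' t u) := by
    have hneg := (hk z (hRU hz)).add ((hk z₀ hz₀).const_mul (-1))
    rw [← (hk z (hRU hz)).kop_sub (hk z₀ hz₀), ← hK'.kop_const_mul]
    have h1 : KBound (fun t u => k z t u - k z₀ t u) (fun x => g x + ‖(-1 : ℂ)‖ * g x) := by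
      refine ⟨(hk z (hRU hz)).meas.sub (hk z₀ hz₀).meas, hneg.int, fun t u htu => ?_⟩
      simpa [sub_eq_add_neg] using hneg.bound t u htu
    exact (h1.kop_sub (hK'.const_mul _)).symm
  rw [hop]
  refine hKB.norm_kop_le.trans (le_of_eq ?_)
  have : ∀ x, ‖4 * g x * (‖z - z₀‖ / R) ^ 2‖ = 4 / R ^ 2 * ‖z - z₀‖ ^ 2 * ‖g x‖ := by
    intro x
    rw [norm_mul, norm_mul, Real.norm_of_nonneg (by positivity : (0:ℝ) ≤ (‖z - z₀‖ / R) ^ 2)]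
    simp only [Real.norm_ofNat]
    ring
  simp only [this]
  rw [integral_const_mul, norm_pow, norm_norm]
  ring

end Analytic

/-! ### Finite-rank approximation of Hilbert–Schmidt operators. -/

section HilbertSchmidt

theorem HilbertBasis.tsum_enorm_inner_sq {ι H : Type*} [NormedAddCommGroup H]
    [InnerProductSpace ℂ H] (b : HilbertBasis ι ℂ H) (v : H) :
    ∑' i, ‖inner ℂ (b i) v‖ₑ ^ 2 = ‖v‖ₑ ^ 2 := by
  have h2 : (0 : ℝ) < (2 : ℝ≥0∞).toReal := by norm_num
  have hs := (lp.memℓp (b.repr v)).summable h2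
  have hn := lp.norm_rpow_eq_tsum h2 (b.repr v)
  rw [b.repr.norm_map] at hn
  simp only [b.repr_apply_apply, ENNReal.toReal_ofNat, Real.rpow_two] at hs hn
  rw [← ofReal_norm, ← ENNReal.ofReal_pow (norm_nonneg _), hn,
    ENNReal.ofReal_tsum_of_nonneg (fun i => by positivity) hs]
  refine tsum_congr fun i => ?_
  rw [ENNReal.ofReal_pow (norm_nonneg _), ofReal_norm]

/-- Distinct vectors lie at distance `√2`, so balls of radius `1/2` around them are disjoint and
open. Countability permits exchanging sums over a basis with integrals and almost-everywhere
statements. -/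
theorem Orthonormal.countable_of_separable {ι H : Type*} [NormedAddCommGroup H]
    [InnerProductSpace ℂ H] [TopologicalSpace.SeparableSpace H] {b : ι → H}
    (hb : Orthonormal ℂ b) : Countable ι := by
  have hdist : ∀ i j, i ≠ j → 1 < dist (b i) (b j) := by
    intro i j hij
    have h1 : ‖b i - b j‖ ^ 2 = 2 := by
      rw [@norm_sub_sq ℂ, hb.2 hij, hb.1, hb.1]; norm_num
    rw [dist_eq_norm]
    nlinarith [norm_nonneg (b i - b j)]
  have hpd : Pairwise (Function.onFun Disjoint fun i => Metric.ball (b i) (1 / 2)) := by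
    intro i j hij
    refine Metric.ball_disjoint_ball ?_
    have := hdist i j hij
    linarith
  exact hpd.countable_of_isOpen_disjoint (fun _ => Metric.isOpen_ball)
    (fun i => ⟨b i, Metric.mem_ball_self (by norm_num)⟩)

theorem Orthonormal.enorm_sub_sum_sq {ι H : Type*} [NormedAddCommGroup H]
    [InnerProductSpace ℂ H] {b : ι → H} (hb : Orthonormal ℂ b) (F : Finset ι) (v : H) :
    ‖v - ∑ i ∈ F, inner ℂ (b i) v • b i‖ₑ ^ 2 + ∑ i ∈ F, ‖inner ℂ (b i) v‖ₑ ^ 2 = ‖v‖ₑ ^ 2 := by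
  set p := ∑ i ∈ F, inner ℂ (b i) v • b i with hp
  have hpp : inner ℂ p p = ((∑ i ∈ F, ‖inner ℂ (b i) v‖ ^ 2 : ℝ) : ℂ) := by
    rw [hp, hb.inner_sum]
    push_cast
    refine Finset.sum_congr rfl fun i _ => ?_
    rw [← Complex.conj_mul']
  have hpv : inner ℂ p v = ((∑ i ∈ F, ‖inner ℂ (b i) v‖ ^ 2 : ℝ) : ℂ) := by
    rw [hp, sum_inner]
    push_cast
    refine Finset.sum_congr rfl fun i _ => ?_
    rw [inner_smul_left, ← Complex.conj_mul']
  have hreal : ‖v - p‖ ^ 2 + ∑ i ∈ F, ‖inner ℂ (b i) v‖ ^ 2 = ‖v‖ ^ 2 := by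
    have h1 : ‖p‖ ^ 2 = ∑ i ∈ F, ‖inner ℂ (b i) v‖ ^ 2 := by
      rw [← inner_self_eq_norm_sq (𝕜 := ℂ), hpp]; exact Complex.ofReal_re _
    have h2 : RCLike.re (inner ℂ v p) = ∑ i ∈ F, ‖inner ℂ (b i) v‖ ^ 2 := by
      rw [inner_re_symm, hpv]; exact Complex.ofReal_re _
    rw [@norm_sub_sq ℂ, h1, h2]; ring
  simp only [← ofReal_norm, ← ENNReal.ofReal_pow (norm_nonneg _)]
  rw [← ENNReal.ofReal_sum_of_nonneg (fun i _ => by positivity),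
    ← ENNReal.ofReal_add (by positivity) (Finset.sum_nonneg fun i _ => by positivity), hreal]

variable {k : ℝ → ℝ → ℂ} {g : ℝ → ℝ}

/-- Almost every row of the kernel is square-integrable, and its conjugate is the Riesz vector `v
t`. -/
theorem KBound.ae_inner_eq (h : KBound k g) (hHS : ∫⁻ t, ∫⁻ u, ‖k t u‖ₑ ^ 2 < ∞) :
    ∃ v : ℝ → L2, (∀ᵐ t, ‖v t‖ₑ ^ 2 = ∫⁻ u, ‖k t u‖ₑ ^ 2) ∧
      ∀ φ : L2, ∀ᵐ t, kop k φ t = inner ℂ (v t) φ := by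
  classical
  have hm : ∀ t, AEStronglyMeasurable (fun u => (starRingEnd ℂ) (k t u)) := fun t =>
    (Complex.continuous_conj.measurable.comp
      (h.meas.comp measurable_prodMk_left)).aestronglyMeasurable
  have hae : ∀ᵐ t, ∫⁻ u, ‖k t u‖ₑ ^ 2 < ∞ :=
    ae_lt_top (h.measurable_enorm.pow_const 2).lintegral_prod_right' hHS.ne
  have hmem : ∀ t, ∫⁻ u, ‖k t u‖ₑ ^ 2 < ∞ → MemLp (fun u => (starRingEnd ℂ) (k t u)) 2 := by
    intro t ht
    refine memLp_two_of_lintegral_lt_top (hm t) ?_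
    simpa [← ofReal_norm] using ht
  refine ⟨fun t => if ht : ∫⁻ u, ‖k t u‖ₑ ^ 2 < ∞ then (hmem t ht).toLp else 0, ?_, ?_⟩
  · filter_upwards [hae] with t ht
    rw [dif_pos ht, Lp.enorm_toLp, eLpNorm_two_eq, ← ENNReal.rpow_natCast, ← ENNReal.rpow_mul]
    norm_num
  · intro φ
    filter_upwards [hae, h.kop_ae φ] with t ht hφ
    rw [hφ, dif_pos ht, L2.inner_def]
    refine integral_congr_ae ?_
    filter_upwards [(hmem t ht).coeFn_toLp] with u hu
    rw [hu, RCLike.inner_apply]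
    simp [mul_comm]

/-- Hilbert–Schmidt operators are limits of operators of finite rank. -/
theorem KBound.exists_finiteRank_approx (h : KBound k g)
    (hHS : ∫⁻ t, ∫⁻ u, ‖k t u‖ₑ ^ 2 < ∞) {ε : ℝ} (hε : 0 < ε) :
    ∃ (n : ℕ) (A : L2 →L[ℂ] (Fin n → ℂ)) (L : (Fin n → ℂ) →L[ℂ] L2),
      ‖kop k - L.comp A‖ ≤ ε := by
  obtain ⟨v, hv, hK⟩ := h.ae_inner_eq hHS
  obtain ⟨w, b, -⟩ := exists_hilbertBasis ℂ L2
  have : Fact ((1 : ℝ≥0∞) ≤ 2) := ⟨by norm_num⟩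
  have : Fact ((2 : ℝ≥0∞) ≠ ∞) := ⟨by norm_num⟩
  have hcount : Countable w := Orthonormal.countable_of_separable b.orthonormal
  set S := ∫⁻ t, ∫⁻ u, ‖k t u‖ₑ ^ 2 with hS
  have hSv : S = ∫⁻ t, ‖v t‖ₑ ^ 2 := lintegral_congr_ae (hv.mono fun t ht => ht.symm)
  have hκm : ∀ i : w, AEMeasurable (fun t => ‖kop k (b i) t‖ₑ ^ 2) := fun i =>
    (Lp.aestronglyMeasurable (kop k (b i))).enorm.pow_const 2
  have hKall : ∀ᵐ t, ∀ i : w, ‖kop k (b i) t‖ₑ = ‖inner ℂ (b i) (v t)‖ₑ := by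
    refine ae_all_iff.2 fun i => ?_
    filter_upwards [hK (b i)] with t ht
    rw [ht, ← ofReal_norm, norm_inner_symm, ofReal_norm]
  have hsum : ∑' i : w, ∫⁻ t, ‖kop k (b i) t‖ₑ ^ 2 = S := by
    rw [← lintegral_tsum hκm, hSv]
    refine lintegral_congr_ae ?_
    filter_upwards [hKall] with t ht
    simp only [ht, HilbertBasis.tsum_enorm_inner_sq]
  -- `S` is the sum of `‖K bᵢ‖²` over the basis, so a finite set `F` leaves a tail below `ε²`.
  obtain ⟨F, hF⟩ : ∃ F : Finset w, S < ∑ i ∈ F, (∫⁻ t, ‖kop k (b i) t‖ₑ ^ 2) + ENNReal.ofReal ε ^ 2 := by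
    have ht : Tendsto (fun F : Finset w => ∑ i ∈ F, (∫⁻ t, ‖kop k (b i) t‖ₑ ^ 2) + ENNReal.ofReal ε ^ 2) atTop
        (𝓝 (S + ENNReal.ofReal ε ^ 2)) := by
      rw [← hsum]
      exact Tendsto.add ENNReal.summable.hasSum tendsto_const_nhds
    have hlt : S < S + ENNReal.ofReal ε ^ 2 :=
      ENNReal.lt_add_right hHS.ne (by simpa using hε)
    exact (ht.eventually (lt_mem_nhds hlt)).exists
  -- `P` projects away from the span of `F`, and `K - KP` has finite rank. Since `(KPφ)(t) = ⟨P
  -- v(t), φ⟩`, the integral of `‖P v(t)‖²` bounds `‖KP‖²`.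
  set P : L2 → L2 := fun φ => φ - ∑ i ∈ F, inner ℂ (b i) φ • b i with hP
  have hPint : ∫⁻ t, ‖P (v t)‖ₑ ^ 2 ≤ ENNReal.ofReal ε ^ 2 := by
    have h1 : ∫⁻ t, (‖P (v t)‖ₑ ^ 2 + ∑ i ∈ F, ‖kop k (b i) t‖ₑ ^ 2) = S := by
      rw [hSv]
      refine lintegral_congr_ae ?_
      filter_upwards [hKall] with t ht
      simp only [ht]
      exact Orthonormal.enorm_sub_sum_sq b.orthonormal F (v t)
    rw [lintegral_add_right' _ (Finset.aemeasurable_fun_sum _ fun i _ => hκm i),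
      lintegral_finsetSum' _ fun i _ => hκm i] at h1
    rw [← h1, add_comm] at hF
    exact (lt_of_add_lt_add_left hF).le
  set e := F.equivFin.symm
  refine ⟨F.card, ContinuousLinearMap.pi fun i => innerSL ℂ (b (e i)),
    ∑ i, (ContinuousLinearMap.proj (R := ℂ) (φ := fun _ : Fin F.card => ℂ) i).smulRight
      (kop k (b (e i))), ?_⟩
  refine ContinuousLinearMap.opNorm_le_bound _ hε.le fun φ => ?_
  have hop : (kop k - (∑ i, (ContinuousLinearMap.proj (R := ℂ) (φ := fun _ : Fin F.card => ℂ) i).smulRight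
      (kop k (b (e i)))).comp (ContinuousLinearMap.pi fun i => innerSL ℂ (b (e i)))) φ =
      kop k (P φ) := by
    have : ∑ i ∈ F, inner ℂ (b i) φ • kop k (b i) =
        ∑ i, inner ℂ (b (e i)) φ • kop k (b (e i)) := by
      rw [← Finset.sum_coe_sort, ← Equiv.sum_comp e]
    simp only [hP, map_sub, map_sum, map_smul, this]
    simp
  rw [hop]
  have hPsymm : ∀ x y : L2, inner ℂ x (P y) = inner ℂ (P x) y := by
    intro x y
    simp only [hP, inner_sub_left, inner_sub_right, inner_sum, sum_inner, inner_smul_left,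
      inner_smul_right, inner_conj_symm]
    congr 1
    exact Finset.sum_congr rfl fun i _ => mul_comm _ _
  have hfin : ‖kop k (P φ)‖ₑ ≤ ENNReal.ofReal ε * ‖φ‖ₑ := by
    have h1 : ∫⁻ t, ‖kop k (P φ) t‖ₑ ^ 2 ≤ (ENNReal.ofReal ε * ‖φ‖ₑ) ^ 2 := by
      calc ∫⁻ t, ‖kop k (P φ) t‖ₑ ^ 2 ≤ ∫⁻ t, ‖P (v t)‖ₑ ^ 2 * ‖φ‖ₑ ^ 2 := by
            refine lintegral_mono_ae ?_
            filter_upwards [hK (P φ)] with t ht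
            rw [ht, hPsymm, ← mul_pow]
            refine pow_le_pow_left' ?_ 2
            simp only [← ofReal_norm]
            rw [← ENNReal.ofReal_mul (norm_nonneg _)]
            exact ENNReal.ofReal_le_ofReal (norm_inner_le_norm _ _)
        _ = (∫⁻ t, ‖P (v t)‖ₑ ^ 2) * ‖φ‖ₑ ^ 2 :=
            lintegral_mul_const' _ _ (ENNReal.pow_ne_top enorm_ne_top)
        _ ≤ ENNReal.ofReal ε ^ 2 * ‖φ‖ₑ ^ 2 := by gcongr
        _ = _ := by rw [mul_pow]
    rw [Lp.enorm_def, eLpNorm_two_eq]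
    calc _ ≤ ((ENNReal.ofReal ε * ‖φ‖ₑ) ^ 2) ^ (1 / 2 : ℝ) := by gcongr
      _ = _ := by
        rw [← ENNReal.rpow_natCast, ← ENNReal.rpow_mul]; norm_num
  rw [← ofReal_norm, ← ofReal_norm, ← ENNReal.ofReal_mul hε.le] at hfin
  exact (ENNReal.ofReal_le_ofReal_iff (by positivity)).1 hfin

end HilbertSchmidt

/-! ### Elementary estimates for curves with exponentially decaying derivatives. -/

section Geometry

variable {E : Type*} [NormedAddCommGroup E] [NormedSpace ℝ E]

theorem norm_sub_le_of_deriv_exp_decay {f f' : ℝ → E} {C b : ℝ} (hb : 0 < b)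
    (hf : ∀ s, HasDerivAt f (f' s) s) (hf' : ∀ s, 0 ≤ s → ‖f' s‖ ≤ C * Real.exp (-b * s))
    {u t : ℝ} (hu : 0 ≤ u) (hut : u ≤ t) :
    ‖f t - f u‖ ≤ C / b * (Real.exp (-b * u) - Real.exp (-b * t)) := by
  have hB : ∀ s, HasDerivAt (fun s => C / b * (Real.exp (-b * u) - Real.exp (-b * s)))
      (C * Real.exp (-b * s)) s := by
    intro s
    have h1 : HasDerivAt (fun s => Real.exp (-b * s)) (Real.exp (-b * s) * (-b)) s := by
      simpa using ((hasDerivAt_id s).const_mul (-b)).exp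
    convert! ((h1.const_sub (Real.exp (-b * u))).const_mul (C / b)) using 1
    field_simp
  have h := image_norm_le_of_norm_deriv_right_le_deriv_boundary (f := fun s => f s - f u)
    (f' := f') (a := u) (b := t) (B := fun s => C / b * (Real.exp (-b * u) - Real.exp (-b * s)))
    (B' := fun s => C * Real.exp (-b * s))
    (fun s _ => ((hf s).sub_const _).continuousAt.continuousWithinAt)
    (fun s _ => ((hf s).sub_const _).hasDerivWithinAt) (by simp)
    hB (fun s hs => hf' s (hu.trans hs.1))
  exact h ⟨hut, le_rfl⟩

theorem exp_sub_exp_le {b : ℝ} {u t : ℝ} :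
    Real.exp (-b * u) - Real.exp (-b * t) ≤ b * (t - u) * Real.exp (-b * u) := by
  have h1 : Real.exp (-b * t) = Real.exp (-b * u) * Real.exp (-(b * (t - u))) := by
    rw [← Real.exp_add]; ring_nf
  have h2 := Real.add_one_le_exp (-(b * (t - u)))
  rw [h1]
  nlinarith [Real.exp_pos (-b * u)]

theorem exists_limit_of_deriv_exp_decay [CompleteSpace E] {f f' : ℝ → E} {C b : ℝ} (hb : 0 < b)
    (hC : 0 ≤ C) (hf : ∀ s, HasDerivAt f (f' s) s)
    (hf' : ∀ s, 0 ≤ s → ‖f' s‖ ≤ C * Real.exp (-b * s)) :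
    ∃ v, ∀ t, 0 ≤ t → ‖f t - v‖ ≤ C / b * Real.exp (-b * t) := by
  have hle : ∀ u t, 0 ≤ u → u ≤ t → ‖f u - f t‖ ≤ C / b * Real.exp (-b * u) := by
    intro u t hu hut
    rw [norm_sub_rev]
    refine (norm_sub_le_of_deriv_exp_decay hb hf hf' hu hut).trans ?_
    have := Real.exp_pos (-b * t)
    gcongr
    linarith
  have hlim : Tendsto (fun n : ℕ => C / b * Real.exp (-b * n)) atTop (𝓝 0) := by
    rw [← mul_zero (C / b)]
    refine Tendsto.const_mul _ (Real.tendsto_exp_atBot.comp ?_)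
    exact Tendsto.const_mul_atTop_of_neg (by linarith) tendsto_natCast_atTop_atTop
  have hc : CauchySeq fun n : ℕ => f n := by
    refine cauchySeq_of_le_tendsto_0' (fun n : ℕ => C / b * Real.exp (-b * n)) ?_ hlim
    intro n m hnm
    rw [dist_eq_norm]
    exact hle n m n.cast_nonneg (by exact_mod_cast hnm)
  obtain ⟨v, hv⟩ := cauchySeq_tendsto_of_complete hc
  refine ⟨v, fun t ht => ?_⟩
  refine le_of_tendsto (tendsto_const_nhds.sub hv).norm ?_
  filter_upwards [eventually_ge_atTop ⌈t⌉₊] with n hn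
  exact hle t n ht (Nat.ceil_le.1 hn)

/-- The difference of the squares of the two sides is `(1 - ⟨v, w⟩)(t - s)²/2`. Applied to the two
asymptotic directions, it shows that the ends of the curve separate linearly. -/
theorem norm_smul_add_smul_ge {F : Type*} [NormedAddCommGroup F] [InnerProductSpace ℝ F] {v w : F}
    (hv : ‖v‖ = 1) (hw : ‖w‖ = 1) (t s : ℝ) :
    ‖v + w‖ / 2 * (t + s) ≤ ‖t • v + s • w‖ := by
  have h1 : ‖v + w‖ ^ 2 = 2 + 2 * inner ℝ v w := by
    rw [norm_add_sq_real, hv, hw]; ring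
  have h2 : ‖t • v + s • w‖ ^ 2 = t ^ 2 + s ^ 2 + 2 * (t * s) * inner ℝ v w := by
    rw [norm_add_sq_real, norm_smul, norm_smul, hv, hw, inner_smul_left, inner_smul_right]
    simp only [Real.norm_eq_abs, mul_one, sq_abs, conj_trivial]
    ring
  have h3 : inner ℝ v w ≤ 1 := by
    have := real_inner_le_norm v w
    rwa [hv, hw, mul_one] at this
  refine le_of_sq_le_sq ?_ (norm_nonneg _)
  rw [h2, mul_pow, div_pow, h1]
  nlinarith [mul_nonneg (sub_nonneg.2 h3) (sq_nonneg (t - s))]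

end Geometry

/-! ### Chord length against arc length on the interface. -/

section Interface

variable {γ : ℝ → Plane}

theorem IsInterface.hasDerivAt (h : IsInterface γ) (t : ℝ) : HasDerivAt γ (deriv γ t) t :=
  ((h.smooth.differentiable (by simp)) t).hasDerivAt

theorem IsInterface.hasDerivAt_deriv (h : IsInterface γ) (t : ℝ) :
    HasDerivAt (deriv γ) (iteratedDeriv 2 γ t) t := by
  have h1 : Differentiable ℝ (iteratedDeriv 1 γ) :=
    h.smooth.differentiable_iteratedDeriv 1 (by exact_mod_cast ENat.natCast_lt_top 1)
  have h2 : iteratedDeriv 2 γ = deriv (deriv γ) := by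
    rw [iteratedDeriv_succ, iteratedDeriv_one]
  rw [h2]
  rw [iteratedDeriv_one] at h1
  exact (h1 t).hasDerivAt

theorem IsInterface.continuous (h : IsInterface γ) : Continuous γ := h.smooth.continuous

theorem IsInterface.norm_chord_le (h : IsInterface γ) (t u : ℝ) : ‖γ t - γ u‖ ≤ |t - u| := by
  have := convex_univ.norm_image_sub_le_of_norm_hasDerivWithin_le (f := γ) (f' := deriv γ) (C := 1)
    (fun x _ => (h.hasDerivAt x).hasDerivWithinAt) (fun x _ => (h.unit_speed x).le)
    (Set.mem_univ u) (Set.mem_univ t)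
  simpa using this

theorem IsInterface.exists_curvature_bound (h : IsInterface γ) :
    ∃ C b : ℝ, 0 < C ∧ 0 < b ∧ ∀ t, ‖iteratedDeriv 2 γ t‖ ≤ C * Real.exp (-b * |t|) := by
  obtain ⟨C₀, hC₀, β, hβ, hb⟩ := h.curvature_decay
  -- The hypothesis controls the square of the curvature; the square root halves the rate.
  refine ⟨√C₀, β / 2, Real.sqrt_pos.2 hC₀, by positivity, fun t => ?_⟩
  refine le_of_sq_le_sq ?_ (by positivity)
  rw [mul_pow, Real.sq_sqrt hC₀.le, ← Real.exp_nat_mul]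
  have := hb t
  have h2 : ((2 : ℕ) : ℝ) * (-(β / 2) * |t|) = -β * |t| := by push_cast; ring
  rw [h2]
  linarith [norm_nonneg (iteratedDeriv 3 γ t)]

/-- Reversal reduces statements about the negative half-line to the positive one. -/
theorem IsInterface.reverse (h : IsInterface γ) : IsInterface (fun t => γ (-t)) := by
  have hd : ∀ n t, iteratedDeriv n (fun t => γ (-t)) t = (-1 : ℝ) ^ n • iteratedDeriv n γ (-t) :=
    fun n t => iteratedDeriv_comp_neg n γ t
  refine ⟨h.smooth.comp contDiff_neg, h.injective.comp neg_injective, fun t => ?_, ?_, ?_, ?_, ?_⟩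
  · have := hd 1 t
    rw [iteratedDeriv_one, iteratedDeriv_one] at this
    rw [this, norm_smul, h.unit_speed]; simp
  · obtain ⟨C₀, hC₀, β, hβ, hb⟩ := h.curvature_decay
    refine ⟨C₀, hC₀, β, hβ, fun t => ?_⟩
    rw [hd, hd, norm_smul, norm_smul]
    simpa using hb (-t)
  · exact h.tendsto_norm_atBot
  · simpa using h.tendsto_norm_atTop
  · simpa [norm_sub_rev] using h.tendsto_norm_sub

/-- Asymptotic directions: a bound for the deviation of the curve from its asymptote. -/
theorem IsInterface.exists_asymptote (h : IsInterface γ) :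
    ∃ v : Plane, ‖v‖ = 1 ∧ ∃ C b : ℝ, 0 < C ∧ 0 < b ∧ ∀ u t, 0 ≤ u → u ≤ t →
      ‖γ t - γ u - (t - u) • v‖ ≤ C / b * (Real.exp (-b * u) - Real.exp (-b * t)) := by
  obtain ⟨C, b, hC, hb, hcurv⟩ := h.exists_curvature_bound
  obtain ⟨v, hv⟩ := exists_limit_of_deriv_exp_decay hb hC.le h.hasDerivAt_deriv
    (fun s hs => by simpa [abs_of_nonneg hs] using hcurv s)
  have hlim : Tendsto (fun n : ℕ => C / b * Real.exp (-b * n)) atTop (𝓝 0) := by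
    rw [← mul_zero (C / b)]
    refine Tendsto.const_mul _ (Real.tendsto_exp_atBot.comp ?_)
    exact Tendsto.const_mul_atTop_of_neg (by linarith) tendsto_natCast_atTop_atTop
  refine ⟨v, ?_, C / b, b, by positivity, hb, ?_⟩
  · have ht : Tendsto (fun n : ℕ => deriv γ n) atTop (𝓝 v) :=
      tendsto_iff_norm_sub_tendsto_zero.2 (squeeze_zero (fun _ => norm_nonneg _)
        (fun n => hv n n.cast_nonneg) hlim)
    refine tendsto_nhds_unique ht.norm ?_
    simp only [h.unit_speed]
    exact tendsto_const_nhds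
  · intro u t hu hut
    -- The curve minus its asymptotic line has derivative `γ' - v`, already known to decay
    -- exponentially.
    have := norm_sub_le_of_deriv_exp_decay (f := fun s => γ s - s • v)
      (f' := fun s => deriv γ s - v) hb
      (fun s => by simpa using (h.hasDerivAt s).fun_sub ((hasDerivAt_id s).smul_const v)) hv hu hut
    refine le_trans (le_of_eq ?_) this
    congr 1
    module

/-- The chord length is close to the arc length for two points on the same side of the origin. -/
theorem IsInterface.exists_chord_bound_nonneg (h : IsInterface γ) :
    ∃ v : Plane, ‖v‖ = 1 ∧ ∃ C b : ℝ, 0 < C ∧ 0 < b ∧ (∀ t, 0 ≤ t → ‖γ t - γ 0 - t • v‖ ≤ C) ∧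
      ∀ t u, 0 ≤ t → 0 ≤ u → |t - u| - ‖γ t - γ u‖ ≤ C ∧
        |t - u| - ‖γ t - γ u‖ ≤ C * |t - u| * Real.exp (-b * min |t| |u|) := by
  obtain ⟨v, hv, C, b, hC, hb, hest⟩ := h.exists_asymptote
  have key : ∀ u t, 0 ≤ u → u ≤ t → ‖γ t - γ u - (t - u) • v‖ ≤ C / b ∧
      ‖γ t - γ u - (t - u) • v‖ ≤ C * (t - u) * Real.exp (-b * u) := by
    intro u t hu hut
    have h1 := hest u t hu hut
    constructor
    · refine h1.trans (mul_le_of_le_one_right (by positivity) ?_)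
      have h2 : Real.exp (-b * u) ≤ 1 := Real.exp_le_one_iff.2 (by nlinarith)
      linarith [Real.exp_pos (-b * t)]
    · refine h1.trans ((mul_le_mul_of_nonneg_left exp_sub_exp_le (by positivity)).trans_eq ?_)
      field_simp
  have hmono : ∀ u t, 0 ≤ u → u ≤ t → |t - u| - ‖γ t - γ u‖ ≤ max C (C / b) ∧
        |t - u| - ‖γ t - γ u‖ ≤ max C (C / b) * |t - u| * Real.exp (-b * min |t| |u|) := by
    intro u t hu hut
    obtain ⟨h1, h2⟩ := key u t hu hut
    have h3 : |t - u| - ‖γ t - γ u‖ ≤ ‖γ t - γ u - (t - u) • v‖ := by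
      have := norm_sub_norm_le ((t - u) • v) (γ t - γ u)
      rwa [norm_smul, hv, mul_one, Real.norm_eq_abs, norm_sub_rev ((t - u) • v)] at this
    rw [abs_of_nonneg (sub_nonneg.2 hut)] at h3 ⊢
    refine ⟨h3.trans (h1.trans (le_max_right _ _)), h3.trans (h2.trans ?_)⟩
    rw [abs_of_nonneg hu, abs_of_nonneg (hu.trans hut), min_eq_right hut]
    have := sub_nonneg.2 hut
    gcongr
    exact le_max_left _ _
  refine ⟨v, hv, max C (C / b), b, lt_max_of_lt_left hC, hb, ?_, ?_⟩
  · intro t ht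
    simpa using (key 0 t le_rfl ht).1.trans (le_max_right C (C / b))
  · intro t u ht hu
    rcases le_total u t with hut | hut
    · exact hmono u t hu hut
    · rw [abs_sub_comm, norm_sub_rev, min_comm]
      exact hmono t u ht hut

/-- On one side of the origin both points follow the same asymptote. On opposite sides the
separation is linear with slope `κ = ‖v - w‖/2`, where `w` is the direction of the reversed curve;
`v = w` would keep `γ(t) - γ(-t)` bounded. -/
theorem IsInterface.exists_chord_bound (h : IsInterface γ) :
    ∃ C b κ : ℝ, 1 ≤ C ∧ 0 < b ∧ 0 < κ ∧ κ ≤ 1 ∧ (∀ t u, κ * |t - u| - C ≤ ‖γ t - γ u‖) ∧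
      ∀ t u, 0 ≤ t * u →
        |t - u| - ‖γ t - γ u‖ ≤ C * |t - u| * Real.exp (-b * min |t| |u|) := by
  obtain ⟨v, hv, C₁, b₁, hC₁, hb₁, hv0, hp⟩ := h.exists_chord_bound_nonneg
  obtain ⟨w, hw, C₂, b₂, hC₂, hb₂, hw0, hn⟩ := h.reverse.exists_chord_bound_nonneg
  have hopp : ∀ t s, 0 ≤ t → 0 ≤ s →
      |‖γ t - γ (-s)‖ - ‖t • v + s • (-w)‖| ≤ C₁ + C₂ := by
    intro t s ht hs
    have h1 := hv0 t ht
    have h2 := hw0 s hs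
    have e : γ t - γ (-s) - (t • v + s • (-w)) =
        (γ t - γ 0 - t • v) - (γ (-s) - γ (-0) - s • w) := by
      simp only [neg_zero]; module
    refine (abs_norm_sub_norm_le _ _).trans ?_
    rw [e]
    exact (norm_sub_le _ _).trans (add_le_add h1 h2)
  have hne : 0 < ‖v + -w‖ := by
    rw [norm_pos_iff]
    intro h0
    have hbd : ∀ t, 0 ≤ t → ‖γ t - γ (-t)‖ ≤ C₁ + C₂ := by
      intro t ht
      have := hopp t t ht ht
      rw [← smul_add, h0, smul_zero, norm_zero, sub_zero, abs_of_nonneg (norm_nonneg _)] at this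
      exact this
    obtain ⟨t, ht, ht0⟩ := ((h.tendsto_norm_sub.eventually_gt_atTop (C₁ + C₂)).and
      (eventually_ge_atTop 0)).exists
    exact absurd (hbd t ht0) (not_le.2 ht)
  set κ := ‖v + -w‖ / 2 with hκ
  have hκ1 : κ ≤ 1 := by
    have := norm_add_le v (-w)
    rw [norm_neg, hv, hw] at this
    rw [hκ]; linarith
  have hopp' : ∀ t s, 0 ≤ t → 0 ≤ s → κ * (t + s) - (C₁ + C₂) ≤ ‖γ t - γ (-s)‖ := by
    intro t s ht hs
    have h1 := (abs_le.1 (hopp t s ht hs)).1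
    have h2 := norm_smul_add_smul_ge hv (by rw [norm_neg, hw] : ‖-w‖ = 1) t s
    rw [← hκ] at h2
    linarith
  -- The `1` in the maximum is used in `IsInterface.exists_geometry` for points on opposite sides,
  -- where the exponential factor equals `1`.
  refine ⟨max 1 (C₁ + C₂), min b₁ b₂, κ, le_max_left _ _, lt_min hb₁ hb₂, by positivity, hκ1, ?_, ?_⟩
  · intro t u
    have hC := le_max_right 1 (C₁ + C₂)
    have hab : κ * |t - u| ≤ |t - u| := mul_le_of_le_one_left (abs_nonneg _) hκ1
    rcases le_total 0 t with ht | ht <;> rcases le_total 0 u with hu | hu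
    · linarith [(hp t u ht hu).1]
    · have := hopp' t (-u) ht (by linarith)
      rw [neg_neg] at this
      rw [abs_of_nonneg (by linarith)]
      linarith
    · have := hopp' u (-t) hu (by linarith)
      rw [neg_neg] at this
      rw [abs_sub_comm, norm_sub_rev, abs_of_nonneg (by linarith)]
      linarith
    · have := (hn (-t) (-u) (by linarith) (by linarith)).1
      simp only [neg_neg] at this
      rw [abs_sub_comm] at hab ⊢
      have e : -t - -u = u - t := by ring
      rw [e] at this
      linarith
  · intro t u htu
    have hexp : ∀ b', min b₁ b₂ ≤ b' → Real.exp (-b' * min |t| |u|) ≤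
        Real.exp (-(min b₁ b₂) * min |t| |u|) := by
      intro b' hb'
      refine Real.exp_le_exp.2 ?_
      have : 0 ≤ min |t| |u| := le_min (abs_nonneg _) (abs_nonneg _)
      nlinarith
    have hpos : 0 ≤ t → 0 ≤ u →
        |t - u| - ‖γ t - γ u‖ ≤ max 1 (C₁ + C₂) * |t - u| * Real.exp (-(min b₁ b₂) * min |t| |u|) := by
      intro ht hu
      refine (hp t u ht hu).2.trans ?_
      have := hexp b₁ (min_le_left _ _)
      have hC : C₁ ≤ max 1 (C₁ + C₂) := le_max_of_le_right (by linarith)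
      gcongr
    have hneg : t ≤ 0 → u ≤ 0 →
        |t - u| - ‖γ t - γ u‖ ≤ max 1 (C₁ + C₂) * |t - u| * Real.exp (-(min b₁ b₂) * min |t| |u|) := by
      intro ht hu
      have h1 := (hn (-t) (-u) (by linarith) (by linarith)).2
      have e : |-t - -u| = |t - u| := by rw [← abs_neg]; congr 1; ring
      simp only [neg_neg, abs_neg, e] at h1
      refine h1.trans ?_
      have := hexp b₂ (min_le_right _ _)
      have hC : C₂ ≤ max 1 (C₁ + C₂) := le_max_of_le_right (by linarith)
      gcongr
    rcases mul_nonneg_iff.1 htu with ⟨ht, hu⟩ | ⟨ht, hu⟩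
    · exact hpos ht hu
    · exact hneg ht hu

/-- The tangent is `C`-Lipschitz, so over a length `1/(2C)` the chord differs from the tangent
segment by at most half its length. -/
theorem IsInterface.exists_local_bound (h : IsInterface γ) :
    ∃ η : ℝ, 0 < η ∧ ∀ t u, |t - u| ≤ η → |t - u| / 2 ≤ ‖γ t - γ u‖ := by
  obtain ⟨C, b, hC, hb, hcurv⟩ := h.exists_curvature_bound
  have hcurv' : ∀ t, ‖iteratedDeriv 2 γ t‖ ≤ C := fun t => (hcurv t).trans <|
    mul_le_of_le_one_right hC.le (Real.exp_le_one_iff.2 (by nlinarith [abs_nonneg t]))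
  have hd : ∀ s u, ‖deriv γ s - deriv γ u‖ ≤ C * |s - u| := by
    intro s u
    exact convex_univ.norm_image_sub_le_of_norm_hasDerivWithin_le
      (fun x _ => (h.hasDerivAt_deriv x).hasDerivWithinAt) (fun x _ => hcurv' x)
      (Set.mem_univ u) (Set.mem_univ s)
  refine ⟨1 / (2 * C), by positivity, fun t u htu => ?_⟩
  have h1 : ‖(γ t - t • deriv γ u) - (γ u - u • deriv γ u)‖ ≤ (C * |t - u|) * ‖t - u‖ := by
    refine (convex_uIcc u t).norm_image_sub_le_of_norm_hasDerivWithin_le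
      (f := fun s => γ s - s • deriv γ u) (f' := fun s => deriv γ s - deriv γ u)
      (fun x _ => ?_) (fun x hx => ?_) Set.left_mem_uIcc Set.right_mem_uIcc
    · simpa using ((h.hasDerivAt x).fun_sub
        ((hasDerivAt_id x).smul_const (deriv γ u))).hasDerivWithinAt
    · refine (hd x u).trans (mul_le_mul_of_nonneg_left ?_ hC.le)
      exact Set.abs_sub_left_of_mem_uIcc hx
  have e : (γ t - t • deriv γ u) - (γ u - u • deriv γ u) = (γ t - γ u) - (t - u) • deriv γ u := by
    module
  rw [e, Real.norm_eq_abs] at h1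
  have h2 := norm_sub_norm_le ((t - u) • deriv γ u) (γ t - γ u)
  rw [norm_smul, h.unit_speed, mul_one, Real.norm_eq_abs, norm_sub_rev ((t - u) • deriv γ u)] at h2
  have h3 : C * |t - u| ≤ 1 / 2 := by
    calc C * |t - u| ≤ C * (1 / (2 * C)) := by gcongr
      _ = 1 / 2 := by field_simp
  nlinarith [abs_nonneg (t - u)]

/-- Four regimes: close parameters (bounded curvature), distant parameters (linear separation), both
parameters far out on one side (chord close to arc), and a compact set off the diagonal, where
injectivity gives a positive minimum. -/
theorem IsInterface.exists_biLipschitz (h : IsInterface γ) :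
    ∃ c : ℝ, 0 < c ∧ c ≤ 1 ∧ ∀ t u, c * |t - u| ≤ ‖γ t - γ u‖ := by
  obtain ⟨C, b, κ, hC, hb, hκ, hκ1, hfar, hsame⟩ := h.exists_chord_bound
  obtain ⟨η, hη, hnear⟩ := h.exists_local_bound
  set M' := 2 * C / κ with hM'
  have hM'pos : 0 < M' := by positivity
  obtain ⟨M, hM0, hM⟩ : ∃ M : ℝ, 0 ≤ M ∧ C * Real.exp (-b * M) ≤ 1 / 2 := by
    have : Tendsto (fun M : ℝ => C * Real.exp (-b * M)) atTop (𝓝 (C * 0)) :=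
      Tendsto.const_mul _ (Real.tendsto_exp_atBot.comp
        (Tendsto.const_mul_atTop_of_neg (by linarith) tendsto_id))
    rw [mul_zero] at this
    obtain ⟨M, h1, h2⟩ := ((this.eventually (ge_mem_nhds (by norm_num : (0 : ℝ) < 1 / 2))).and
      (eventually_ge_atTop 0)).exists
    exact ⟨M, h2, h1⟩
  set R := M + M' with hR
  have hRpos : 0 < R := by positivity
  set K : Set (ℝ × ℝ) := (Set.Icc (-R) R ×ˢ Set.Icc (-R) R) ∩ {p | η ≤ |p.1 - p.2|} with hKdef
  have hK : IsCompact K := (isCompact_Icc.prod isCompact_Icc).inter_right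
    (isClosed_le continuous_const (by fun_prop))
  obtain ⟨δ, hδ, hKδ⟩ : ∃ δ : ℝ, 0 < δ ∧ ∀ p ∈ K, δ ≤ ‖γ p.1 - γ p.2‖ := by
    rcases K.eq_empty_or_nonempty with he | hne
    · exact ⟨1, one_pos, fun p hp => by simp [he] at hp⟩
    · have hcont : Continuous fun p : ℝ × ℝ => ‖γ p.1 - γ p.2‖ := by
        have := h.continuous
        fun_prop
      obtain ⟨p, hp, hmin⟩ := hK.exists_isMinOn hne hcont.continuousOn
      refine ⟨_, ?_, fun q hq => hmin hq⟩
      rw [norm_pos_iff, sub_ne_zero]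
      intro e
      have h1 : η ≤ |p.1 - p.2| := hp.2
      rw [h.injective e, sub_self, abs_zero] at h1
      linarith
  set c := min (κ / 2) (δ / (2 * R)) with hc
  have hcκ : c ≤ κ / 2 := min_le_left _ _
  have hcδ : c ≤ δ / (2 * R) := min_le_right _ _
  refine ⟨c, by positivity, by linarith, fun t u => ?_⟩
  have habs := abs_nonneg (t - u)
  have hhalf : |t - u| / 2 ≤ ‖γ t - γ u‖ → c * |t - u| ≤ ‖γ t - γ u‖ := fun h1 => by
    nlinarith
  rcases le_or_gt |t - u| η with h1 | h1
  · exact hhalf (hnear t u h1)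
  rcases le_or_gt M' |t - u| with h2 | h2
  · have h3 := hfar t u
    have h4 : 2 * C ≤ κ * |t - u| := by
      rw [hM', div_le_iff₀ hκ] at h2; linarith
    nlinarith
  by_cases hin : |t| ≤ R ∧ |u| ≤ R
  · have h3 := hKδ (t, u) ⟨⟨abs_le.1 hin.1, abs_le.1 hin.2⟩, h1.le⟩
    have h4 : |t - u| ≤ 2 * R := (abs_sub t u).trans (by linarith [hin.1, hin.2])
    calc c * |t - u| ≤ δ / (2 * R) * (2 * R) := by gcongr
      _ = δ := by field_simp
      _ ≤ _ := h3
  -- One parameter beyond `R = M + M'` and distance below `M'` force both beyond `M`, with the same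
  -- sign.
  · have hM2 : M ≤ min |t| |u| ∧ 0 ≤ t * u := by
      have hcases : R < |t| ∨ R < |u| := by
        by_contra hcon
        push Not at hcon
        exact hin hcon
      have hd := abs_lt.1 h2
      refine ⟨?_, ?_⟩
      · rcases hcases with h5 | h5
        · have := abs_sub_abs_le_abs_sub t u
          exact le_min (by linarith) (by linarith)
        · have := abs_sub_abs_le_abs_sub u t
          rw [abs_sub_comm u t] at this
          exact le_min (by linarith) (by linarith)
      · by_contra hneg
        push Not at hneg
        rcases mul_neg_iff.1 hneg with ⟨h6, h7⟩ | ⟨h6, h7⟩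
        · rw [abs_of_pos h6, abs_of_neg h7] at hcases
          rcases hcases with h5 | h5 <;> linarith
        · rw [abs_of_neg h6, abs_of_pos h7] at hcases
          rcases hcases with h5 | h5 <;> linarith
    refine hhalf ?_
    have h5 := hsame t u hM2.2
    have h6 : C * Real.exp (-b * min |t| |u|) ≤ 1 / 2 := by
      refine le_trans ?_ hM
      gcongr C * ?_
      exact Real.exp_le_exp.2 (by nlinarith [hM2.1])
    nlinarith

/-- Quantitative comparison of chord length and arc length along an interface. -/
theorem IsInterface.exists_geometry (h : IsInterface γ) :
    ∃ c C b : ℝ, 0 < c ∧ c ≤ 1 ∧ 0 < C ∧ 0 < b ∧ (∀ t u, c * |t - u| ≤ ‖γ t - γ u‖) ∧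
      ∀ b', b' ≤ b → ∀ t u,
        |t - u| - ‖γ t - γ u‖ ≤ C * |t - u| * Real.exp (-b' * (|t| + |u| - |t - u|)) := by
  obtain ⟨c, hc, hc1, hlip⟩ := h.exists_biLipschitz
  obtain ⟨C, b, κ, hC, hb, hκ, hκ1, hfar, hsame⟩ := h.exists_chord_bound
  -- The quantity `|t| + |u| - |t - u|` equals `2 min(|t|, |u|)` on one side, whence the halved
  -- rate, and `0` across the origin. As it is never negative, the rate may be lowered at will,
  -- which later fits it to the decay of the Green's function.
  refine ⟨c, C, b / 2, hc, hc1, by linarith, by positivity, hlip, fun b' hb' t u => ?_⟩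
  have habs := abs_nonneg (t - u)
  rcases le_or_gt 0 (t * u) with h1 | h1
  · refine (hsame t u h1).trans ?_
    gcongr C * |t - u| * ?_
    refine Real.exp_le_exp.2 ?_
    have e : |t| + |u| - |t - u| = 2 * min |t| |u| := by
      rcases mul_nonneg_iff.1 h1 with ⟨ht, hu⟩ | ⟨ht, hu⟩
      · rw [abs_of_nonneg ht, abs_of_nonneg hu]
        rcases le_total t u with htu | htu
        · rw [min_eq_left htu, abs_of_nonpos (by linarith)]; ring
        · rw [min_eq_right htu, abs_of_nonneg (by linarith)]; ring
      · rw [abs_of_nonpos ht, abs_of_nonpos hu]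
        rcases le_total t u with htu | htu
        · rw [min_eq_right (by linarith), abs_of_nonpos (by linarith)]; ring
        · rw [min_eq_left (by linarith), abs_of_nonneg (by linarith)]; ring
    have hmin : 0 ≤ min |t| |u| := le_min (abs_nonneg _) (abs_nonneg _)
    rw [e]
    nlinarith
  · have e : |t| + |u| - |t - u| = 0 := by
      rcases mul_neg_iff.1 h1 with ⟨ht, hu⟩ | ⟨ht, hu⟩
      · rw [abs_of_pos ht, abs_of_neg hu, abs_of_pos (by linarith)]; ring
      · rw [abs_of_neg ht, abs_of_pos hu, abs_of_neg (by linarith)]; ring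
    rw [e, mul_zero, Real.exp_zero, mul_one]
    nlinarith [norm_nonneg (γ t - γ u)]

end Interface

/-! ### Holomorphy of parameter integrals. -/

section Holomorphic

/-- Cauchy's estimate on balls of half the radius derives a bound for the derivative from the bound
for the integrand. -/
theorem differentiableOn_integral_of_dominated {X : Type*} [MeasurableSpace X] {μ : Measure X}
    {U : Set ℂ} (hU : IsOpen U) {F : ℂ → X → ℂ} {B : X → ℝ} (hB : Integrable B μ)
    (hm : ∀ z ∈ U, AEStronglyMeasurable (F z) μ) (hb : ∀ z ∈ U, ∀ᵐ x ∂μ, ‖F z x‖ ≤ B x)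
    (hb' : ∀ᵐ x ∂μ, ∀ z ∈ U, ‖F z x‖ ≤ B x)
    (hd : ∀ᵐ x ∂μ, DifferentiableOn ℂ (fun z => F z x) U) :
    DifferentiableOn ℂ (fun z => ∫ x, F z x ∂μ) U := by
  intro z₀ hz₀
  obtain ⟨R, hR, hRU⟩ := Metric.isOpen_iff.1 hU z₀ hz₀
  have hsub : ∀ z ∈ Metric.ball z₀ (R / 2), Metric.ball z (R / 2) ⊆ U := fun z hz w hw => hRU <| by
    have h1 := Metric.mem_ball.1 hz
    have h2 := Metric.mem_ball.1 hw
    have := dist_triangle w z z₀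
    exact Metric.mem_ball.2 (by linarith)
  have hhalf : 0 < R / 2 := by positivity
  have hballU : Metric.ball z₀ (R / 2) ⊆ U := hsub z₀ (Metric.mem_ball_self hhalf)
  have hder : ∀ᵐ x ∂μ, ∀ z ∈ Metric.ball z₀ (R / 2), ‖deriv (fun z => F z x) z‖ ≤ 2 * B x / (R / 2) := by
    filter_upwards [hb', hd] with x hx hdx z hz
    refine Complex.norm_deriv_le_div_of_mapsTo_ball (hdx.mono (hsub z hz)) ?_ hhalf
    intro w hw
    rw [mem_closedBall_iff_norm, two_mul]
    exact (norm_sub_le _ _).trans (add_le_add (hx w (hsub z hz hw)) (hx z (hballU hz)))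
  have hF'm : AEStronglyMeasurable (fun x => deriv (fun z => F z x) z₀) μ := by
    have hmem : ∀ n : ℕ, z₀ + ((R / (n + 2) : ℝ) : ℂ) ∈ U := fun n => hRU <| by
      rw [Metric.mem_ball, dist_eq_norm, add_sub_cancel_left, Complex.norm_real,
        Real.norm_of_nonneg (by positivity)]
      exact div_lt_self hR (by have : (0 : ℝ) ≤ n := n.cast_nonneg
                               linarith)
    refine aestronglyMeasurable_of_tendsto_ae atTop (f := fun n : ℕ => fun x =>
      (((R / (n + 2) : ℝ) : ℂ))⁻¹ • (F (z₀ + ((R / (n + 2) : ℝ) : ℂ)) x - F z₀ x))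
      (fun n => by
        exact ((hm _ (hmem n)).sub (hm _ hz₀)).const_smul ((((R / (n + 2) : ℝ) : ℂ))⁻¹)) ?_
    filter_upwards [hd] with x hdx
    have hs := hasDerivAt_iff_tendsto_slope_zero.1
      (hdx.differentiableAt (hU.mem_nhds hz₀)).hasDerivAt
    refine hs.comp ?_
    rw [tendsto_nhdsWithin_iff]
    refine ⟨?_, Eventually.of_forall fun n => ?_⟩
    · rw [← Complex.ofReal_zero]
      refine (Complex.continuous_ofReal.tendsto 0).comp ?_
      exact tendsto_const_nhds.div_atTop
        (tendsto_atTop_add_const_right _ _ tendsto_natCast_atTop_atTop)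
    · rw [Set.mem_compl_iff, Set.mem_singleton_iff, Complex.ofReal_eq_zero]
      positivity
  have h := hasDerivAt_integral_of_dominated_loc_of_deriv_le (μ := μ) (F := F)
    (F' := fun z x => deriv (fun z => F z x) z) (x₀ := z₀) (s := Metric.ball z₀ (R / 2))
    (bound := fun x => 2 * B x / (R / 2)) (Metric.ball_mem_nhds _ hhalf)
    (by filter_upwards [hU.mem_nhds hz₀] with z hz using hm z hz)
    (hB.mono' (hm _ hz₀) (hb _ hz₀)) hF'm hder ((hB.const_mul 2).div_const _)
    (by
      filter_upwards [hd] with x hdx z hz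
      exact (hdx.differentiableAt (hU.mem_nhds (hballU hz))).hasDerivAt)
  exact h.2.differentiableAt.differentiableWithinAt

end Holomorphic

/-! ### Bounds for `K₀` and for superpositions of exponentials. -/

section Bessel

/-- The normalisation constant `∫₀^∞ (cosh s)^(-1/4) ds`. -/
def coshConst : ℝ := ∫ s in Set.Ioi (0 : ℝ), Real.cosh s ^ (-(1 / 4) : ℝ)

theorem half_exp_le_cosh (s : ℝ) : Real.exp s / 2 ≤ Real.cosh s := by
  rw [Real.cosh_eq]; linarith [Real.exp_pos (-s)]

theorem integrableOn_cosh_rpow {a : ℝ} (ha : 0 < a) :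
    IntegrableOn (fun s => Real.cosh s ^ (-a)) (Set.Ioi (0 : ℝ)) := by
  have h1 : IntegrableOn (fun s : ℝ => 2 ^ a * Real.exp (-a * s)) (Set.Ioi 0) :=
    (integrableOn_exp_mul_Ioi (by linarith) 0).const_mul _
  refine h1.mono' ?_ (Eventually.of_forall fun s => ?_)
  · refine (Continuous.rpow_const Real.continuous_cosh fun s => ?_).aestronglyMeasurable
    exact Or.inl (Real.cosh_pos s).ne'
  · rw [Real.norm_of_nonneg (Real.rpow_nonneg (Real.cosh_pos s).le _)]
    calc Real.cosh s ^ (-a) ≤ (Real.exp s / 2) ^ (-a) :=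
          Real.rpow_le_rpow_of_nonpos (by positivity) (half_exp_le_cosh s) (by linarith)
      _ = 2 ^ a * Real.exp (-a * s) := by
          rw [Real.div_rpow (Real.exp_pos s).le (by norm_num), Real.rpow_neg (by norm_num : (0:ℝ) ≤ 2),
            ← Real.exp_mul, div_inv_eq_mul]
          ring_nf

theorem coshConst_nonneg : 0 ≤ coshConst :=
  setIntegral_nonneg measurableSet_Ioi fun s _ => Real.rpow_nonneg (Real.cosh_pos s).le _

theorem rpow_quarter_le_exp {y : ℝ} (hy : 0 ≤ y) : y ^ (1 / 4 : ℝ) ≤ Real.exp (y / 4) := by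
  have h1 : y ≤ Real.exp y := by linarith [Real.add_one_le_exp y]
  calc y ^ (1 / 4 : ℝ) ≤ (Real.exp y) ^ (1 / 4 : ℝ) := Real.rpow_le_rpow hy h1 (by norm_num)
    _ = Real.exp (y / 4) := by rw [← Real.exp_mul]; ring_nf

/-- The power `-1/4` serves three purposes: it makes the integral in `cosh s` converge, it stays
square-integrable at the origin, and it leaves a negative power of `Re ω`. Half of the exponential
decay is kept. -/
theorem exp_neg_le_rpow {y : ℝ} (hy : 0 < y) :
    Real.exp (-y) ≤ y ^ (-(1 / 4) : ℝ) * Real.exp (-y / 2) := by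
  rw [Real.rpow_neg hy.le, ← div_eq_inv_mul, le_div_iff₀ (by positivity)]
  calc Real.exp (-y) * y ^ (1 / 4 : ℝ) ≤ Real.exp (-y) * Real.exp (y / 4) := by
        gcongr; exact rpow_quarter_le_exp hy.le
    _ ≤ Real.exp (-y / 2) := by
        rw [← Real.exp_add]; exact Real.exp_le_exp.2 (by linarith)

/-- The extra factor `y` is what differentiating the exponential in the distance produces. -/
theorem mul_exp_neg_le_rpow {y : ℝ} (hy : 0 < y) :
    y * Real.exp (-y) ≤ 4 * (y ^ (-(1 / 4) : ℝ) * Real.exp (-y / 2)) := by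
  rw [Real.rpow_neg hy.le, ← div_eq_inv_mul, ← mul_div_assoc, le_div_iff₀ (by positivity)]
  have h1 : y ≤ 4 * Real.exp (y / 4) := by linarith [Real.add_one_le_exp (y / 4)]
  calc y * Real.exp (-y) * y ^ (1 / 4 : ℝ)
      ≤ (4 * Real.exp (y / 4)) * Real.exp (-y) * Real.exp (y / 4) := by
        gcongr; exact rpow_quarter_le_exp hy.le
    _ = 4 * Real.exp (-y / 2) := by
        rw [mul_assoc, mul_assoc, ← Real.exp_add, ← Real.exp_add]; ring_nf

theorem rpow_mul_cosh_exp_le {x : ℝ} (hx : 0 < x) (s : ℝ) :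
    (x * Real.cosh s) ^ (-(1 / 4) : ℝ) * Real.exp (-(x * Real.cosh s) / 2) ≤
      x ^ (-(1 / 4) : ℝ) * Real.exp (-x / 2) * Real.cosh s ^ (-(1 / 4) : ℝ) := by
  have hc := Real.one_le_cosh s
  rw [Real.mul_rpow hx.le (by linarith)]
  have : Real.exp (-(x * Real.cosh s) / 2) ≤ Real.exp (-x / 2) := Real.exp_le_exp.2 (by nlinarith)
  have h2 : 0 ≤ x ^ (-(1 / 4) : ℝ) * Real.cosh s ^ (-(1 / 4) : ℝ) :=
    mul_nonneg (Real.rpow_nonneg hx.le _) (Real.rpow_nonneg (by linarith) _)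
  rw [mul_right_comm (x ^ (-(1 / 4) : ℝ)) (Real.exp (-x / 2))]
  gcongr

theorem exp_neg_mul_cosh_le {x : ℝ} (hx : 0 < x) (s : ℝ) :
    Real.exp (-(x * Real.cosh s)) ≤
      x ^ (-(1 / 4) : ℝ) * Real.exp (-x / 2) * Real.cosh s ^ (-(1 / 4) : ℝ) :=
  (exp_neg_le_rpow (mul_pos hx (Real.cosh_pos s))).trans (rpow_mul_cosh_exp_le hx s)

/-- Superposition of exponentials, `∫₀^∞ p(s) exp (-z cosh s) ds`. -/
def expSup (p : ℝ → ℂ) (z : ℂ) : ℂ :=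
  ∫ s in Set.Ioi (0 : ℝ), p s * Complex.exp (-z * (Real.cosh s : ℂ))

theorem besselK0_eq_expSup (z : ℂ) : besselK0 z = expSup (fun _ => 1) z := by
  simp [besselK0, expSup]

theorem norm_exp_neg_mul_cosh (z : ℂ) (s : ℝ) :
    ‖Complex.exp (-z * (Real.cosh s : ℂ))‖ = Real.exp (-(z.re * Real.cosh s)) := by
  rw [Complex.norm_exp]
  simp

theorem integrableOn_exp_neg_mul_cosh {x : ℝ} (hx : 0 < x) :
    IntegrableOn (fun s => Real.exp (-(x * Real.cosh s))) (Set.Ioi 0) := by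
  refine Integrable.mono' ((integrableOn_cosh_rpow (a := 1 / 4) (by norm_num)).const_mul
    (x ^ (-(1 / 4) : ℝ) * Real.exp (-x / 2))) ?_ (Eventually.of_forall fun s => ?_)
  · have : Continuous fun s => Real.exp (-(x * Real.cosh s)) := by
      have := Real.continuous_cosh
      fun_prop
    exact this.aestronglyMeasurable
  · rw [Real.norm_of_nonneg (Real.exp_pos _).le]
    exact exp_neg_mul_cosh_le hx s

theorem integral_exp_neg_mul_cosh_le {x : ℝ} (hx : 0 < x) :
    ∫ s in Set.Ioi (0 : ℝ), Real.exp (-(x * Real.cosh s)) ≤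
      coshConst * (x ^ (-(1 / 4) : ℝ) * Real.exp (-x / 2)) := by
  rw [coshConst, mul_comm, ← integral_const_mul]
  exact integral_mono (integrableOn_exp_neg_mul_cosh hx)
    ((integrableOn_cosh_rpow (a := 1 / 4) (by norm_num)).const_mul _)
    (fun s => exp_neg_mul_cosh_le hx s)

theorem continuous_exp_neg_mul_cosh (z : ℂ) :
    Continuous fun s : ℝ => Complex.exp (-z * (Real.cosh s : ℂ)) := by
  have := Real.continuous_cosh
  fun_prop

theorem integrableOn_expSup {p : ℝ → ℂ} (hp : Measurable p) {p₀ : ℝ} (hp₀ : ∀ s, ‖p s‖ ≤ p₀)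
    {z : ℂ} (hz : 0 < z.re) :
    IntegrableOn (fun s => p s * Complex.exp (-z * (Real.cosh s : ℂ))) (Set.Ioi 0) := by
  refine Integrable.mono' ((integrableOn_exp_neg_mul_cosh hz).const_mul p₀)
    (hp.aestronglyMeasurable.mul (continuous_exp_neg_mul_cosh z).aestronglyMeasurable)
    (Eventually.of_forall fun s => ?_)
  rw [norm_mul, norm_exp_neg_mul_cosh]
  have := hp₀ s
  gcongr

theorem norm_expSup_le {p : ℝ → ℂ} {p₀ : ℝ} (hp₀ : ∀ s, ‖p s‖ ≤ p₀) {z : ℂ} (hz : 0 < z.re) :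
    ‖expSup p z‖ ≤ p₀ * (coshConst * (z.re ^ (-(1 / 4) : ℝ) * Real.exp (-z.re / 2))) := by
  have h0 : 0 ≤ p₀ := (norm_nonneg _).trans (hp₀ 0)
  calc ‖expSup p z‖ ≤ ∫ s in Set.Ioi (0 : ℝ), p₀ * Real.exp (-(z.re * Real.cosh s)) := by
        refine norm_integral_le_of_norm_le ((integrableOn_exp_neg_mul_cosh hz).const_mul p₀)
          (Eventually.of_forall fun s => ?_)
        rw [norm_mul, norm_exp_neg_mul_cosh]
        have := hp₀ s
        gcongr
    _ ≤ _ := by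
        rw [integral_const_mul]
        gcongr
        exact integral_exp_neg_mul_cosh_le hz

theorem norm_exp_neg_sub_le {a b : ℂ} {x : ℝ} (ha : x ≤ a.re) (hb : x ≤ b.re) :
    ‖Complex.exp (-a) - Complex.exp (-b)‖ ≤ Real.exp (-x) * ‖a - b‖ := by
  refine (convex_halfSpace_re_ge x).norm_image_sub_le_of_norm_hasDerivWithin_le
    (f := fun z => Complex.exp (-z)) (f' := fun z => Complex.exp (-z) * (-1)) (fun z _ => ?_)
    (fun z hz => ?_) hb ha
  · exact ((hasDerivAt_id z).neg.cexp).hasDerivWithinAt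
  · rw [norm_mul, Complex.norm_exp]
    simpa using hz

/-- The mean value inequality for the exponential on a half-plane brings a factor `ω cosh s`. With
`‖ω‖ ≤ 2 Re ω` it becomes `y / ρ`, up to a constant, for `y = Re ω · ρ cosh s`, and the decay
`e^{-y}` absorbs `y`. -/
theorem norm_besselK0_sub_le {ω : ℂ} (hω : 0 < ω.re) (hω2 : ‖ω‖ ≤ 2 * ω.re) {r r₀ ρ : ℝ}
    (hρ : 0 < ρ) (hr : ρ ≤ r) (hr₀ : ρ ≤ r₀) :
    ‖besselK0 (ω * r) - besselK0 (ω * r₀)‖ ≤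
      8 * coshConst * (|r - r₀| / ρ) * ((ω.re * ρ) ^ (-(1 / 4) : ℝ) * Real.exp (-(ω.re * ρ) / 2)) := by
  have hre : ∀ x : ℝ, (ω * x).re = ω.re * x := fun x => by simp
  have hx : 0 < ω.re * ρ := by positivity
  have hi : ∀ x, ρ ≤ x → IntegrableOn (fun s => Complex.exp (-(ω * x) * (Real.cosh s : ℂ))) (Set.Ioi 0) := by
    intro x hx
    have := integrableOn_expSup (p := fun _ => 1) measurable_const (p₀ := 1) (by simp)
      (z := ω * x) (by rw [hre]; exact mul_pos hω (hρ.trans_le hx))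
    simpa using this
  rw [besselK0, besselK0, ← integral_sub (hi r hr) (hi r₀ hr₀)]
  have hpt : ∀ s : ℝ, ‖Complex.exp (-(ω * r) * (Real.cosh s : ℂ)) - Complex.exp (-(ω * r₀) * (Real.cosh s : ℂ))‖ ≤
      8 * (|r - r₀| / ρ) * ((ω.re * ρ) ^ (-(1 / 4) : ℝ) * Real.exp (-(ω.re * ρ) / 2)) *
        Real.cosh s ^ (-(1 / 4) : ℝ) := by
    intro s
    have hc := Real.cosh_pos s
    have h1 := norm_exp_neg_sub_le (a := ω * r * (Real.cosh s : ℂ)) (b := ω * r₀ * (Real.cosh s : ℂ))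
      (x := ω.re * ρ * Real.cosh s)
      (by rw [Complex.re_mul_ofReal, hre]; gcongr) (by rw [Complex.re_mul_ofReal, hre]; gcongr)
    rw [← neg_mul (ω * r), ← neg_mul (ω * r₀)] at h1
    refine h1.trans ?_
    have h2 : ω * r * (Real.cosh s : ℂ) - ω * r₀ * (Real.cosh s : ℂ) =
        ω * ((r - r₀ : ℝ) : ℂ) * (Real.cosh s : ℂ) := by push_cast; ring
    rw [h2, norm_mul, norm_mul, Complex.norm_real, Complex.norm_real, Real.norm_eq_abs,
      Real.norm_of_nonneg hc.le]
    calc Real.exp (-(ω.re * ρ * Real.cosh s)) * (‖ω‖ * |r - r₀| * Real.cosh s)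
        ≤ Real.exp (-(ω.re * ρ * Real.cosh s)) * (2 * ω.re * |r - r₀| * Real.cosh s) := by gcongr
      _ = 2 * (|r - r₀| / ρ) * ((ω.re * ρ * Real.cosh s) * Real.exp (-(ω.re * ρ * Real.cosh s))) := by
          field_simp
      _ ≤ 2 * (|r - r₀| / ρ) * (4 * ((ω.re * ρ) ^ (-(1 / 4) : ℝ) * Real.exp (-(ω.re * ρ) / 2) *
            Real.cosh s ^ (-(1 / 4) : ℝ))) := by
          refine mul_le_mul_of_nonneg_left ?_ (by positivity)
          refine (mul_exp_neg_le_rpow (by positivity)).trans ?_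
          exact mul_le_mul_of_nonneg_left (rpow_mul_cosh_exp_le hx s) (by norm_num)
      _ = _ := by ring
  refine (norm_integral_le_of_norm_le ((integrableOn_cosh_rpow (a := 1 / 4) (by norm_num)).const_mul
    (8 * (|r - r₀| / ρ) * ((ω.re * ρ) ^ (-(1 / 4) : ℝ) * Real.exp (-(ω.re * ρ) / 2))))
    (Eventually.of_forall hpt)).trans_eq ?_
  rw [integral_const_mul, coshConst]
  ring

theorem measurable_expSup {X : Type*} [MeasurableSpace X] {p : ℝ → ℂ} (hp : Measurable p)
    {f : X → ℂ} (hf : Measurable f) : Measurable fun x => expSup p (f x) := by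
  have h : StronglyMeasurable (Function.uncurry fun (x : X) (s : ℝ) =>
      p s * Complex.exp (-f x * (Real.cosh s : ℂ))) := by
    refine Measurable.stronglyMeasurable ?_
    have := Real.measurable_cosh
    fun_prop
  exact (h.integral_prod_right (ν := volume.restrict (Set.Ioi (0 : ℝ)))).measurable

theorem differentiableOn_expSup {U : Set ℂ} (hU : IsOpen U) {p : ℂ → ℝ → ℂ} {f : ℂ → ℂ} {p₀ x : ℝ}
    (hx : 0 < x) (hp : ∀ z ∈ U, Measurable (p z)) (hp₀ : ∀ z ∈ U, ∀ s, ‖p z s‖ ≤ p₀)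
    (hpd : ∀ s, DifferentiableOn ℂ (fun z => p z s) U) (hf : DifferentiableOn ℂ f U)
    (hfx : ∀ z ∈ U, x ≤ (f z).re) : DifferentiableOn ℂ (fun z => expSup (p z) (f z)) U := by
  have hb : ∀ z ∈ U, ∀ s : ℝ, ‖p z s * Complex.exp (-f z * (Real.cosh s : ℂ))‖ ≤
      p₀ * Real.exp (-(x * Real.cosh s)) := by
    intro z hz s
    have h1 := hp₀ z hz s
    have h2 := hfx z hz
    have h3 := Real.cosh_pos s
    have h4 : 0 ≤ p₀ := (norm_nonneg _).trans h1
    rw [norm_mul, norm_exp_neg_mul_cosh]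
    gcongr
  refine differentiableOn_integral_of_dominated hU
    ((integrableOn_exp_neg_mul_cosh hx).const_mul p₀) (fun z hz => ?_)
    (fun z hz => Eventually.of_forall (hb z hz)) (Eventually.of_forall fun s z hz => hb z hz s)
    (Eventually.of_forall fun s => ?_)
  · exact (hp z hz).aestronglyMeasurable.mul (continuous_exp_neg_mul_cosh _).aestronglyMeasurable
  · exact (hpd s).mul ((hf.neg.mul_const _).cexp)

end Bessel

/-! ### The complex square root and the sector around the positive axis. -/

section Sqrt

/-- The principal branch of the complex square root. -/
def csqrt (z : ℂ) : ℂ := Complex.exp (Complex.log z / 2)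

theorem csqrt_sq {z : ℂ} (hz : z ≠ 0) : csqrt z ^ 2 = z := by
  rw [csqrt, ← Complex.exp_nat_mul]
  have : ((2 : ℕ) : ℂ) * (Complex.log z / 2) = Complex.log z := by push_cast; ring
  rw [this, Complex.exp_log hz]

theorem csqrt_re_pos {z : ℂ} (hz : z ∈ Complex.slitPlane) : 0 < (csqrt z).re := by
  rw [csqrt, Complex.exp_re]
  have h1 : (Complex.log z / 2).im = z.arg / 2 := by
    rw [show (Complex.log z / 2) = Complex.log z / ((2 : ℝ) : ℂ) by norm_num,
      Complex.div_ofReal_im, Complex.log_im]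
  rw [h1]
  refine mul_pos (Real.exp_pos _) (Real.cos_pos_of_mem_Ioo ⟨?_, ?_⟩)
  · have := Complex.neg_pi_lt_arg z
    linarith
  · have h2 := Complex.arg_le_pi z
    have h3 := (Complex.mem_slitPlane_iff_arg.1 hz).1
    have : z.arg < Real.pi := lt_of_le_of_ne h2 h3
    linarith

theorem differentiableAt_csqrt {z : ℂ} (hz : z ∈ Complex.slitPlane) :
    DifferentiableAt ℂ csqrt z :=
  ((Complex.differentiableAt_log hz).div_const 2).cexp

theorem csqrt_ofReal {x : ℝ} (hx : 0 < x) : csqrt x = (√x : ℝ) := by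
  rw [csqrt, ← Complex.ofReal_log hx.le, Real.sqrt_eq_rpow, Real.rpow_def_of_pos hx]
  push_cast
  ring_nf

theorem abs_im_lt_re {v : ℂ} (hv : 0 < v.re) (hv2 : 0 < (v ^ 2).re) : |v.im| < v.re := by
  rw [sq, Complex.mul_re] at hv2
  exact abs_lt_of_sq_lt_sq (by nlinarith) hv.le

theorem norm_le_two_mul_re {v : ℂ} (hv : 0 < v.re) (hv2 : 0 < (v ^ 2).re) : ‖v‖ ≤ 2 * v.re := by
  have := abs_im_lt_re hv hv2
  have h2 := Complex.norm_le_abs_re_add_abs_im v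
  rw [abs_of_pos hv] at h2
  linarith

/-- Both numbers have argument in `(-π/4, π/4)`, so their quotient stays in the right half-plane. -/
theorem div_re_pos {v w : ℂ} (hv : 0 < v.re) (hv2 : 0 < (v ^ 2).re) (hw : 0 < w.re)
    (hw2 : 0 < (w ^ 2).re) : 0 < (v / w).re := by
  have h1 := abs_lt.1 (abs_im_lt_re hv hv2)
  have h2 := abs_lt.1 (abs_im_lt_re hw hw2)
  have hn : 0 < Complex.normSq w := Complex.normSq_pos.2 fun h => by simp [h] at hw
  rw [Complex.div_re, ← add_div]
  refine div_pos ?_ hn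
  have h3 := mul_pos (sub_pos.2 h1.2) (sub_pos.2 h2.2)
  have h4 : 0 < (v.re + v.im) * (w.re + w.im) := mul_pos (by linarith) (by linarith)
  nlinarith

end Sqrt

/-! ### Explicit integrals of exponentials and the hyperbolic resolvent integral. -/

section Integrals

theorem integrable_exp_neg_abs {a : ℂ} (ha : 0 < a.re) :
    Integrable fun t : ℝ => Complex.exp (-a * |t|) := by
  rw [← integrableOn_univ, ← Set.Iic_union_Ioi (a := (0 : ℝ))]
  refine IntegrableOn.union ?_ ?_
  · refine (integrableOn_exp_mul_complex_Iic ha 0).congr_fun (fun t ht => ?_) measurableSet_Iic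
    simp [abs_of_nonpos (Set.mem_Iic.1 ht)]
  · refine (integrableOn_exp_mul_complex_Ioi (a := -a) (by simpa using ha) 0).congr_fun
      (fun t ht => ?_) measurableSet_Ioi
    simp [abs_of_pos (Set.mem_Ioi.1 ht)]

theorem integrable_exp_neg_abs_real {a : ℝ} (ha : 0 < a) :
    Integrable fun t : ℝ => Real.exp (-a * |t|) := by
  have := (integrable_exp_neg_abs (a := a) (by simpa using ha)).norm
  simpa [Complex.norm_exp] using this

theorem integral_exp_neg_abs_real {a : ℝ} (ha : 0 < a) :
    ∫ t : ℝ, Real.exp (-a * |t|) = 2 / a := by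
  rw [integral_comp_abs (f := fun t => Real.exp (-a * t)),
    integral_exp_mul_Ioi (by linarith)]
  simp
  ring

theorem integral_exp_neg_abs_mul_exp {a : ℂ} {y : ℝ} (ha : 0 < a.re) :
    ∫ t : ℝ, Complex.exp (-a * |t|) * Complex.exp (-(y * t * Complex.I)) =
      2 * a / (a ^ 2 + y ^ 2) := by
  have hi : Integrable fun t : ℝ => Complex.exp (-a * |t|) * Complex.exp (-(y * t * Complex.I)) := by
    refine (integrable_exp_neg_abs ha).mono ?_ (Eventually.of_forall fun t => ?_)
    · exact Continuous.aestronglyMeasurable (by fun_prop)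
    · rw [norm_mul]
      have : ‖Complex.exp (-(y * t * Complex.I))‖ = 1 := by
        rw [Complex.norm_exp]; simp
      rw [this, mul_one]
  have hre1 : 0 < (a - y * Complex.I).re := by simpa using ha
  have hre2 : (-a - y * Complex.I).re < 0 := by simpa using ha
  rw [← intervalIntegral.integral_Iic_add_Ioi hi.integrableOn hi.integrableOn (b := 0)]
  have h1 : ∫ t : ℝ in Set.Iic 0, Complex.exp (-a * |t|) * Complex.exp (-(y * t * Complex.I)) =
      1 / (a - y * Complex.I) := by
    rw [setIntegral_congr_fun (g := fun t : ℝ => Complex.exp ((a - y * Complex.I) * t))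
      measurableSet_Iic, integral_exp_mul_complex_Iic hre1]
    · simp
    · intro t ht
      simp only [abs_of_nonpos (Set.mem_Iic.1 ht), ← Complex.exp_add]
      congr 1; push_cast; ring
  have h2 : ∫ t : ℝ in Set.Ioi 0, Complex.exp (-a * |t|) * Complex.exp (-(y * t * Complex.I)) =
      1 / (a + y * Complex.I) := by
    rw [setIntegral_congr_fun (g := fun t : ℝ => Complex.exp ((-a - y * Complex.I) * t))
      measurableSet_Ioi, integral_exp_mul_complex_Ioi hre2]
    · rw [Complex.ofReal_zero, mul_zero, Complex.exp_zero, ← neg_add', div_neg, neg_div, neg_neg]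
    · intro t ht
      simp only [abs_of_pos (Set.mem_Ioi.1 ht), ← Complex.exp_add]
      congr 1; ring
  have hne1 : a - y * Complex.I ≠ 0 := fun h => by rw [h] at hre1; simp at hre1
  have hne2 : a + y * Complex.I ≠ 0 := fun h => by
    have : (a + y * Complex.I).re = 0 := by rw [h]; simp
    simp at this; linarith
  have hprod : (a - y * Complex.I) * (a + y * Complex.I) = a ^ 2 + y ^ 2 := by
    linear_combination (-(y : ℂ) ^ 2) * Complex.I_sq
  rw [h1, h2, div_add_div _ _ hne1 hne2, hprod]
  ring_nf

/-- Convolution of a decaying exponential with an outgoing wave. -/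
theorem integral_exp_neg_abs_sub_mul_exp_abs {a : ℂ} {E : ℝ} (ha : 0 < a.re) (t : ℝ) :
    ∫ u : ℝ, Complex.exp (-a * |t - u|) * Complex.exp (Complex.I * E * |u|) =
      2 * a / (a ^ 2 + E ^ 2) * Complex.exp (Complex.I * E * |t|) +
        2 * Complex.I * E / (a ^ 2 + E ^ 2) * Complex.exp (-a * |t|) := by
  -- Both sides are even in `t`, so `t ≥ 0` suffices; the line is cut at `0` and `t`, where the
  -- absolute values change form.
  have key : ∀ t : ℝ, 0 ≤ t →
      ∫ u : ℝ, Complex.exp (-a * |t - u|) * Complex.exp (Complex.I * E * |u|) =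
      2 * a / (a ^ 2 + E ^ 2) * Complex.exp (Complex.I * E * t) +
        2 * Complex.I * E / (a ^ 2 + E ^ 2) * Complex.exp (-a * t) := by
    intro t ht
    have hi : Integrable fun u : ℝ =>
        Complex.exp (-a * |t - u|) * Complex.exp (Complex.I * E * |u|) := by
      refine ((integrable_exp_neg_abs ha).comp_sub_left t).mono ?_ (Eventually.of_forall fun u => ?_)
      · exact Continuous.aestronglyMeasurable (by fun_prop)
      · rw [norm_mul]
        have : ‖Complex.exp (Complex.I * E * |u|)‖ = 1 := by
          rw [Complex.norm_exp]; simp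
        rw [this, mul_one]
    have hre1 : 0 < (a - Complex.I * E).re := by simpa using ha
    have hre2 : (-a + Complex.I * E).re < 0 := by simpa using ha
    have hne1 : a - Complex.I * E ≠ 0 := fun h => by rw [h] at hre1; simp at hre1
    have hne2 : a + Complex.I * E ≠ 0 := fun h => by
      have : (a + Complex.I * E).re = 0 := by rw [h]; simp
      simp at this; linarith
    have hprod : (a - Complex.I * E) * (a + Complex.I * E) = a ^ 2 + E ^ 2 := by
      linear_combination (-(E : ℂ) ^ 2) * Complex.I_sq
    have h1 : ∫ u : ℝ in Set.Iic 0, Complex.exp (-a * |t - u|) * Complex.exp (Complex.I * E * |u|) =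
        Complex.exp (-a * t) / (a - Complex.I * E) := by
      rw [setIntegral_congr_fun
        (g := fun u : ℝ => Complex.exp (-a * t) * Complex.exp ((a - Complex.I * E) * u))
        measurableSet_Iic, integral_const_mul, integral_exp_mul_complex_Iic hre1]
      · simp [div_eq_mul_inv]
      · intro u hu
        have hu' := Set.mem_Iic.1 hu
        simp only [abs_of_nonpos hu', abs_of_nonneg (by linarith : 0 ≤ t - u), ← Complex.exp_add]
        congr 1; push_cast; ring
    have h2 : ∫ u : ℝ in Set.Ioc 0 t, Complex.exp (-a * |t - u|) * Complex.exp (Complex.I * E * |u|) =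
        (Complex.exp (Complex.I * E * t) - Complex.exp (-a * t)) / (a + Complex.I * E) := by
      rw [setIntegral_congr_fun
        (g := fun u : ℝ => Complex.exp (-a * t) * Complex.exp ((a + Complex.I * E) * u))
        measurableSet_Ioc, integral_const_mul, ← intervalIntegral.integral_of_le ht,
        integral_exp_mul_complex hne2, mul_div_assoc', mul_sub, ← Complex.exp_add]
      · congr 2
        · congr 1; ring
        · simp
      · intro u hu
        simp only [abs_of_pos hu.1, abs_of_nonneg (sub_nonneg.2 hu.2), ← Complex.exp_add]
        congr 1; push_cast; ring
    have h3 : ∫ u : ℝ in Set.Ioi t, Complex.exp (-a * |t - u|) * Complex.exp (Complex.I * E * |u|) =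
        Complex.exp (Complex.I * E * t) / (a - Complex.I * E) := by
      rw [setIntegral_congr_fun
        (g := fun u : ℝ => Complex.exp (a * t) * Complex.exp ((-a + Complex.I * E) * u))
        measurableSet_Ioi, integral_const_mul, integral_exp_mul_complex_Ioi hre2,
        mul_div_assoc', mul_neg, ← Complex.exp_add,
        show -a + Complex.I * E = -(a - Complex.I * E) by ring, div_neg, neg_div, neg_neg]
      · congr 2; ring
      · intro u hu
        have hu' := Set.mem_Ioi.1 hu
        simp only [abs_of_pos (ht.trans_lt hu'), abs_of_neg (sub_neg.2 hu'), ← Complex.exp_add]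
        congr 1; push_cast; ring
    rw [← intervalIntegral.integral_Iic_add_Ioi hi.integrableOn hi.integrableOn (b := 0),
      ← Set.Ioc_union_Ioi_eq_Ioi ht, setIntegral_union (Set.Ioc_disjoint_Ioi le_rfl)
        measurableSet_Ioi hi.integrableOn hi.integrableOn, h1, h2, h3, ← hprod]
    field_simp
    ring
  rcases le_total 0 t with ht | ht
  · rw [abs_of_nonneg ht]; exact key t ht
  · rw [abs_of_nonpos ht, ← key (-t) (by linarith),
      ← integral_neg_eq_self (fun u : ℝ => Complex.exp (-a * |t - u|) * Complex.exp (Complex.I * E * |u|))]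
    refine integral_congr_ae (Eventually.of_forall fun u => ?_)
    have : |t - -u| = |-t - u| := by rw [← abs_neg]; congr 1; ring
    simp only [this, abs_neg]

theorem tendsto_sinh_atTop : Tendsto Real.sinh atTop atTop :=
  tendsto_atTop_mono' atTop (by
    filter_upwards [eventually_ge_atTop 0] with s hs using Real.self_le_sinh_iff.2 hs) tendsto_id

/-- After dividing both arguments by `sinh s > 0`, which cancels in the difference, they tend to
`iq` and `-iq`; and `log z - log (-z) = πi` when `Im z > 0`. -/
theorem tendsto_log_sub_log {q : ℂ} (hq : 0 < q.re) :
    Tendsto (fun s : ℝ => Complex.log (1 + Complex.I * q * (Real.sinh s : ℂ)) -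
      Complex.log (1 - Complex.I * q * (Real.sinh s : ℂ))) atTop (𝓝 (Real.pi * Complex.I)) := by
  have him : 0 < (Complex.I * q).im := by simpa using hq
  have hne : Complex.I * q ≠ 0 := fun h => by simp [h] at him
  have hval : Complex.log (0 + Complex.I * q) - Complex.log (0 - Complex.I * q) = Real.pi * Complex.I := by
    rw [zero_add, zero_sub]
    apply Complex.ext
    · simp [Complex.log_re]
    · rw [Complex.sub_im, Complex.log_im, Complex.log_im,
        Complex.arg_neg_eq_arg_sub_pi_of_im_pos him]
      simp
  have h0 : Tendsto (fun s : ℝ => ((Real.sinh s)⁻¹ : ℂ)) atTop (𝓝 0) := by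
    have : Tendsto (fun s : ℝ => (((Real.sinh s)⁻¹ : ℝ) : ℂ)) atTop (𝓝 ((0 : ℝ) : ℂ)) :=
      (Complex.continuous_ofReal.tendsto 0).comp (tendsto_inv_atTop_zero.comp tendsto_sinh_atTop)
    simpa using this
  have hlim : Tendsto (fun s : ℝ => Complex.log (((Real.sinh s)⁻¹ : ℂ) + Complex.I * q) -
      Complex.log (((Real.sinh s)⁻¹ : ℂ) - Complex.I * q)) atTop (𝓝 (Real.pi * Complex.I)) := by
    rw [← hval]
    refine Tendsto.sub ?_ ?_
    · refine (h0.add_const _).clog ?_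
      rw [zero_add]
      exact Or.inr him.ne'
    · refine (h0.sub_const _).clog ?_
      rw [zero_sub]
      exact Or.inr (by rw [Complex.neg_im]; linarith)
  refine hlim.congr' ?_
  filter_upwards [tendsto_sinh_atTop.eventually_gt_atTop 0] with s hs
  have hsC : (Real.sinh s : ℂ) ≠ 0 := by exact_mod_cast hs.ne'
  have e1 : 1 + Complex.I * q * (Real.sinh s : ℂ) =
      (Real.sinh s : ℂ) * (((Real.sinh s : ℂ))⁻¹ + Complex.I * q) := by
    rw [mul_add, mul_inv_cancel₀ hsC]; ring
  have e2 : 1 - Complex.I * q * (Real.sinh s : ℂ) =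
      (Real.sinh s : ℂ) * (((Real.sinh s : ℂ))⁻¹ - Complex.I * q) := by
    rw [mul_sub, mul_inv_cancel₀ hsC]; ring
  have him1 : (((Real.sinh s : ℂ))⁻¹ + Complex.I * q).im = (Complex.I * q).im := by
    rw [← Complex.ofReal_inv, Complex.add_im, Complex.ofReal_im, zero_add]
  have him2 : (((Real.sinh s : ℂ))⁻¹ - Complex.I * q).im = -(Complex.I * q).im := by
    rw [← Complex.ofReal_inv, Complex.sub_im, Complex.ofReal_im, zero_sub]
  rw [e1, e2, Complex.log_ofReal_mul hs, Complex.log_ofReal_mul hs]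
  · ring
  · intro h; rw [h, Complex.zero_im] at him2; linarith
  · intro h; rw [h, Complex.zero_im] at him1; linarith

theorem integrableOn_resolvent_cosh {ω l : ℂ} {d : ℝ} (hd : 0 < d)
    (hl : ∀ s : ℝ, d * Real.cosh s ^ 2 ≤ ‖ω ^ 2 * (Real.cosh s : ℂ) ^ 2 + l‖) :
    IntegrableOn (fun s : ℝ => 2 * (ω * (Real.cosh s : ℂ)) / (ω ^ 2 * (Real.cosh s : ℂ) ^ 2 + l))
      (Set.Ioi 0) := by
  have hne : ∀ s : ℝ, ω ^ 2 * (Real.cosh s : ℂ) ^ 2 + l ≠ 0 := fun s => by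
    rw [← norm_pos_iff]
    have := Real.cosh_pos s
    exact lt_of_lt_of_le (by positivity) (hl s)
  refine Integrable.mono' ((integrableOn_cosh_rpow (a := 1) one_pos).const_mul (2 * ‖ω‖ / d)) ?_
    (Eventually.of_forall fun s => ?_)
  · have := Real.continuous_cosh
    exact Continuous.aestronglyMeasurable (by fun_prop (disch := exact hne _))
  · have hc := Real.cosh_pos s
    rw [norm_div, Real.rpow_neg_one, norm_mul, norm_mul, Complex.norm_real,
      Real.norm_of_nonneg hc.le, Complex.norm_ofNat]
    calc 2 * (‖ω‖ * Real.cosh s) / ‖ω ^ 2 * (Real.cosh s : ℂ) ^ 2 + l‖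
        ≤ 2 * (‖ω‖ * Real.cosh s) / (d * Real.cosh s ^ 2) := by gcongr; exact hl s
      _ = _ := by field_simp

/-- A primitive is `(2/v) arctan(q sinh s)` with `q = ω/v`, written with logarithms; `Re q > 0`
keeps both of them off the branch cut. -/
theorem integral_resolvent_cosh {ω v l : ℂ} {d : ℝ} (hv : v ^ 2 = ω ^ 2 + l) (hv0 : v ≠ 0)
    (hq : 0 < (ω / v).re) (hd : 0 < d)
    (hl : ∀ s : ℝ, d * Real.cosh s ^ 2 ≤ ‖ω ^ 2 * (Real.cosh s : ℂ) ^ 2 + l‖) :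
    ∫ s : ℝ in Set.Ioi 0, 2 * (ω * (Real.cosh s : ℂ)) / (ω ^ 2 * (Real.cosh s : ℂ) ^ 2 + l) =
      Real.pi / v := by
  set q := ω / v with hqdef
  have hne : ∀ s : ℝ, ω ^ 2 * (Real.cosh s : ℂ) ^ 2 + l ≠ 0 := fun s => by
    rw [← norm_pos_iff]
    have := Real.cosh_pos s
    exact lt_of_lt_of_le (by positivity) (hl s)
  have hslit : ∀ s : ℝ, 0 ≤ s → 1 + Complex.I * q * (Real.sinh s : ℂ) ∈ Complex.slitPlane ∧
      1 - Complex.I * q * (Real.sinh s : ℂ) ∈ Complex.slitPlane := by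
    intro s hs
    rcases hs.eq_or_lt with rfl | hs
    · simp
    · have : 0 < Real.sinh s := Real.sinh_pos_iff.2 hs
      have h1 : (Complex.I * q * (Real.sinh s : ℂ)).im = q.re * Real.sinh s := by
        rw [Complex.im_mul_ofReal]; simp
      have h2 : 0 < q.re * Real.sinh s := mul_pos hq this
      refine ⟨Or.inr ?_, Or.inr ?_⟩
      · rw [Complex.add_im, h1, Complex.one_im, zero_add]; exact h2.ne'
      · rw [Complex.sub_im, h1, Complex.one_im, zero_sub]; exact (neg_lt_zero.2 h2).ne
  have hderiv : ∀ s ∈ Set.Ici (0 : ℝ), HasDerivAt (fun s : ℝ => 1 / (Complex.I * v) *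
      (Complex.log (1 + Complex.I * q * (Real.sinh s : ℂ)) -
      Complex.log (1 - Complex.I * q * (Real.sinh s : ℂ))))
      (2 * (ω * (Real.cosh s : ℂ)) / (ω ^ 2 * (Real.cosh s : ℂ) ^ 2 + l)) s := by
    intro s hs
    obtain ⟨hs1, hs2⟩ := hslit s hs
    have hsinh : HasDerivAt (fun s : ℝ => (Real.sinh s : ℂ)) (Real.cosh s : ℂ) s :=
      (Real.hasDerivAt_sinh s).ofReal_comp
    have h1 := ((hsinh.const_mul (Complex.I * q)).const_add 1).clog_real hs1
    have h2 := ((hsinh.const_mul (Complex.I * q)).const_sub 1).clog_real hs2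
    convert! (h1.sub h2).const_mul (1 / (Complex.I * v)) using 1
    have hn1 := Complex.slitPlane_ne_zero hs1
    have hn2 := Complex.slitPlane_ne_zero hs2
    have hcs : (Real.cosh s : ℂ) ^ 2 = 1 + (Real.sinh s : ℂ) ^ 2 := by
      have := Real.cosh_sq s
      rw [← Complex.ofReal_pow, this]; push_cast; ring
    have hω : ω = q * v := by rw [hqdef, div_mul_cancel₀ _ hv0]
    have hden : ω ^ 2 * (Real.cosh s : ℂ) ^ 2 + l = v ^ 2 *
        ((1 + Complex.I * q * (Real.sinh s : ℂ)) * (1 - Complex.I * q * (Real.sinh s : ℂ))) := by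
      have hl' : l = v ^ 2 - ω ^ 2 := by rw [hv]; ring
      rw [hcs, hl', hω]
      linear_combination (v ^ 2 * q ^ 2 * (Real.sinh s : ℂ) ^ 2) * Complex.I_sq
    rw [hden, div_sub_div _ _ hn1 hn2]
    have hI := Complex.I_ne_zero
    rw [hω]
    field_simp
    ring
  rw [integral_Ioi_of_hasDerivAt_of_tendsto' hderiv (integrableOn_resolvent_cosh hd hl)
    ((tendsto_log_sub_log hq).const_mul _)]
  simp
  field_simp
  simp

end Integrals

/-! ### Injectivity of the Fourier transform; convolution identities from symbols. -/

section FourierUniqueness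

/-- A bump function is the transform of a Schwartz function `ψ`, and the multiplication formula `∫
𝓕f ψ = ∫ f 𝓕ψ` shows that `f` integrates to zero against it. -/
theorem ae_eq_zero_of_fourier_ae_eq_zero {f : ℝ → ℂ} (hf : Integrable f)
    (h : ∀ᵐ ξ, 𝓕 f ξ = 0) : ∀ᵐ x, f x = 0 := by
  refine ae_eq_zero_of_integral_contDiff_smul_eq_zero hf.locallyIntegrable fun g hg hgc => ?_
  have hg1 : ContDiff ℝ ((⊤ : ℕ∞) : WithTop ℕ∞) (fun x => (g x : ℂ)) := Complex.ofRealCLM.contDiff.comp hg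
  have hgc1 : HasCompactSupport (fun x => (g x : ℂ)) := hgc.comp_left Complex.ofReal_zero
  set φ : SchwartzMap ℝ ℂ := hgc1.toSchwartzMap hg1 with hφ
  set ψ : SchwartzMap ℝ ℂ := 𝓕⁻ φ with hψ
  have hψφ : 𝓕 (ψ : ℝ → ℂ) = φ := by
    rw [← SchwartzMap.fourier_coe, hψ, FourierTransform.fourier_fourierInv_eq]
  have hself : ∫ ξ, 𝓕 f ξ • ψ ξ = ∫ x, f x • 𝓕 (ψ : ℝ → ℂ) x := by
    simpa using! VectorFourier.integral_fourierIntegral_smul_eq_flip (L := innerₗ ℝ)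
      Real.continuous_fourierChar continuous_inner hf ψ.integrable
  have h0 : ∫ ξ, 𝓕 f ξ • ψ ξ = 0 := by
    rw [← integral_zero ℝ ℂ]
    refine integral_congr_ae ?_
    filter_upwards [h] with ξ hξ
    rw [hξ, zero_smul]
  rw [h0, hψφ] at hself
  rw [hself]
  refine integral_congr_ae (Eventually.of_forall fun x => ?_)
  change (g x : ℝ) • f x = f x • (g x : ℂ)
  rw [smul_eq_mul, mul_comm]; rfl

theorem convolution_ae_eq_of_fourier {f₁ f₂ f₃ : ℝ → ℂ} (h₁ : Integrable f₁) (h₂ : Integrable f₂)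
    (h₃ : Integrable f₃) (h : ∀ᵐ ξ, 𝓕 f₁ ξ * 𝓕 f₂ ξ = 𝓕 f₃ ξ) :
    ∀ᵐ x, ∫ u, f₁ (x - u) * f₂ u = f₃ x := by
  have hconv : Integrable (convolution f₁ f₂ (ContinuousLinearMap.mul ℂ ℂ) volume) :=
    h₁.integrable_convolution _ h₂
  have hF : ∀ᵐ ξ, 𝓕 (fun x => convolution f₁ f₂ (ContinuousLinearMap.mul ℂ ℂ) volume x - f₃ x) ξ = 0 := by
    filter_upwards [h] with ξ hξ
    have h4 := Real.fourier_mul_convolution_eq h₁ h₂ ξ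
    rw [hξ] at h4
    have hc1 := (Real.fourierIntegral_convergent_iff (f := convolution f₁ f₂ (ContinuousLinearMap.mul ℂ ℂ) volume) ξ).2 hconv
    have hc2 := (Real.fourierIntegral_convergent_iff (f := f₃) ξ).2 h₃
    rw [Real.fourier_eq] at h4 ⊢
    rw [Real.fourier_eq] at h4
    simp only [smul_sub]
    rw [integral_sub hc1 hc2, h4, sub_self]
  filter_upwards [ae_eq_zero_of_fourier_ae_eq_zero (hconv.sub h₃) hF] with x hx
  rw [← sub_eq_zero, ← hx, Pi.sub_apply, convolution_eq_swap]
  rfl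

end FourierUniqueness

/-! ### Fourier transforms of superpositions of exponentials. -/

section Superposition

variable {p : ℝ → ℂ} {p₀ : ℝ} {ω : ℂ}

/-- Integrating first in `t` leaves `2/(Re ω cosh s)`, which is integrable in `s`. -/
theorem integrable_prod_expSup (hp : Measurable p) (hp₀ : ∀ s, ‖p s‖ ≤ p₀) (hω : 0 < ω.re) :
    Integrable (fun q : ℝ × ℝ => p q.2 * Complex.exp (-(ω * |q.1|) * (Real.cosh q.2 : ℂ)))
      (volume.prod (volume.restrict (Set.Ioi 0))) := by
  have hnorm : ∀ t s : ℝ, ‖p s * Complex.exp (-(ω * |t|) * (Real.cosh s : ℂ))‖ =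
      ‖p s‖ * Real.exp (-(ω.re * Real.cosh s) * |t|) := by
    intro t s
    rw [norm_mul, norm_exp_neg_mul_cosh, Complex.re_mul_ofReal]
    ring_nf
  have hmeas : Measurable (fun q : ℝ × ℝ => p q.2 * Complex.exp (-(ω * |q.1|) * (Real.cosh q.2 : ℂ))) := by
    have := Real.measurable_cosh
    fun_prop
  refine (integrable_prod_iff' hmeas.aestronglyMeasurable).2 ⟨?_, ?_⟩
  · refine Eventually.of_forall fun s => ?_
    refine ((integrable_exp_neg_abs_real (mul_pos hω (Real.cosh_pos s))).const_mul ‖p s‖).mono'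
      (hmeas.comp measurable_prodMk_right).aestronglyMeasurable (Eventually.of_forall fun t => ?_)
    exact (hnorm t s).le
  · simp only [hnorm]
    have : ∀ s, ∫ t : ℝ, ‖p s‖ * Real.exp (-(ω.re * Real.cosh s) * |t|) =
        ‖p s‖ * (2 / (ω.re * Real.cosh s)) := fun s => by
      rw [integral_const_mul, integral_exp_neg_abs_real (mul_pos hω (Real.cosh_pos s))]
    simp only [this]
    refine ((integrableOn_cosh_rpow (a := 1) one_pos).const_mul (p₀ * (2 / ω.re))).mono' ?_
      (Eventually.of_forall fun s => ?_)
    · have := Real.measurable_cosh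
      exact Measurable.aestronglyMeasurable (by fun_prop)
    · have hc := Real.cosh_pos s
      rw [norm_mul, norm_norm, Real.norm_of_nonneg (by positivity), Real.rpow_neg_one]
      have := hp₀ s
      calc ‖p s‖ * (2 / (ω.re * Real.cosh s)) ≤ p₀ * (2 / (ω.re * Real.cosh s)) := by gcongr
        _ = _ := by field_simp

theorem integrable_expSup_abs (hp : Measurable p) (hp₀ : ∀ s, ‖p s‖ ≤ p₀) (hω : 0 < ω.re) :
    Integrable fun t : ℝ => expSup p (ω * |t|) :=
  (integrable_prod_expSup hp hp₀ hω).integral_prod_left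

/-- By Fubini, integrals against `K₀` on the line reduce to integrals against a single exponential.
-/
theorem integral_mul_expSup (hp : Measurable p) (hp₀ : ∀ s, ‖p s‖ ≤ p₀) (hω : 0 < ω.re)
    {e : ℝ → ℂ} (he : Measurable e) (he1 : ∀ t, ‖e t‖ ≤ 1) :
    ∫ t : ℝ, e t * expSup p (ω * |t|) =
      ∫ s in Set.Ioi (0 : ℝ), p s * ∫ t : ℝ, Complex.exp (-(ω * (Real.cosh s : ℂ)) * |t|) * e t := by
  have hint : Integrable (fun q : ℝ × ℝ => e q.1 * (p q.2 * Complex.exp (-(ω * |q.1|) * (Real.cosh q.2 : ℂ))))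
      (volume.prod (volume.restrict (Set.Ioi 0))) :=
    (integrable_prod_expSup hp hp₀ hω).bdd_mul (he.comp measurable_fst).aestronglyMeasurable (c := 1)
      (Eventually.of_forall fun q => he1 q.1)
  calc ∫ t : ℝ, e t * expSup p (ω * |t|)
      = ∫ t : ℝ, ∫ s in Set.Ioi (0 : ℝ), e t * (p s * Complex.exp (-(ω * |t|) * (Real.cosh s : ℂ))) := by
        simp only [expSup, integral_const_mul]
    _ = ∫ s in Set.Ioi (0 : ℝ), ∫ t : ℝ, e t * (p s * Complex.exp (-(ω * |t|) * (Real.cosh s : ℂ))) :=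
        integral_integral_swap hint
    _ = _ := by
        refine integral_congr_ae (Eventually.of_forall fun s => ?_)
        simp only
        rw [← integral_const_mul]
        refine integral_congr_ae (Eventually.of_forall fun t => ?_)
        simp only
        have : -(ω * |t|) * (Real.cosh s : ℂ) = -(ω * (Real.cosh s : ℂ)) * |t| := by ring
        rw [this]; ring

theorem fourier_expSup (hp : Measurable p) (hp₀ : ∀ s, ‖p s‖ ≤ p₀) (hω : 0 < ω.re) (ξ : ℝ) :
    𝓕 (fun t : ℝ => expSup p (ω * |t|)) ξ = ∫ s in Set.Ioi (0 : ℝ), p s *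
      (2 * (ω * (Real.cosh s : ℂ)) / (ω ^ 2 * (Real.cosh s : ℂ) ^ 2 + ((2 * Real.pi * ξ : ℝ) : ℂ) ^ 2)) := by
  rw [Real.fourier_real_eq_integral_exp_smul]
  simp only [smul_eq_mul]
  rw [integral_mul_expSup hp hp₀ hω (e := fun v : ℝ => Complex.exp (((-2 * Real.pi * v * ξ : ℝ) : ℂ) * Complex.I))
    (by fun_prop) (fun t => by rw [Complex.norm_exp_ofReal_mul_I])]
  refine integral_congr_ae (Eventually.of_forall fun s => ?_)
  simp only
  have ha : 0 < (ω * (Real.cosh s : ℂ)).re := by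
    rw [Complex.re_mul_ofReal]; exact mul_pos hω (Real.cosh_pos s)
  have h := integral_exp_neg_abs_mul_exp (y := 2 * Real.pi * ξ) ha
  rw [mul_pow] at h
  rw [← h]
  congr 1
  refine integral_congr_ae (Eventually.of_forall fun t => ?_)
  simp only
  congr 2
  push_cast; ring

theorem fourier_exp_neg_abs {θ : ℂ} (hθ : 0 < θ.re) (ξ : ℝ) :
    𝓕 (fun t : ℝ => Complex.exp (-θ * |t|)) ξ = 2 * θ / (θ ^ 2 + ((2 * Real.pi * ξ : ℝ) : ℂ) ^ 2) := by
  rw [Real.fourier_real_eq_integral_exp_smul, ← integral_exp_neg_abs_mul_exp hθ]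
  refine integral_congr_ae (Eventually.of_forall fun t => ?_)
  simp only [smul_eq_mul]
  rw [mul_comm]
  congr 2
  push_cast; ring

end Superposition

/-! ### Kernels on the straight line and their symbols. -/

section Kernels

/-- The relation between the energy `E` and the decay rate `ω` in the bulk. -/
structure Admissible (m : ℝ) (E ω : ℂ) : Prop where
  m_pos : 0 < m
  sq_eq : ω ^ 2 = m ^ 2 - E ^ 2
  re_pos : 0 < ω.re
  re_sq_pos : 0 < (ω ^ 2).re

/-- The symbol weight `1 / (ω² cosh² s + E²)`. -/
def resolventWeight (ω E : ℂ) (s : ℝ) : ℂ := 1 / (ω ^ 2 * (Real.cosh s : ℂ) ^ 2 + E ^ 2)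

/-- The Green's function on a straight line. -/
def lineGreen (ω : ℂ) (t : ℝ) : ℂ := 1 / (2 * (Real.pi : ℂ)) * besselK0 (ω * |t|)

/-- The kernel with symbol `1 / (√(ξ² + ω²) (√(ξ² + ω²) + m))`. -/
def lineW (m : ℝ) (ω E : ℂ) (t : ℝ) : ℂ :=
  (m : ℂ) / (Real.pi : ℂ) * expSup (resolventWeight ω E) (ω * |t|)

/-- The kernel with symbol `1 / (ξ² + θ²)`. -/
def lineR (θ : ℂ) (t : ℝ) : ℂ := 1 / (2 * θ) * Complex.exp (-θ * |t|)

variable {m : ℝ} {E ω : ℂ}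

/-- Substituting `E² = m² - ω²` turns the denominator into `ω² sinh² s + m²`, bounded away from
zero. -/
theorem Admissible.re_den (h : Admissible m E ω) (s : ℝ) :
    (ω ^ 2 * (Real.cosh s : ℂ) ^ 2 + E ^ 2).re = (ω ^ 2).re * Real.sinh s ^ 2 + m ^ 2 := by
  have hE : E ^ 2 = m ^ 2 - ω ^ 2 := by rw [h.sq_eq]; ring
  have hc : (Real.cosh s : ℂ) ^ 2 = 1 + ((Real.sinh s ^ 2 : ℝ) : ℂ) := by
    rw [← Complex.ofReal_pow, Real.cosh_sq s]; push_cast; ring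
  have : ω ^ 2 * (Real.cosh s : ℂ) ^ 2 + E ^ 2 =
      ω ^ 2 * ((Real.sinh s ^ 2 : ℝ) : ℂ) + ((m ^ 2 : ℝ) : ℂ) := by
    rw [hE, hc]; push_cast; ring
  rw [this, Complex.add_re, Complex.re_mul_ofReal, Complex.ofReal_re]

theorem Admissible.sq_le_norm_den (h : Admissible m E ω) (s : ℝ) :
    m ^ 2 ≤ ‖ω ^ 2 * (Real.cosh s : ℂ) ^ 2 + E ^ 2‖ := by
  refine le_trans ?_ (Complex.re_le_norm _)
  rw [h.re_den]
  have := h.re_sq_pos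
  nlinarith [mul_nonneg this.le (sq_nonneg (Real.sinh s))]

theorem Admissible.le_norm_den (h : Admissible m E ω) (s : ℝ) :
    min (ω ^ 2).re (m ^ 2) * Real.cosh s ^ 2 ≤ ‖ω ^ 2 * (Real.cosh s : ℂ) ^ 2 + E ^ 2‖ := by
  refine le_trans ?_ (Complex.re_le_norm _)
  rw [h.re_den, Real.cosh_sq s, mul_add, mul_one]
  have h1 := min_le_left (ω ^ 2).re (m ^ 2)
  have h2 := min_le_right (ω ^ 2).re (m ^ 2)
  gcongr

theorem Admissible.den_ne_zero (h : Admissible m E ω) (s : ℝ) :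
    ω ^ 2 * (Real.cosh s : ℂ) ^ 2 + E ^ 2 ≠ 0 := by
  rw [← norm_pos_iff]
  exact lt_of_lt_of_le (pow_pos h.m_pos 2) (h.sq_le_norm_den s)

theorem Admissible.norm_resolventWeight_le (h : Admissible m E ω) (s : ℝ) :
    ‖resolventWeight ω E s‖ ≤ 1 / m ^ 2 := by
  rw [resolventWeight, norm_div, norm_one]
  exact one_div_le_one_div_of_le (pow_pos h.m_pos 2) (h.sq_le_norm_den s)

theorem measurable_resolventWeight (ω E : ℂ) : Measurable (resolventWeight ω E) := by
  have := Real.measurable_cosh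
  unfold resolventWeight
  fun_prop

/-- The case `v = m` of the resolvent integral, since `ω² + E² = m²`. It encodes that the symbol of
`ℒ` on the line vanishes at `ξ = ±E`. -/
theorem Admissible.integral_resolvent (h : Admissible m E ω) :
    ∫ s : ℝ in Set.Ioi 0, 2 * (ω * (Real.cosh s : ℂ)) / (ω ^ 2 * (Real.cosh s : ℂ) ^ 2 + E ^ 2) =
      (Real.pi : ℂ) / (m : ℂ) := by
  refine integral_resolvent_cosh (d := min (ω ^ 2).re (m ^ 2)) ?_ ?_ ?_ ?_ h.le_norm_den
  · rw [h.sq_eq]; ring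
  · exact_mod_cast h.m_pos.ne'
  · rw [Complex.div_ofReal_re]; exact div_pos h.re_pos h.m_pos
  · exact lt_min h.re_sq_pos (pow_pos h.m_pos 2)

/-- The principal square root of `ω² + x²`. -/
def symbolRoot (ω : ℂ) (x : ℝ) : ℂ := csqrt (ω ^ 2 + (x : ℂ) ^ 2)

theorem Admissible.re_symbol (h : Admissible m E ω) (x : ℝ) :
    0 < (ω ^ 2 + (x : ℂ) ^ 2).re := by
  rw [← Complex.ofReal_pow, Complex.add_re, Complex.ofReal_re]
  have := h.re_sq_pos
  positivity

theorem Admissible.symbolRoot_re (h : Admissible m E ω) (x : ℝ) : 0 < (symbolRoot ω x).re :=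
  csqrt_re_pos (Or.inl (h.re_symbol x))

theorem Admissible.symbolRoot_sq (h : Admissible m E ω) (x : ℝ) :
    symbolRoot ω x ^ 2 = ω ^ 2 + (x : ℂ) ^ 2 :=
  csqrt_sq fun h0 => by have := h.re_symbol x; simp [h0] at this

theorem Admissible.symbolRoot_ne_zero (h : Admissible m E ω) (x : ℝ) : symbolRoot ω x ≠ 0 :=
  fun h0 => by have := h.symbolRoot_re x; simp [h0] at this

theorem le_norm_den' (x s : ℝ) :
    (ω ^ 2).re * Real.cosh s ^ 2 ≤ ‖ω ^ 2 * (Real.cosh s : ℂ) ^ 2 + (x : ℂ) ^ 2‖ := by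
  refine le_trans ?_ (Complex.re_le_norm _)
  rw [← Complex.ofReal_pow, ← Complex.ofReal_pow, Complex.add_re, Complex.re_mul_ofReal,
    Complex.ofReal_re]
  linarith [sq_nonneg x]

theorem Admissible.integral_resolvent' (h : Admissible m E ω) (x : ℝ) :
    ∫ s : ℝ in Set.Ioi 0, 2 * (ω * (Real.cosh s : ℂ)) / (ω ^ 2 * (Real.cosh s : ℂ) ^ 2 + (x : ℂ) ^ 2) =
      Real.pi / symbolRoot ω x := by
  refine integral_resolvent_cosh (h.symbolRoot_sq x) (h.symbolRoot_ne_zero x) ?_ h.re_sq_pos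
    (le_norm_den' x)
  refine div_re_pos h.re_pos h.re_sq_pos (h.symbolRoot_re x) ?_
  rw [h.symbolRoot_sq]; exact h.re_symbol x

theorem fourier_const_mul (c : ℂ) (f : ℝ → ℂ) (ξ : ℝ) :
    𝓕 (fun t => c * f t) ξ = c * 𝓕 f ξ := by
  rw [Real.fourier_real_eq_integral_exp_smul, Real.fourier_real_eq_integral_exp_smul,
    ← integral_const_mul]
  refine integral_congr_ae (Eventually.of_forall fun t => ?_)
  simp only [smul_eq_mul]; ring

theorem Admissible.fourier_lineGreen (h : Admissible m E ω) (ξ : ℝ) :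
    𝓕 (lineGreen ω) ξ = 1 / (2 * symbolRoot ω (2 * Real.pi * ξ)) := by
  have h1 : lineGreen ω = fun t : ℝ => 1 / (2 * (Real.pi : ℂ)) * expSup (fun _ => 1) (ω * |t|) := by
    ext t; rw [lineGreen, besselK0_eq_expSup]
  rw [h1, fourier_const_mul, fourier_expSup measurable_const (p₀ := 1) (by simp) h.re_pos]
  simp only [one_mul]
  rw [h.integral_resolvent']
  have := h.symbolRoot_ne_zero (2 * Real.pi * ξ)
  have hpi : (Real.pi : ℂ) ≠ 0 := by exact_mod_cast Real.pi_ne_zero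
  field_simp

/-- Partial fractions in `ω² cosh² s` give a multiple of `(1/m - 1/v)/(x² - E²)`, and `x² - E² = (v
- m)(v + m)` cancels the factor `v - m`. -/
theorem Admissible.fourier_lineW (h : Admissible m E ω) (ξ : ℝ)
    (hξ : ((2 * Real.pi * ξ : ℝ) : ℂ) ^ 2 ≠ E ^ 2) :
    𝓕 (lineW m ω E) ξ = 1 / (symbolRoot ω (2 * Real.pi * ξ) * (symbolRoot ω (2 * Real.pi * ξ) + m)) := by
  have hsq := h.symbolRoot_sq (2 * Real.pi * ξ)
  have hv0 := h.symbolRoot_ne_zero (2 * Real.pi * ξ)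
  have hJ := h.integral_resolvent' (2 * Real.pi * ξ)
  have hd' := le_norm_den' (ω := ω) (2 * Real.pi * ξ)
  have hvre := h.symbolRoot_re (2 * Real.pi * ξ)
  set v := symbolRoot ω (2 * Real.pi * ξ)
  set x : ℂ := ((2 * Real.pi * ξ : ℝ) : ℂ)
  have hpi : (Real.pi : ℂ) ≠ 0 := by exact_mod_cast Real.pi_ne_zero
  have hm : (m : ℂ) ≠ 0 := by exact_mod_cast h.m_pos.ne'
  have hvm : v + m ≠ 0 := fun h0 => by
    have : (v + m).re = 0 := by rw [h0]; simp
    rw [Complex.add_re, Complex.ofReal_re] at this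
    linarith [h.m_pos]
  have hxE : x ^ 2 - E ^ 2 ≠ 0 := sub_ne_zero.2 hξ
  have h1 : lineW m ω E = fun t : ℝ => (m : ℂ) / (Real.pi : ℂ) * expSup (resolventWeight ω E) (ω * |t|) := rfl
  rw [h1, fourier_const_mul, fourier_expSup (measurable_resolventWeight ω E)
    h.norm_resolventWeight_le h.re_pos]
  have hpart : ∀ s : ℝ, resolventWeight ω E s *
      (2 * (ω * (Real.cosh s : ℂ)) / (ω ^ 2 * (Real.cosh s : ℂ) ^ 2 + x ^ 2)) =
      (1 / (x ^ 2 - E ^ 2)) * (2 * (ω * (Real.cosh s : ℂ)) / (ω ^ 2 * (Real.cosh s : ℂ) ^ 2 + E ^ 2) -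
        2 * (ω * (Real.cosh s : ℂ)) / (ω ^ 2 * (Real.cosh s : ℂ) ^ 2 + x ^ 2)) := by
    intro s
    have hn1 := h.den_ne_zero s
    have hn2 : ω ^ 2 * (Real.cosh s : ℂ) ^ 2 + x ^ 2 ≠ 0 := by
      rw [← norm_pos_iff]
      exact lt_of_lt_of_le (mul_pos h.re_sq_pos (pow_pos (Real.cosh_pos s) 2)) (hd' s)
    rw [resolventWeight, div_sub_div _ _ hn1 hn2, div_mul_div_comm, div_mul_div_comm,
      div_eq_div_iff (mul_ne_zero hn1 hn2) (mul_ne_zero hxE (mul_ne_zero hn1 hn2))]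
    ring
  have hx : ((2 * Real.pi * ξ : ℝ) : ℂ) = x := rfl
  simp only [hx, hpart]
  rw [integral_const_mul, integral_sub
    (integrableOn_resolvent_cosh (lt_min h.re_sq_pos (pow_pos h.m_pos 2)) h.le_norm_den)
    (integrableOn_resolvent_cosh h.re_sq_pos hd'), h.integral_resolvent, hJ]
  have hvm' : x ^ 2 - E ^ 2 = (v - m) * (v + m) := by
    have : (v - m) * (v + m) = v ^ 2 - m ^ 2 := by ring
    rw [this, hsq, h.sq_eq]; ring
  have hvm2 : v - m ≠ 0 := fun h0 => hxE (by rw [hvm', h0, zero_mul])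
  rw [hvm']
  field_simp

theorem fourier_lineR {θ : ℂ} (hθ : 0 < θ.re) (ξ : ℝ) :
    𝓕 (lineR θ) ξ = 1 / (θ ^ 2 + ((2 * Real.pi * ξ : ℝ) : ℂ) ^ 2) := by
  have h1 : lineR θ = fun t : ℝ => 1 / (2 * θ) * Complex.exp (-θ * |t|) := rfl
  have hθ0 : θ ≠ 0 := fun h0 => by simp [h0] at hθ
  rw [h1, fourier_const_mul, fourier_exp_neg_abs hθ]
  field_simp

/-- The single layer operator on the line maps an outgoing wave to itself up to `lineW`. -/
theorem Admissible.outgoing {E : ℝ} (h : Admissible m E ω) (t : ℝ) :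
    Complex.exp (Complex.I * E * |t|) -
      2 * m * ∫ u : ℝ, lineGreen ω u * Complex.exp (Complex.I * E * |t - u|) =
      -2 * Complex.I * E * lineW m ω E t := by
  have hpi : (Real.pi : ℂ) ≠ 0 := by exact_mod_cast Real.pi_ne_zero
  have hm : (m : ℂ) ≠ 0 := by exact_mod_cast h.m_pos.ne'
  have h1 : ∫ u : ℝ, lineGreen ω u * Complex.exp (Complex.I * E * |t - u|) =
      1 / (2 * (Real.pi : ℂ)) * ∫ u : ℝ, Complex.exp (Complex.I * E * |t - u|) *
        expSup (fun _ => 1) (ω * |u|) := by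
    rw [← integral_const_mul]
    refine integral_congr_ae (Eventually.of_forall fun u => ?_)
    simp only [lineGreen, besselK0_eq_expSup]; ring
  have h2 : ∀ s : ℝ, ∫ u : ℝ, Complex.exp (-(ω * (Real.cosh s : ℂ)) * |u|) *
      Complex.exp (Complex.I * E * |t - u|) =
      2 * (ω * (Real.cosh s : ℂ)) / (ω ^ 2 * (Real.cosh s : ℂ) ^ 2 + E ^ 2) *
        Complex.exp (Complex.I * E * |t|) +
      2 * Complex.I * E * (resolventWeight ω E s * Complex.exp (-(ω * |t|) * (Real.cosh s : ℂ))) := by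
    intro s
    have ha : 0 < (ω * (Real.cosh s : ℂ)).re := by
      rw [Complex.re_mul_ofReal]; exact mul_pos h.re_pos (Real.cosh_pos s)
    have h3 := integral_exp_neg_abs_sub_mul_exp_abs (E := E) ha t
    rw [← integral_sub_left_eq_self _ volume t] at h3
    simp only [sub_sub_cancel] at h3
    rw [h3, mul_pow, resolventWeight]
    have : -(ω * |t|) * (Real.cosh s : ℂ) = -(ω * (Real.cosh s : ℂ)) * |t| := by ring
    rw [this]; ring
  rw [h1, integral_mul_expSup measurable_const (p₀ := 1) (by simp) h.re_pos
    (e := fun u : ℝ => Complex.exp (Complex.I * E * |t - u|)) (by fun_prop)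
    (fun u => by rw [Complex.norm_exp]; simp)]
  simp only [one_mul, h2]
  have hi1 : IntegrableOn (fun s : ℝ => 2 * (ω * (Real.cosh s : ℂ)) /
      (ω ^ 2 * (Real.cosh s : ℂ) ^ 2 + (E : ℂ) ^ 2) * Complex.exp (Complex.I * E * |t|)) (Set.Ioi 0) :=
    (integrableOn_resolvent_cosh (lt_min h.re_sq_pos (pow_pos h.m_pos 2)) h.le_norm_den).mul_const _
  have hi2 : IntegrableOn (fun s : ℝ => resolventWeight ω E s *
      Complex.exp (-(ω * |t|) * (Real.cosh s : ℂ))) (Set.Ioi 0) := by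
    have hw : IntegrableOn (resolventWeight ω E) (Set.Ioi 0) := by
      refine ((integrableOn_cosh_rpow (a := 2) two_pos).const_mul (1 / min (ω ^ 2).re (m ^ 2))).mono'
        (measurable_resolventWeight ω E).aestronglyMeasurable (Eventually.of_forall fun s => ?_)
      have hc := Real.cosh_pos s
      have hd : 0 < min (ω ^ 2).re (m ^ 2) := lt_min h.re_sq_pos (pow_pos h.m_pos 2)
      rw [resolventWeight, norm_div, norm_one, Real.rpow_neg hc.le, Real.rpow_two, ← one_div,
        one_div_mul_one_div]
      exact one_div_le_one_div_of_le (by positivity) (h.le_norm_den s)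
    refine hw.mul_bdd (c := 1) (continuous_exp_neg_mul_cosh _).aestronglyMeasurable
      (Eventually.of_forall fun s => ?_)
    rw [norm_exp_neg_mul_cosh]
    refine Real.exp_le_one_iff.2 ?_
    rw [Complex.re_mul_ofReal, neg_nonpos]
    have := h.re_pos
    have := Real.cosh_pos s
    positivity
  -- The coefficient of the outgoing wave integrates to `π/m`; multiplied by `2m/(2π)` this is `1`,
  -- so the wave cancels and only the decaying kernel remains.
  rw [integral_add hi1 (hi2.const_mul _), integral_mul_const, integral_const_mul,
    h.integral_resolvent, lineW, expSup]
  field_simp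
  ring

end Kernels

/-! ### The common majorant and a Hilbert–Schmidt criterion. -/

section Majorant

theorem integrable_abs_rpow_mul_exp {s c : ℝ} (hs : -1 < s) (hc : 0 < c) :
    Integrable fun x : ℝ => |x| ^ s * Real.exp (-c * |x|) := by
  have h1 : IntegrableOn (fun x : ℝ => |x| ^ s * Real.exp (-c * |x|)) (Set.Ioi 0) := by
    refine (integrableOn_rpow_mul_exp_neg_mul_rpow (p := 1) hs one_pos hc).congr_fun
      (fun x hx => ?_) measurableSet_Ioi
    simp only [Real.rpow_one, abs_of_pos (Set.mem_Ioi.1 hx)]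
  have h2 : IntegrableOn (fun x : ℝ => |x| ^ s * Real.exp (-c * |x|)) (Set.Iic 0) := by
    rw [integrableOn_Iic_iff_integrableOn_Iio]
    have := IntegrableOn.comp_neg_Iio (c := (0 : ℝ)) (by simpa using h1)
    simpa using this
  rw [← integrableOn_univ, ← Set.Iic_union_Ioi (a := (0 : ℝ))]
  exact h2.union h1

/-- The integrable majorant `|x|^(-1/4) exp (-c |x|)`. -/
def gmaj (c x : ℝ) : ℝ := |x| ^ (-(1 / 4) : ℝ) * Real.exp (-c * |x|)

theorem gmaj_nonneg (c x : ℝ) : 0 ≤ gmaj c x :=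
  mul_nonneg (Real.rpow_nonneg (abs_nonneg x) _) (Real.exp_pos _).le

theorem integrable_gmaj {c : ℝ} (hc : 0 < c) : Integrable (gmaj c) :=
  integrable_abs_rpow_mul_exp (by norm_num) hc

theorem integrable_gmaj_sq {c : ℝ} (hc : 0 < c) : Integrable fun x => gmaj c x ^ 2 := by
  refine (integrable_abs_rpow_mul_exp (s := -(1 / 2)) (c := 2 * c) (by norm_num)
    (by positivity)).congr (Eventually.of_forall fun x => ?_)
  simp only [gmaj, mul_pow]
  rw [← Real.rpow_natCast, ← Real.rpow_mul (abs_nonneg x), ← Real.exp_nat_mul]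
  norm_num
  left; ring

theorem gmaj_le {a a' α : ℝ} (h : a' + α ≤ a) (x : ℝ) :
    gmaj a x ≤ gmaj a' x * Real.exp (-α * |x|) := by
  rw [gmaj, gmaj, mul_assoc, ← Real.exp_add]
  refine mul_le_mul_of_nonneg_left (Real.exp_le_exp.2 ?_) (Real.rpow_nonneg (abs_nonneg x) _)
  nlinarith [abs_nonneg x]

/-- Decay in `t` gives integrability along the diagonal direction; across it, `gmaj` is
square-integrable because its singularity has exponent `-1/4 > -1/2`. -/
theorem KBound.lintegral_sq_lt_top {k : ℝ → ℝ → ℂ} {M b c : ℝ} (hb : 0 < b) (hc : 0 < c)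
    (h : ∀ t u, t ≠ u → ‖k t u‖ ≤ Real.exp (-b * |t|) * (M * gmaj c (t - u))) :
    ∫⁻ t, ∫⁻ u, ‖k t u‖ₑ ^ 2 < ∞ := by
  have hi : Integrable fun x => (M * gmaj c x) ^ 2 := by
    simp only [mul_pow]
    exact (integrable_gmaj_sq hc).const_mul _
  have hle : ∀ t, ∫⁻ u, ‖k t u‖ₑ ^ 2 ≤
      ENNReal.ofReal (Real.exp (-(2 * b) * |t|)) * ∫⁻ x, ENNReal.ofReal ((M * gmaj c x) ^ 2) := by
    intro t
    rw [← lintegral_sub_left_eq_self (fun x => ENNReal.ofReal ((M * gmaj c x) ^ 2)) t,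
      ← lintegral_const_mul' _ _ ENNReal.ofReal_ne_top]
    refine lintegral_mono_ae ?_
    filter_upwards [compl_mem_ae_iff.2 (measure_singleton t : volume {t} = 0)] with u hu
    rw [← ENNReal.ofReal_mul (Real.exp_pos _).le, ← ofReal_norm,
      ← ENNReal.ofReal_pow (norm_nonneg _)]
    refine ENNReal.ofReal_le_ofReal ?_
    have e : Real.exp (-(2 * b) * |t|) = Real.exp (-b * |t|) ^ 2 := by
      rw [← Real.exp_nat_mul]; congr 1; push_cast; ring
    rw [e, ← mul_pow]
    exact pow_le_pow_left₀ (norm_nonneg _) (h t u (fun e => hu (by simp [e]))) 2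
  refine (lintegral_mono hle).trans_lt ?_
  have hfin : ∫⁻ x, ENNReal.ofReal ((M * gmaj c x) ^ 2) < ∞ := hi.lintegral_lt_top
  rw [lintegral_mul_const' _ _ hfin.ne]
  exact ENNReal.mul_lt_top
    (integrable_exp_neg_abs_real (a := 2 * b) (by positivity)).lintegral_lt_top hfin

end Majorant

/-! ### Conjugation with exponential weights. -/

section WeightedKernels

/-- The exponential weight `exp (α |t|)`. -/
def wexp (α t : ℝ) : ℂ := ((Real.exp (α * |t|) : ℝ) : ℂ)

theorem continuous_wexp (α : ℝ) : Continuous (wexp α) := by unfold wexp; fun_prop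

theorem norm_wexp (α t : ℝ) : ‖wexp α t‖ = Real.exp (α * |t|) := by
  rw [wexp, Complex.norm_real, Real.norm_of_nonneg (Real.exp_pos _).le]

theorem wexp_mul_neg (α t : ℝ) : wexp α t * wexp (-α) t = 1 := by
  rw [wexp, wexp, ← Complex.ofReal_mul, ← Real.exp_add]; simp

theorem wexp_neg_mul (α t : ℝ) : wexp (-α) t * wexp α t = 1 := by
  rw [mul_comm, wexp_mul_neg]

theorem wexp_ne_zero (α t : ℝ) : wexp α t ≠ 0 := by
  rw [wexp, Complex.ofReal_ne_zero]; exact (Real.exp_pos _).ne'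

/-- Conjugation of a convolution kernel with the exponential weight. -/
def convKernel (α : ℝ) (h : ℝ → ℂ) (t u : ℝ) : ℂ := wexp α t * h (t - u) * wexp (-α) u

/-- Since `|t| - |u| ≤ |t - u|`, conjugation costs at most `e^{α|t - u|}`, which the assumed decay
of `h` pays for. -/
theorem KBound.convKernel {α : ℝ} (hα : 0 ≤ α) {h : ℝ → ℂ} {g : ℝ → ℝ} (hm : Measurable h)
    (hg : Integrable g) (hb : ∀ x, x ≠ 0 → ‖h x‖ ≤ g x * Real.exp (-α * |x|)) :
    KBound (convKernel α h) g := by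
  refine ⟨?_, hg, fun t u htu => ?_⟩
  · have h1 := (continuous_wexp α).measurable
    have h2 := (continuous_wexp (-α)).measurable
    unfold SingularWaveguide.convKernel
    exact ((h1.comp measurable_fst).mul (hm.comp (measurable_fst.sub measurable_snd))).mul
      (h2.comp measurable_snd)
  · rw [SingularWaveguide.convKernel, norm_mul, norm_mul, norm_wexp, norm_wexp]
    have h1 := hb (t - u) (sub_ne_zero.2 htu)
    have hgn : 0 ≤ g (t - u) :=
      le_of_mul_le_mul_right ((zero_mul _).trans_le ((norm_nonneg _).trans h1)) (Real.exp_pos _)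
    have h2 : |t| - |u| ≤ |t - u| := abs_sub_abs_le_abs_sub t u
    calc Real.exp (α * |t|) * ‖h (t - u)‖ * Real.exp (-α * |u|)
        ≤ Real.exp (α * |t|) * (g (t - u) * Real.exp (-α * |t - u|)) * Real.exp (-α * |u|) := by
          gcongr
      _ = g (t - u) * Real.exp (α * |t| + -α * |t - u| + -α * |u|) := by
          rw [Real.exp_add, Real.exp_add]; ring
      _ ≤ g (t - u) * 1 := by
          gcongr
          refine Real.exp_le_one_iff.2 ?_
          nlinarith
      _ = g (t - u) := mul_one _

end WeightedKernels

/-! ### Bounds for the kernels on the line. -/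

section LineKernels

variable {m ω₀ : ℝ} {E ω : ℂ}

/-- The factor by which all the kernels decay when the bulk mass grows. -/
def massDecay (ω : ℂ) : ℝ := ω.re ^ (-(1 / 4) : ℝ)

theorem massDecay_nonneg {ω : ℂ} (h : 0 < ω.re) : 0 ≤ massDecay ω := Real.rpow_nonneg h.le _

theorem massDecay_le (hω₀ : 0 < ω₀) (h : ω₀ ≤ ω.re) : massDecay ω ≤ ω₀ ^ (-(1 / 4) : ℝ) :=
  Real.rpow_le_rpow_of_nonpos hω₀ h (by norm_num)

theorem rpow_mul_exp_le_gmaj (hω : 0 < ω.re) (h : ω₀ ≤ ω.re) (x : ℝ) :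
    (ω * |x|).re ^ (-(1 / 4) : ℝ) * Real.exp (-(ω * |x|).re / 2) ≤
      massDecay ω * gmaj (ω₀ / 2) x := by
  rw [Complex.re_mul_ofReal, Real.mul_rpow hω.le (abs_nonneg x), massDecay, gmaj, mul_assoc]
  refine mul_le_mul_of_nonneg_left ?_ (Real.rpow_nonneg hω.le _)
  refine mul_le_mul_of_nonneg_left (Real.exp_le_exp.2 ?_) (Real.rpow_nonneg (abs_nonneg x) _)
  nlinarith [abs_nonneg x]

theorem Admissible.norm_lineGreen_le (h : Admissible m E ω) (h₀ : ω₀ ≤ ω.re) {x : ℝ}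
    (hx : x ≠ 0) : ‖lineGreen ω x‖ ≤ coshConst * massDecay ω * gmaj (ω₀ / 2) x := by
  have hpos : 0 < (ω * |x|).re := by
    rw [Complex.re_mul_ofReal]; exact mul_pos h.re_pos (abs_pos.2 hx)
  have h1 := norm_expSup_le (p := fun _ => 1) (p₀ := 1) (by simp) hpos
  rw [lineGreen, besselK0_eq_expSup, norm_mul]
  have h2 : ‖(1 / (2 * (Real.pi : ℂ)))‖ ≤ 1 := by
    rw [norm_div, norm_one, norm_mul, Complex.norm_real, Complex.norm_ofNat,
      Real.norm_of_nonneg Real.pi_pos.le, div_le_one (by positivity)]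
    linarith [Real.pi_gt_three]
  calc _ ≤ 1 * (1 * (coshConst * (massDecay ω * gmaj (ω₀ / 2) x))) := by
        have := coshConst_nonneg
        refine mul_le_mul h2 (h1.trans ?_) (norm_nonneg _) zero_le_one
        exact mul_le_mul_of_nonneg_left (mul_le_mul_of_nonneg_left
          (rpow_mul_exp_le_gmaj h.re_pos h₀ x) this) zero_le_one
    _ = _ := by ring

theorem Admissible.norm_lineW_le (h : Admissible m E ω) (h₀ : ω₀ ≤ ω.re) {x : ℝ}
    (hx : x ≠ 0) : ‖lineW m ω E x‖ ≤ coshConst / m * massDecay ω * gmaj (ω₀ / 2) x := by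
  have hpos : 0 < (ω * |x|).re := by
    rw [Complex.re_mul_ofReal]; exact mul_pos h.re_pos (abs_pos.2 hx)
  have h1 := norm_expSup_le h.norm_resolventWeight_le hpos
  have hm := h.m_pos
  rw [lineW, norm_mul]
  have h2 : ‖(m : ℂ) / (Real.pi : ℂ)‖ ≤ m := by
    rw [norm_div, Complex.norm_real, Complex.norm_real, Real.norm_of_nonneg hm.le,
      Real.norm_of_nonneg Real.pi_pos.le]
    exact div_le_self hm.le (by linarith [Real.pi_gt_three])
  calc _ ≤ m * (1 / m ^ 2 * (coshConst * (massDecay ω * gmaj (ω₀ / 2) x))) := by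
        have := coshConst_nonneg
        refine mul_le_mul h2 (h1.trans ?_) (norm_nonneg _) hm.le
        exact mul_le_mul_of_nonneg_left (mul_le_mul_of_nonneg_left
          (rpow_mul_exp_le_gmaj h.re_pos h₀ x) this) (by positivity)
    _ = _ := by field_simp

theorem measurable_lineGreen (ω : ℂ) : Measurable (lineGreen ω) := by
  unfold lineGreen
  simp only [besselK0_eq_expSup]
  exact (measurable_expSup measurable_const (by fun_prop)).const_mul _

theorem measurable_lineW (m : ℝ) (ω E : ℂ) : Measurable (lineW m ω E) := by
  unfold lineW
  exact (measurable_expSup (measurable_resolventWeight ω E) (by fun_prop)).const_mul _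

theorem measurable_lineR (θ : ℂ) : Measurable (lineR θ) := by
  unfold lineR
  fun_prop

theorem norm_lineR (θ : ℂ) (x : ℝ) :
    ‖lineR θ x‖ = ‖1 / (2 * θ)‖ * Real.exp (-θ.re * |x|) := by
  rw [lineR, norm_mul, Complex.norm_exp]
  congr 2
  rw [Complex.re_mul_ofReal, Complex.neg_re]

theorem KBound.lineR {θ : ℂ} {α : ℝ} (hα : 0 ≤ α) (hθ : α < θ.re) :
    KBound (SingularWaveguide.convKernel α (lineR θ))
      (fun x => ‖1 / (2 * θ)‖ * Real.exp (-(θ.re - α) * |x|)) := by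
  refine KBound.convKernel hα (measurable_lineR θ)
    ((integrable_exp_neg_abs_real (sub_pos.2 hθ)).const_mul _) fun x _ => ?_
  rw [norm_lineR, mul_assoc, ← Real.exp_add]
  refine le_of_eq ?_
  congr 2; ring

end LineKernels

/-! ### Bounds for the kernels on the curve. -/

section CurveKernels

/-- The standing assumptions on the curve, the decay rates and the weight. -/
structure Config (γ : ℝ → Plane) (c C b ω₀ α : ℝ) : Prop where
  cont : Continuous γ
  c_pos : 0 < c
  c_le : c ≤ 1
  C_pos : 0 < C
  b_pos : 0 < b
  ω₀_pos : 0 < ω₀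
  lower : ∀ t u, c * |t - u| ≤ ‖γ t - γ u‖
  upper : ∀ t u, ‖γ t - γ u‖ ≤ |t - u|
  chord : ∀ t u, |t - u| - ‖γ t - γ u‖ ≤ C * |t - u| * Real.exp (-b * (|t| + |u| - |t - u|))
  b_le : b ≤ c * ω₀ / 8
  α_pos : 0 < α
  α_le : α ≤ b / 2

/-- The difference between the Green's function on the curve and on a straight line. -/
def defect (γ : ℝ → Plane) (ω : ℂ) (t u : ℝ) : ℂ := green ω (γ t) (γ u) - lineGreen ω (t - u)

/-- The defect kernel between spaces with weights `-β` and `α`. -/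
def defectKernel (γ : ℝ → Plane) (α β : ℝ) (ω : ℂ) (t u : ℝ) : ℂ :=
  wexp α t * defect γ ω t u * wexp β u

/-- The outgoing kernel, from the weight `α` to the weight `-α`. -/
def waveKernel (m α : ℝ) (E : ℂ) (t u : ℝ) : ℂ :=
  wexp (-α) t * ((m : ℂ) ^ 2 / E * Complex.exp (Complex.I * E * (|t - u| : ℝ))) * wexp (-α) u

/-- The constant in the bound of the defect kernel. -/
def defectConst (c C : ℝ) : ℝ := 8 * coshConst * (C / c) * c ^ (-(1 / 4) : ℝ)

variable {γ : ℝ → Plane} {c C b ω₀ α m : ℝ} {E ω : ℂ}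

theorem Config.defectConst_nonneg (K : Config γ c C b ω₀ α) : 0 ≤ defectConst c C := by
  have := coshConst_nonneg
  have := K.C_pos
  have := K.c_pos
  unfold defectConst
  positivity

/-- The Lipschitz bound for `K₀` with `ρ = c|t - u|`, a lower bound for chord and arc alike, sees
only their relative difference, which `chord` makes exponentially small. -/
theorem Config.norm_defect_le (K : Config γ c C b ω₀ α) (h : Admissible m E ω) (h₀ : ω₀ ≤ ω.re)
    {t u : ℝ} (htu : t ≠ u) :
    ‖defect γ ω t u‖ ≤ defectConst c C * massDecay ω * (|t - u| ^ (-(1 / 4) : ℝ) *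
      Real.exp (-(c * ω₀ / 2) * |t - u| - b * (|t| + |u| - |t - u|))) := by
  have hd : 0 < |t - u| := abs_pos.2 (sub_ne_zero.2 htu)
  have hc := K.c_pos
  have hρ : 0 < c * |t - u| := mul_pos hc hd
  have h1 := norm_besselK0_sub_le h.re_pos (norm_le_two_mul_re h.re_pos h.re_sq_pos) hρ
    (K.lower t u) (mul_le_of_le_one_left hd.le K.c_le)
  have h2 : defect γ ω t u = 1 / (2 * (Real.pi : ℂ)) *
      (besselK0 (ω * (‖γ t - γ u‖ : ℝ)) - besselK0 (ω * (|t - u| : ℝ))) := by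
    rw [defect, green, lineGreen]; ring
  have h3 : ‖(1 / (2 * (Real.pi : ℂ)))‖ ≤ 1 := by
    rw [norm_div, norm_one, norm_mul, Complex.norm_real, Complex.norm_ofNat,
      Real.norm_of_nonneg Real.pi_pos.le, div_le_one (by positivity)]
    linarith [Real.pi_gt_three]
  have h4 : abs (‖γ t - γ u‖ - |t - u|) / (c * |t - u|) ≤
      C / c * Real.exp (-b * (|t| + |u| - |t - u|)) := by
    rw [abs_sub_comm, abs_of_nonneg (sub_nonneg.2 (K.upper t u)), div_le_iff₀ hρ]
    refine (K.chord t u).trans_eq ?_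
    field_simp
  have h5 : (ω.re * (c * |t - u|)) ^ (-(1 / 4) : ℝ) * Real.exp (-(ω.re * (c * |t - u|)) / 2) ≤
      massDecay ω * (c ^ (-(1 / 4) : ℝ) * (|t - u| ^ (-(1 / 4) : ℝ) * Real.exp (-(c * ω₀ / 2) * |t - u|))) := by
    rw [Real.mul_rpow h.re_pos.le hρ.le, Real.mul_rpow hc.le hd.le, massDecay, mul_assoc, mul_assoc]
    have hp := Real.rpow_nonneg h.re_pos.le (-(1 / 4) : ℝ)
    have hp1 := Real.rpow_nonneg hc.le (-(1 / 4) : ℝ)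
    have hp2 := Real.rpow_nonneg hd.le (-(1 / 4) : ℝ)
    gcongr ?_ * (?_ * (?_ * ?_))
    refine Real.exp_le_exp.2 ?_
    nlinarith [mul_le_mul_of_nonneg_right h₀ hρ.le]
  have hκ := coshConst_nonneg
  have hmd := massDecay_nonneg h.re_pos
  rw [h2, norm_mul]
  calc _ ≤ 1 * (8 * coshConst * (C / c * Real.exp (-b * (|t| + |u| - |t - u|))) *
        (massDecay ω * (c ^ (-(1 / 4) : ℝ) * (|t - u| ^ (-(1 / 4) : ℝ) *
          Real.exp (-(c * ω₀ / 2) * |t - u|))))) := by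
        refine mul_le_mul h3 (h1.trans ?_) (norm_nonneg _) zero_le_one
        have hX : 0 ≤ (ω.re * (c * |t - u|)) ^ (-(1 / 4) : ℝ) *
            Real.exp (-(ω.re * (c * |t - u|)) / 2) := by
          have := h.re_pos
          positivity
        have hκ8 : 0 ≤ 8 * coshConst := by positivity
        exact mul_le_mul (mul_le_mul_of_nonneg_left h4 hκ8) h5 hX
          (mul_nonneg hκ8 (mul_nonneg (div_nonneg K.C_pos.le hc.le) (Real.exp_pos _).le))
    _ = _ := by
        rw [show -(c * ω₀ / 2) * |t - u| - b * (|t| + |u| - |t - u|) =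
          -(c * ω₀ / 2) * |t - u| + -b * (|t| + |u| - |t - u|) by ring, Real.exp_add, defectConst]
        ring

/-- As `α, β ≤ b/2`, half of the decay `b(|t| + |u|)` pays for the weights. The loss `b|t - u|` is
absorbed by the decay of `K₀` because `b ≤ cω₀/8`. The surviving `e^{-b|t|/2}` is what makes the
kernel Hilbert–Schmidt. -/
theorem Config.norm_defectKernel_le (K : Config γ c C b ω₀ α) (h : Admissible m E ω)
    (h₀ : ω₀ ≤ ω.re) {β : ℝ} (hβ : β ≤ α) {t u : ℝ} (htu : t ≠ u) :
    ‖defectKernel γ α β ω t u‖ ≤ Real.exp (-(b / 2) * |t|) *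
      (defectConst c C * massDecay ω * gmaj (c * ω₀ / 4) (t - u)) := by
  rw [defectKernel, norm_mul, norm_mul, norm_wexp, norm_wexp]
  have h1 := K.norm_defect_le h h₀ htu
  have hM : 0 ≤ defectConst c C * massDecay ω :=
    mul_nonneg K.defectConst_nonneg (massDecay_nonneg h.re_pos)
  have hr : 0 ≤ |t - u| ^ (-(1 / 4) : ℝ) := Real.rpow_nonneg (abs_nonneg _) _
  calc Real.exp (α * |t|) * ‖defect γ ω t u‖ * Real.exp (β * |u|)
      ≤ Real.exp (α * |t|) * (defectConst c C * massDecay ω * (|t - u| ^ (-(1 / 4) : ℝ) *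
      Real.exp (-(c * ω₀ / 2) * |t - u| - b * (|t| + |u| - |t - u|)))) * Real.exp (β * |u|) := by
        gcongr
    _ = defectConst c C * massDecay ω * |t - u| ^ (-(1 / 4) : ℝ) *
        Real.exp (α * |t| + (-(c * ω₀ / 2) * |t - u| - b * (|t| + |u| - |t - u|)) + β * |u|) := by
        rw [Real.exp_add, Real.exp_add]; ring
    _ ≤ defectConst c C * massDecay ω * |t - u| ^ (-(1 / 4) : ℝ) *
        Real.exp (-(b / 2) * |t| + -(c * ω₀ / 4) * |t - u|) := by
        refine mul_le_mul_of_nonneg_left (Real.exp_le_exp.2 ?_) (mul_nonneg hM hr)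
        have h2 := K.b_le
        have h3 := K.α_le
        have h4 := K.b_pos
        have ht := abs_nonneg t
        have hu := abs_nonneg u
        have hd := abs_nonneg (t - u)
        nlinarith [mul_le_mul_of_nonneg_right h3 ht, mul_le_mul_of_nonneg_right (hβ.trans h3) hu,
          mul_le_mul_of_nonneg_right h2 hd]
    _ = _ := by rw [Real.exp_add, gmaj]; ring

theorem Config.measurable_defectKernel (K : Config γ c C b ω₀ α) (α' β : ℝ) (ω : ℂ) :
    Measurable (Function.uncurry (defectKernel γ α' β ω)) := by
  have h1 := (continuous_wexp α').measurable
  have h2 := (continuous_wexp β).measurable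
  have hγ := K.cont.measurable
  have h3 := measurable_lineGreen ω
  have h4 : Measurable fun p : ℝ × ℝ => green ω (γ p.1) (γ p.2) := by
    unfold green
    simp only [besselK0_eq_expSup]
    exact (measurable_expSup measurable_const (by fun_prop)).const_mul _
  unfold defectKernel defect
  exact ((h1.comp measurable_fst).mul (h4.sub (h3.comp (measurable_fst.sub measurable_snd)))).mul
    (h2.comp measurable_snd)

theorem Config.rate_pos (K : Config γ c C b ω₀ α) : 0 < c * ω₀ / 4 := by
  have := K.c_pos
  have := K.ω₀_pos
  positivity

theorem Config.kbound_defectKernel (K : Config γ c C b ω₀ α) (h : Admissible m E ω)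
    (h₀ : ω₀ ≤ ω.re) {β : ℝ} (hβ : β ≤ α) :
    KBound (defectKernel γ α β ω)
      (fun x => defectConst c C * massDecay ω * gmaj (c * ω₀ / 4) x) := by
  refine ⟨K.measurable_defectKernel α β ω, (integrable_gmaj K.rate_pos).const_mul _,
    fun t u htu => (K.norm_defectKernel_le h h₀ hβ htu).trans ?_⟩
  refine mul_le_of_le_one_left ?_ (Real.exp_le_one_iff.2 ?_)
  · exact mul_nonneg (mul_nonneg K.defectConst_nonneg (massDecay_nonneg h.re_pos)) (gmaj_nonneg _ _)
  · have := K.b_pos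
    have := abs_nonneg t
    nlinarith

theorem Config.α_le_rate (K : Config γ c C b ω₀ α) : c * ω₀ / 4 + α ≤ ω₀ / 2 := by
  have h1 := K.b_le
  have h2 := K.α_le
  have h3 : c * ω₀ ≤ ω₀ := mul_le_of_le_one_left K.ω₀_pos.le K.c_le
  have h4 := K.ω₀_pos
  linarith

theorem Config.kbound_lineGreen (K : Config γ c C b ω₀ α) (h : Admissible m E ω)
    (h₀ : ω₀ ≤ ω.re) :
    KBound (convKernel α (lineGreen ω)) (fun x => coshConst * massDecay ω * gmaj (c * ω₀ / 4) x) := by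
  refine KBound.convKernel K.α_pos.le (measurable_lineGreen ω)
    ((integrable_gmaj K.rate_pos).const_mul _) fun x hx => (h.norm_lineGreen_le h₀ hx).trans ?_
  rw [mul_assoc (coshConst * massDecay ω)]
  exact mul_le_mul_of_nonneg_left (gmaj_le K.α_le_rate x)
    (mul_nonneg coshConst_nonneg (massDecay_nonneg h.re_pos))

theorem Config.kbound_lineW (K : Config γ c C b ω₀ α) (h : Admissible m E ω)
    (h₀ : ω₀ ≤ ω.re) :
    KBound (convKernel α (lineW m ω E))
      (fun x => coshConst / m * massDecay ω * gmaj (c * ω₀ / 4) x) := by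
  refine KBound.convKernel K.α_pos.le (measurable_lineW m ω E)
    ((integrable_gmaj K.rate_pos).const_mul _) fun x hx => (h.norm_lineW_le h₀ hx).trans ?_
  rw [mul_assoc (coshConst / m * massDecay ω)]
  exact mul_le_mul_of_nonneg_left (gmaj_le K.α_le_rate x)
    (mul_nonneg (div_nonneg coshConst_nonneg h.m_pos.le) (massDecay_nonneg h.re_pos))

/-- The two weights give at least `e^{-α|t - u|}` of decay, and `Im E ≥ -α/2` lets the wave grow by
at most half of that rate. This fixes how far below the real axis the energies may go. -/
theorem kbound_waveKernel (hα : 0 < α) {a : ℝ} (ha : 0 < a) (hE : a ≤ ‖E‖) (hIm : -(α / 2) ≤ E.im) :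
    KBound (waveKernel m α E) (fun x => m ^ 2 / a * Real.exp (-(α / 2) * |x|)) := by
  refine ⟨?_, (integrable_exp_neg_abs_real (by positivity)).const_mul _, fun t u _ => ?_⟩
  · have h1 := (continuous_wexp (-α)).measurable
    unfold waveKernel
    exact ((h1.comp measurable_fst).mul (by fun_prop)).mul (h1.comp measurable_snd)
  · rw [waveKernel, norm_mul, norm_mul, norm_mul, norm_wexp, norm_wexp, norm_div, norm_pow,
      Complex.norm_real, Real.norm_eq_abs, sq_abs, Complex.norm_exp]
    have hre : (Complex.I * E * (|t - u| : ℝ)).re = -E.im * |t - u| := by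
      rw [Complex.re_mul_ofReal]; simp
    rw [hre]
    calc Real.exp (-α * |t|) * (m ^ 2 / ‖E‖ * Real.exp (-E.im * |t - u|)) * Real.exp (-α * |u|)
        = m ^ 2 / ‖E‖ * Real.exp (-α * |t| + -E.im * |t - u| + -α * |u|) := by
          rw [Real.exp_add, Real.exp_add]; ring
      _ ≤ m ^ 2 / a * Real.exp (-(α / 2) * |t - u|) := by
          refine mul_le_mul (div_le_div_of_nonneg_left (sq_nonneg m) ha hE)
            (Real.exp_le_exp.2 ?_) (Real.exp_pos _).le (by positivity)
          have := abs_sub t u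
          nlinarith [abs_nonneg (t - u)]

end CurveKernels

/-! ### Norm limits of finite-rank operators. -/

section FiniteRank

variable {V : Type*} [NormedAddCommGroup V] [NormedSpace ℂ V]

/-- The operator is a norm limit of operators of finite rank. -/
def ApproxFiniteRank (X : V →L[ℂ] V) : Prop :=
  ∀ ε : ℝ, 0 < ε → ∃ (n : ℕ) (A : V →L[ℂ] (Fin n → ℂ)) (L : (Fin n → ℂ) →L[ℂ] V),
    ‖X - L.comp A‖ ≤ ε

theorem ApproxFiniteRank.add {X Y : V →L[ℂ] V} (hX : ApproxFiniteRank X)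
    (hY : ApproxFiniteRank Y) : ApproxFiniteRank (X + Y) := by
  intro ε hε
  obtain ⟨n, A, L, h1⟩ := hX (ε / 2) (half_pos hε)
  obtain ⟨k, B, M, h2⟩ := hY (ε / 2) (half_pos hε)
  let e : ((Fin n → ℂ) × (Fin k → ℂ)) ≃L[ℂ] (Fin (n + k) → ℂ) :=
    ContinuousLinearEquiv.ofFinrankEq (by simp)
  refine ⟨n + k, e.toContinuousLinearMap.comp (A.prod B), (L.coprod M).comp e.symm.toContinuousLinearMap, ?_⟩
  have h3 : X + Y - ((L.coprod M).comp e.symm.toContinuousLinearMap).comp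
      (e.toContinuousLinearMap.comp (A.prod B)) =
      (X - L.comp A) + (Y - M.comp B) := by
    ext v
    simp only [ContinuousLinearMap.coe_comp, Function.comp_apply, sub_apply,
      add_apply, ContinuousLinearEquiv.coe_coe,
      ContinuousLinearEquiv.symm_apply_apply, ContinuousLinearMap.prod_apply,
      ContinuousLinearMap.coprod_apply]
    abel
  rw [h3]
  exact (norm_add_le _ _).trans (by linarith)

theorem ApproxFiniteRank.smul {X : V →L[ℂ] V} (hX : ApproxFiniteRank X) (a : ℂ) :
    ApproxFiniteRank (a • X) := by
  intro ε hε
  obtain ⟨n, A, L, h1⟩ := hX (ε / (‖a‖ + 1)) (by positivity)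
  refine ⟨n, A, a • L, ?_⟩
  rw [ContinuousLinearMap.smul_comp, ← smul_sub, norm_smul]
  calc ‖a‖ * ‖X - L.comp A‖ ≤ (‖a‖ + 1) * (ε / (‖a‖ + 1)) := by gcongr; linarith
    _ = ε := by field_simp

theorem ApproxFiniteRank.mul_right {X : V →L[ℂ] V} (hX : ApproxFiniteRank X) (Y : V →L[ℂ] V) :
    ApproxFiniteRank (X * Y) := by
  intro ε hε
  obtain ⟨n, A, L, h1⟩ := hX (ε / (‖Y‖ + 1)) (by positivity)
  refine ⟨n, A.comp Y, L, ?_⟩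
  have h2 : X * Y - L.comp (A.comp Y) = (X - L.comp A) * Y := by
    rw [sub_mul]; rfl
  rw [h2]
  calc ‖(X - L.comp A) * Y‖ ≤ ‖X - L.comp A‖ * ‖Y‖ := norm_mul_le _ _
    _ ≤ (ε / (‖Y‖ + 1)) * (‖Y‖ + 1) := by gcongr; linarith
    _ = ε := by field_simp

theorem ApproxFiniteRank.exists_isUnit_sub [CompleteSpace V] {X T : V →L[ℂ] V}
    (hX : ApproxFiniteRank X) (hT : IsUnit (T - X)) :
    ∃ (n : ℕ) (A : V →L[ℂ] (Fin n → ℂ)) (L : (Fin n → ℂ) →L[ℂ] V), IsUnit (T - L.comp A) := by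
  obtain ⟨r, hr, hball⟩ := Metric.isOpen_iff.1 (Units.isOpen (R := V →L[ℂ] V)) (T - X) hT
  obtain ⟨n, A, L, h1⟩ := hX (r / 2) (half_pos hr)
  refine ⟨n, A, L, hball ?_⟩
  rw [Metric.mem_ball, dist_eq_norm, sub_sub_sub_cancel_left]
  linarith

end FiniteRank

/-! ### Inversion of the straight-line operator. -/

section LineInverse

variable {m ω₀ α : ℝ} {E ω θ : ℂ}

/-- The inner weights cancel, so composition of conjugated kernels is conjugation of the
convolution. -/
theorem kop_convKernel_mul {f₁ f₂ f₃ : ℝ → ℂ} {g₁ g₂ g₃ : ℝ → ℝ}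
    (h₁ : KBound (convKernel α f₁) g₁) (h₂ : KBound (convKernel α f₂) g₂)
    (h₃ : KBound (convKernel α f₃) g₃) (h : ∀ᵐ x, ∫ u, f₁ (x - u) * f₂ u = f₃ x) :
    kop (convKernel α f₁) * kop (convKernel α f₂) = kop (convKernel α f₃) := by
  refine h₁.kop_comp h₂ h₃ fun t => ?_
  have h4 : ∀ᵐ v, ∫ u, f₁ (t - v - u) * f₂ u = f₃ (t - v) :=
    (Measure.measurePreserving_sub_left volume t).quasiMeasurePreserving.ae h
  filter_upwards [h4] with v hv
  have h5 : ∀ u, convKernel α f₁ t u * convKernel α f₂ u v =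
      wexp α t * wexp (-α) v * (f₁ (t - u) * f₂ (u - v)) := fun u => by
    rw [convKernel, convKernel]
    linear_combination (wexp α t * f₁ (t - u) * f₂ (u - v) * wexp (-α) v) * wexp_neg_mul α u
  simp only [h5]
  rw [integral_const_mul, ← integral_add_right_eq_self _ v]
  simp only [add_sub_cancel_right, sub_add_eq_sub_sub, sub_right_comm t _ v]
  rw [hv, convKernel]; ring

theorem KBound.convKernel_const_mul {f : ℝ → ℂ} {g : ℝ → ℝ}
    (h : KBound (SingularWaveguide.convKernel α f) g) (a : ℂ) :
    KBound (SingularWaveguide.convKernel α fun x => a * f x) (fun x => ‖a‖ * g x) := by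
  have := h.const_mul a
  convert this using 3
  rw [SingularWaveguide.convKernel, SingularWaveguide.convKernel]; ring

theorem KBound.convKernel_sub {f₁ f₂ : ℝ → ℂ} {g₁ g₂ : ℝ → ℝ}
    (h₁ : KBound (SingularWaveguide.convKernel α f₁) g₁)
    (h₂ : KBound (SingularWaveguide.convKernel α f₂) g₂) :
    ∃ g, KBound (SingularWaveguide.convKernel α fun x => f₁ x - f₂ x) g := by
  have h3 := h₁.add (h₂.const_mul (-1))
  have e : (fun t u => SingularWaveguide.convKernel α f₁ t u +
      -1 * SingularWaveguide.convKernel α f₂ t u) =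
      SingularWaveguide.convKernel α fun x => f₁ x - f₂ x := by
    ext t u
    simp only [SingularWaveguide.convKernel]; ring
  exact ⟨_, e ▸ h3⟩

theorem KBound.kop_convKernel_sub_mul {f₁ f₂ : ℝ → ℂ} {g₁ g₂ : ℝ → ℝ}
    (h₁ : KBound (SingularWaveguide.convKernel α f₁) g₁)
    (h₂ : KBound (SingularWaveguide.convKernel α f₂) g₂) (a : ℂ) :
    kop (SingularWaveguide.convKernel α fun x => a * (f₁ x - f₂ x)) =
      a • (kop (SingularWaveguide.convKernel α f₁) - kop (SingularWaveguide.convKernel α f₂)) := by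
  obtain ⟨g, hg⟩ := h₁.convKernel_sub h₂
  rw [← h₁.kop_sub h₂]
  have e : (fun t u => SingularWaveguide.convKernel α f₁ t u - SingularWaveguide.convKernel α f₂ t u) =
      SingularWaveguide.convKernel α fun x => f₁ x - f₂ x := by
    ext t u
    simp only [SingularWaveguide.convKernel]; ring
  rw [e, ← hg.kop_const_mul]
  congr 1
  ext t u
  simp only [SingularWaveguide.convKernel]; ring

theorem Admissible.integrable_lineGreen (h : Admissible m E ω) : Integrable (lineGreen ω) := by
  have h1 := (integrable_expSup_abs (p := fun _ => 1) measurable_const (p₀ := 1) (by simp)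
    h.re_pos).const_mul (1 / (2 * (Real.pi : ℂ)))
  refine h1.congr (Eventually.of_forall fun t => ?_)
  simp only [lineGreen, besselK0_eq_expSup]

theorem Admissible.integrable_lineW (h : Admissible m E ω) : Integrable (lineW m ω E) :=
  (integrable_expSup_abs (measurable_resolventWeight ω E) h.norm_resolventWeight_le
    h.re_pos).const_mul _

theorem integrable_lineR (hθ : 0 < θ.re) : Integrable (lineR θ) :=
  (integrable_exp_neg_abs hθ).const_mul _

theorem fourier_const_mul_sub {f₁ f₂ : ℝ → ℂ} (h₁ : Integrable f₁) (h₂ : Integrable f₂) (a : ℂ)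
    (ξ : ℝ) : 𝓕 (fun x => a * (f₁ x - f₂ x)) ξ = a * (𝓕 f₁ ξ - 𝓕 f₂ ξ) := by
  rw [fourier_const_mul]
  congr 1
  rw [Real.fourier_real_eq, Real.fourier_real_eq, Real.fourier_real_eq, ← integral_sub]
  · simp only [smul_sub]
  · simpa [mul_comm] using (Real.fourierIntegral_convergent_iff (f := f₁) ξ).2 h₁
  · simpa [mul_comm] using (Real.fourierIntegral_convergent_iff (f := f₂) ξ).2 h₂

theorem ae_sq_ne (E : ℂ) : ∀ᵐ ξ : ℝ, ((2 * Real.pi * ξ : ℝ) : ℂ) ^ 2 ≠ E ^ 2 := by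
  have hfin : ({E.re / (2 * Real.pi), -E.re / (2 * Real.pi)} : Set ℝ).Finite := by simp
  filter_upwards [compl_mem_ae_iff.2 (hfin.measure_zero volume)] with ξ hξ h
  refine hξ ?_
  have hpi := Real.pi_ne_zero
  rcases sq_eq_sq_iff_eq_or_eq_neg.1 h with h1 | h1
  · left
    rw [← h1, Complex.ofReal_re]; field_simp
  · right
    rw [Set.mem_singleton_iff]
    have : E = -((2 * Real.pi * ξ : ℝ) : ℂ) := by rw [h1, neg_neg]
    rw [this, Complex.neg_re, Complex.ofReal_re]; field_simp

theorem Admissible.ne_zero_of_symbolRoot (h : Admissible m E ω) (x : ℝ) : symbolRoot ω x + m ≠ 0 :=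
  fun h0 => by
    have h1 : (symbolRoot ω x + m).re = 0 := by rw [h0]; simp
    rw [Complex.add_re, Complex.ofReal_re] at h1
    linarith [h.m_pos, h.symbolRoot_re x]

theorem Admissible.fourier_lineR_self (h : Admissible m E ω) (ξ : ℝ) :
    𝓕 (lineR ω) ξ = 1 / symbolRoot ω (2 * Real.pi * ξ) ^ 2 := by
  rw [fourier_lineR h.re_pos, h.symbolRoot_sq]

theorem Admissible.conv_lineGreen_lineGreen (h : Admissible m E ω) :
    ∀ᵐ x, ∫ u, lineGreen ω (x - u) * lineGreen ω u = 1 / 4 * lineR ω x := by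
  refine convolution_ae_eq_of_fourier h.integrable_lineGreen h.integrable_lineGreen
    ((integrable_lineR h.re_pos).const_mul _) (Eventually.of_forall fun ξ => ?_)
  rw [fourier_const_mul, h.fourier_lineGreen, h.fourier_lineR_self]
  have := h.symbolRoot_ne_zero (2 * Real.pi * ξ)
  field_simp
  norm_num

theorem Admissible.fourier_lineW_mul_lineGreen (h : Admissible m E ω) :
    ∀ᵐ ξ, 𝓕 (lineW m ω E) ξ * 𝓕 (lineGreen ω) ξ =
      𝓕 (fun x => 1 / (2 * (m : ℂ)) * (lineR ω x - lineW m ω E x)) ξ := by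
  filter_upwards [ae_sq_ne E] with ξ hξ
  rw [fourier_const_mul_sub (integrable_lineR h.re_pos) h.integrable_lineW, h.fourier_lineGreen,
    h.fourier_lineR_self, h.fourier_lineW ξ hξ]
  have h1 := h.symbolRoot_ne_zero (2 * Real.pi * ξ)
  have h2 := h.ne_zero_of_symbolRoot (2 * Real.pi * ξ)
  have hm : (m : ℂ) ≠ 0 := by exact_mod_cast h.m_pos.ne'
  field_simp
  ring

theorem Admissible.fourier_lineR_mul_lineR (h : Admissible m E ω) (hθ : 0 < θ.re)
    (hωθ : ω ^ 2 - θ ^ 2 ≠ 0) (hre : ∀ x : ℝ, θ ^ 2 + (x : ℂ) ^ 2 ≠ 0) (ξ : ℝ) :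
    𝓕 (lineR ω) ξ * 𝓕 (lineR θ) ξ =
      𝓕 (fun x => 1 / (ω ^ 2 - θ ^ 2) * (lineR θ x - lineR ω x) : ℝ → ℂ) ξ := by
  rw [fourier_const_mul_sub (integrable_lineR hθ) (integrable_lineR h.re_pos),
    fourier_lineR h.re_pos, fourier_lineR hθ]
  have h1 := h.symbolRoot_ne_zero (2 * Real.pi * ξ)
  have h2 : ω ^ 2 + ((2 * Real.pi * ξ : ℝ) : ℂ) ^ 2 ≠ 0 := by
    rw [← h.symbolRoot_sq]; exact pow_ne_zero 2 h1
  have h3 := hre (2 * Real.pi * ξ)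
  rw [div_sub_div _ _ h3 h2, div_mul_div_comm, div_mul_div_comm, div_eq_div_iff
    (mul_ne_zero h2 h3) (mul_ne_zero hωθ (mul_ne_zero h3 h2))]
  ring

/-- In symbols `G = 1/(2v)`, `W = 1/(v(v + m))`, `R = 1/v²`, `S = 1/(v² - c)`. The operator is `(v²
- c)/(v(v + m))`; multiplied by `1 + 2mG = (v + m)/v` it gives `1 - cR`, whose inverse is `1 + cS`.
-/
theorem isUnit_of_resolvent_identities {A : Type*} [Ring A] [Algebra ℂ A] {m c : ℂ} (hm : m ≠ 0)
    (hc : c = m ^ 2 + 2 * Complex.I * m ^ 2) (hc0 : c ≠ 0) {G W R S : A}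
    (hGG : G * G = (1 / 4 : ℂ) • R) (hWG : W * G = (1 / (2 * m)) • (R - W))
    (hGW : G * W = (1 / (2 * m)) • (R - W)) (hRS : R * S = (1 / c) • (S - R))
    (hSR : S * R = (1 / c) • (S - R)) :
    IsUnit (1 - (2 * m) • G - (2 * Complex.I * m ^ 2) • W) := by
  have h1 : (1 - (2 * m) • G - (2 * Complex.I * m ^ 2) • W) * (1 + (2 * m) • G) = 1 - c • R := by
    simp only [sub_mul, mul_add, smul_mul_assoc, mul_smul_comm, one_mul, mul_one, hGG, hWG]
    rw [hc]
    match_scalars <;> field_simp <;> ring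
  have h2 : (1 + (2 * m) • G) * (1 - (2 * m) • G - (2 * Complex.I * m ^ 2) • W) = 1 - c • R := by
    simp only [mul_sub, add_mul, smul_mul_assoc, mul_smul_comm, one_mul, mul_one, hGG, hGW]
    rw [hc]
    match_scalars <;> field_simp <;> ring
  have h3 : (1 - c • R) * (1 + c • S) = 1 := by
    simp only [sub_mul, mul_add, smul_mul_assoc, mul_smul_comm, one_mul, mul_one, hRS]
    match_scalars <;> field_simp <;> ring
  have h4 : (1 + c • S) * (1 - c • R) = 1 := by
    simp only [mul_sub, add_mul, smul_mul_assoc, mul_smul_comm, one_mul, mul_one, hSR]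
    match_scalars <;> field_simp <;> ring
  refine isUnit_iff_exists_and_exists.2 ⟨⟨(1 + (2 * m) • G) * (1 + c • S), ?_⟩,
    ⟨(1 + c • S) * (1 + (2 * m) • G), ?_⟩⟩
  · rw [← mul_assoc, h1, h3]
  · rw [mul_assoc, h2, h4]

variable {γ : ℝ → Plane} {c C b : ℝ}

/-- The boundary integral operator for the straight line, conjugated with the weight. -/
def lineOp (m α : ℝ) (E ω : ℂ) : L2 →L[ℂ] L2 :=
  1 - (2 * (m : ℂ)) • kop (convKernel α (lineGreen ω)) -
    (2 * Complex.I * (m : ℂ) ^ 2) • kop (convKernel α (lineW m ω E))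

theorem Config.isUnit_lineOp (K : Config γ c C b ω₀ α) (h : Admissible m E ω) (h₀ : ω₀ ≤ ω.re)
    (hθ : α < θ.re) (hθE : θ ^ 2 = -(E ^ 2 + 2 * Complex.I * (m : ℂ) ^ 2))  :
    IsUnit (lineOp m α E ω) := by
  have hm : (m : ℂ) ≠ 0 := by exact_mod_cast h.m_pos.ne'
  have hα := K.α_pos
  have hθ0 : 0 < θ.re := hα.trans hθ
  have hωα : α < ω.re := by
    have h1 := K.α_le_rate
    have h2 := K.rate_pos
    have h3 := K.ω₀_pos
    linarith
  have hG := K.kbound_lineGreen h h₀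
  have hW := K.kbound_lineW h h₀
  have hR := KBound.lineR hα.le hωα
  have hS := KBound.lineR hα.le hθ
  have hc : ω ^ 2 - θ ^ 2 = (m : ℂ) ^ 2 + 2 * Complex.I * (m : ℂ) ^ 2 := by
    rw [hθE, h.sq_eq]; ring
  have hc0 : ω ^ 2 - θ ^ 2 ≠ 0 := by
    rw [hc]
    intro h0
    have h1 : (m : ℂ) ^ 2 * (1 + 2 * Complex.I) = 0 := by rw [← h0]; ring
    rcases mul_eq_zero.1 h1 with h2 | h2
    · exact pow_ne_zero 2 hm h2
    · simpa using congrArg Complex.re h2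
  have hre : ∀ x : ℝ, θ ^ 2 + (x : ℂ) ^ 2 ≠ 0 := by
    intro x h0
    have h1 : (θ + Complex.I * x) * (θ - Complex.I * x) = 0 := by
      rw [← h0]; linear_combination (-(x : ℂ) ^ 2) * Complex.I_sq
    rcases mul_eq_zero.1 h1 with h2 | h2
    · have := congrArg Complex.re h2
      simp at this; linarith
    · have := congrArg Complex.re h2
      simp at this; linarith
  have iG := h.integrable_lineGreen
  have iW := h.integrable_lineW
  have iR := integrable_lineR h.re_pos
  have iS := integrable_lineR hθ0
  obtain ⟨gRW, hRW⟩ := hR.convKernel_sub hW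
  obtain ⟨gSR, hSR⟩ := hS.convKernel_sub hR
  refine isUnit_of_resolvent_identities hm hc hc0 (R := kop (convKernel α (lineR ω)))
    (S := kop (convKernel α (lineR θ))) ?_ ?_ ?_ ?_ ?_
  · rw [kop_convKernel_mul hG hG (hR.convKernel_const_mul (1 / 4)) h.conv_lineGreen_lineGreen,
      ← hR.kop_const_mul]
    congr 1
    ext t u
    simp only [convKernel]; ring
  · rw [kop_convKernel_mul hW hG (hRW.convKernel_const_mul (1 / (2 * (m : ℂ))))
      (convolution_ae_eq_of_fourier iW iG ((iR.sub iW).const_mul _) h.fourier_lineW_mul_lineGreen)]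
    exact hR.kop_convKernel_sub_mul hW _
  · rw [kop_convKernel_mul hG hW (hRW.convKernel_const_mul (1 / (2 * (m : ℂ))))
      (convolution_ae_eq_of_fourier iG iW ((iR.sub iW).const_mul _) (by
        filter_upwards [h.fourier_lineW_mul_lineGreen] with ξ hξ
        rw [mul_comm]; exact hξ))]
    exact hR.kop_convKernel_sub_mul hW _
  · rw [kop_convKernel_mul hR hS (hSR.convKernel_const_mul (1 / (ω ^ 2 - θ ^ 2)))
      (convolution_ae_eq_of_fourier iR iS ((iS.sub iR).const_mul _)
        (Eventually.of_forall (h.fourier_lineR_mul_lineR hθ0 hc0 hre)))]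
    exact hS.kop_convKernel_sub_mul hR _
  · rw [kop_convKernel_mul hS hR (hSR.convKernel_const_mul (1 / (ω ^ 2 - θ ^ 2)))
      (convolution_ae_eq_of_fourier iS iR ((iS.sub iR).const_mul _)
        (Eventually.of_forall fun ξ => by
          rw [mul_comm]; exact h.fourier_lineR_mul_lineR hθ0 hc0 hre ξ))]
    exact hS.kop_convKernel_sub_mul hR _

end LineInverse

/-! ### The rates `ω` and `θ` on the energy strip. -/

section Window

/-- The decay rate in the bulk, as a function of the energy. -/
def bulkRate (m : ℝ) (E : ℂ) : ℂ := csqrt ((m : ℂ) ^ 2 - E ^ 2)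

/-- The decay rate in the parametrix on the line, as a function of the energy. -/
def lineRate (m : ℝ) (E : ℂ) : ℂ := csqrt (-(E ^ 2 + 2 * Complex.I * (m : ℂ) ^ 2))

variable {m x₁ α : ℝ} {E : ℂ}

theorem re_bulk (m : ℝ) (E : ℂ) : ((m : ℂ) ^ 2 - E ^ 2).re = m ^ 2 - E.re ^ 2 + E.im ^ 2 := by
  simp [sq]; ring

theorem le_re_bulk (hE : |E.re| ≤ x₁) :
    m ^ 2 - x₁ ^ 2 + E.im ^ 2 ≤ ((m : ℂ) ^ 2 - E ^ 2).re := by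
  have h1 : E.re ^ 2 ≤ x₁ ^ 2 := sq_le_sq' (by linarith [neg_abs_le E.re]) ((le_abs_self _).trans hE)
  rw [re_bulk]; linarith

theorem re_bulk_pos (hx : x₁ < m) (hE : |E.re| ≤ x₁) : 0 < ((m : ℂ) ^ 2 - E ^ 2).re := by
  have h1 := le_re_bulk (m := m) hE
  have h2 : 0 ≤ x₁ := (abs_nonneg _).trans hE
  nlinarith [sq_nonneg E.im]

theorem bulkRate_sq (hx : x₁ < m) (hE : |E.re| ≤ x₁) : bulkRate m E ^ 2 = (m : ℂ) ^ 2 - E ^ 2 :=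
  csqrt_sq fun h0 => by have := re_bulk_pos hx hE; simp [h0] at this

theorem admissible_bulkRate (hx : x₁ < m) (hE : |E.re| ≤ x₁) : Admissible m E (bulkRate m E) where
  m_pos := ((abs_nonneg _).trans hE).trans_lt hx
  sq_eq := bulkRate_sq hx hE
  re_pos := csqrt_re_pos (Or.inl (re_bulk_pos hx hE))
  re_sq_pos := by rw [bulkRate_sq hx hE]; exact re_bulk_pos hx hE

theorem sq_re_bulkRate (hx : x₁ < m) (hE : |E.re| ≤ x₁) :
    m ^ 2 - x₁ ^ 2 + E.im ^ 2 ≤ (bulkRate m E).re ^ 2 := by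
  have h1 := le_re_bulk (m := m) hE
  rw [← bulkRate_sq hx hE, sq (bulkRate m E), Complex.mul_re] at h1
  nlinarith [sq_nonneg (bulkRate m E).im]

theorem le_re_bulkRate (hx : x₁ < m) (hE : |E.re| ≤ x₁) :
    √(m ^ 2 - x₁ ^ 2) ≤ (bulkRate m E).re := by
  refine Real.sqrt_le_iff.2 ⟨(admissible_bulkRate hx hE).re_pos.le, ?_⟩
  have := sq_re_bulkRate hx hE
  linarith [sq_nonneg E.im]

/-- From `(Re ω)² ≥ Re ω² = m² - (Re E)² + (Im E)²`; so the bulk mass grows without bound up the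
strip. -/
theorem im_le_re_bulkRate (hx : x₁ < m) (hE : |E.re| ≤ x₁) : E.im ≤ (bulkRate m E).re := by
  refine le_of_sq_le_sq ?_ (admissible_bulkRate hx hE).re_pos.le
  have h1 := sq_re_bulkRate hx hE
  have h2 : 0 ≤ x₁ := (abs_nonneg _).trans hE
  nlinarith

theorem differentiableAt_bulkRate (hx : x₁ < m) (hE : |E.re| ≤ x₁) :
    DifferentiableAt ℂ (bulkRate m) E :=
  (differentiableAt_csqrt (Or.inl (re_bulk_pos hx hE))).comp E (by fun_prop)

theorem re_line (m : ℝ) (E : ℂ) :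
    (-(E ^ 2 + 2 * Complex.I * (m : ℂ) ^ 2)).re = E.im ^ 2 - E.re ^ 2 := by
  simp [sq]

theorem im_line (m : ℝ) (E : ℂ) :
    (-(E ^ 2 + 2 * Complex.I * (m : ℂ) ^ 2)).im = -2 * (E.re * E.im + m ^ 2) := by
  simp [sq]; ring

/-- Used to keep `θ²` off the negative axis: the first case makes its real part positive, the second
makes its imaginary part negative. -/
theorem line_dichotomy (hE : |E.re| ≤ x₁) (hα : α < (m - x₁) / 2)
    (hIm : -(α / 2) < E.im) : m ≤ E.im ∨ |E.im| ≤ m ∧ m * (m - x₁) ≤ E.re * E.im + m ^ 2 := by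
  have h2 : 0 ≤ x₁ := (abs_nonneg _).trans hE
  rcases le_or_gt m E.im with h | h
  · exact Or.inl h
  · have h3 : |E.im| ≤ m := abs_le.2 ⟨by linarith, h.le⟩
    refine Or.inr ⟨h3, ?_⟩
    have h4 : |E.re * E.im| ≤ x₁ * m := by
      rw [abs_mul]; exact mul_le_mul hE h3 (abs_nonneg _) h2
    nlinarith [neg_abs_le (E.re * E.im)]

theorem line_mem_slitPlane (hx : x₁ < m) (hE : |E.re| ≤ x₁) (hα : α < (m - x₁) / 2)
    (hIm : -(α / 2) < E.im) : -(E ^ 2 + 2 * Complex.I * (m : ℂ) ^ 2) ∈ Complex.slitPlane := by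
  have h2 : 0 ≤ x₁ := (abs_nonneg _).trans hE
  rw [Complex.mem_slitPlane_iff, re_line, im_line]
  rcases line_dichotomy hE hα hIm with h | ⟨-, h⟩
  · left
    have h1 : E.re ^ 2 ≤ x₁ ^ 2 := sq_le_sq' (by linarith [neg_abs_le E.re]) ((le_abs_self _).trans hE)
    nlinarith
  · right
    have : 0 < m * (m - x₁) := mul_pos (by linarith) (by linarith)
    linarith

theorem lineRate_sq (hx : x₁ < m) (hE : |E.re| ≤ x₁) (hα : α < (m - x₁) / 2)
    (hIm : -(α / 2) < E.im) : lineRate m E ^ 2 = -(E ^ 2 + 2 * Complex.I * (m : ℂ) ^ 2) :=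
  csqrt_sq (Complex.slitPlane_ne_zero (line_mem_slitPlane hx hE hα hIm))

/-- Let `θ = p + iq` with `p ≤ α`. If `Im E ≥ m`, then `p² ≥ m² - x₁²`, too large. Otherwise `q² ≤
p² + m²` gives `m(m - x₁) ≤ p|q| ≤ p(p + m)`, which fails for `p < (m - x₁)/2`. -/
theorem lt_re_lineRate (hx : x₁ < m) (hE : |E.re| ≤ x₁) (hα : α < (m - x₁) / 2)
    (hIm : -(α / 2) < E.im) : α < (lineRate m E).re := by
  have h2 : 0 ≤ x₁ := (abs_nonneg _).trans hE
  have hpos : 0 < (lineRate m E).re := csqrt_re_pos (line_mem_slitPlane hx hE hα hIm)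
  have hsq := lineRate_sq hx hE hα hIm
  have hre := congrArg Complex.re hsq
  have him := congrArg Complex.im hsq
  rw [re_line, sq, Complex.mul_re] at hre
  rw [im_line, sq, Complex.mul_im] at him
  set p := (lineRate m E).re
  set q := (lineRate m E).im
  have h1 : E.re ^ 2 ≤ x₁ ^ 2 := sq_le_sq' (by linarith [neg_abs_le E.re]) ((le_abs_self _).trans hE)
  by_contra! hle
  rcases line_dichotomy hE hα hIm with h | ⟨h3, h⟩
  · nlinarith [sq_nonneg q]
  · have h4 : E.re * E.im + m ^ 2 ≤ p * |q| := by
      have : E.re * E.im + m ^ 2 = p * -q := by linarith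
      rw [this]
      exact mul_le_mul_of_nonneg_left (neg_le_abs q) hpos.le
    have h5 : |q| ≤ p + m := by
      refine abs_le_of_sq_le_sq ?_ (by linarith)
      have : x₁ ^ 2 ≤ m ^ 2 := by nlinarith
      nlinarith [sq_nonneg E.im]
    have h6 : p * |q| ≤ p * (p + m) := mul_le_mul_of_nonneg_left h5 hpos.le
    nlinarith

end Window

/-! ### The conjugated boundary integral operator. -/

section Operator

variable {γ : ℝ → Plane} {c C b ω₀ α m a : ℝ} {E ω θ : ℂ}

/-- The boundary integral operator, conjugated with the weight `exp (α |t|)`. -/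
def bieOp (γ : ℝ → Plane) (m α : ℝ) (E ω : ℂ) : L2 →L[ℂ] L2 :=
  lineOp m α E ω + ((-2 * (m : ℂ)) • kop (defectKernel γ α (-α) ω) +
    (-2 * (m : ℂ)) • (kop (defectKernel γ α α ω) * kop (waveKernel m α E)))

theorem Config.approxFiniteRank_defectKernel (K : Config γ c C b ω₀ α) (h : Admissible m E ω)
    (h₀ : ω₀ ≤ ω.re) {β : ℝ} (hβ : β ≤ α) : ApproxFiniteRank (kop (defectKernel γ α β ω)) :=
  fun _ hε => (K.kbound_defectKernel h h₀ hβ).exists_finiteRank_approx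
    (KBound.lintegral_sq_lt_top (half_pos K.b_pos) K.rate_pos
      fun _ _ htu => K.norm_defectKernel_le h h₀ hβ htu) hε

theorem Config.neg_α_le (K : Config γ c C b ω₀ α) : -α ≤ α := by linarith [K.α_pos]

theorem Config.exists_isUnit_bieOp_sub (K : Config γ c C b ω₀ α) (h : Admissible m E ω)
    (h₀ : ω₀ ≤ ω.re) (hθ : α < θ.re) (hθE : θ ^ 2 = -(E ^ 2 + 2 * Complex.I * (m : ℂ) ^ 2)) :
    ∃ (n : ℕ) (A : L2 →L[ℂ] (Fin n → ℂ)) (L : (Fin n → ℂ) →L[ℂ] L2),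
      IsUnit (bieOp γ m α E ω - L.comp A) := by
  refine ApproxFiniteRank.exists_isUnit_sub
    (((K.approxFiniteRank_defectKernel h h₀ K.neg_α_le).smul (-2 * (m : ℂ))).add
      (((K.approxFiniteRank_defectKernel h h₀ le_rfl).mul_right (kop (waveKernel m α E))).smul
        (-2 * (m : ℂ)))) ?_
  rw [bieOp, add_sub_cancel_right]
  exact K.isUnit_lineOp h h₀ hθ hθE

theorem KBound.mono {k : ℝ → ℝ → ℂ} {g g' : ℝ → ℝ} (h : KBound k g) (hg : Integrable g')
    (hle : ∀ x, g x ≤ g' x) : KBound k g' :=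
  ⟨h.meas, hg, fun t u htu => (h.bound t u htu).trans (hle _)⟩

theorem norm_gmaj (c x : ℝ) : ‖gmaj c x‖ = gmaj c x := Real.norm_of_nonneg (gmaj_nonneg c x)

theorem KBound.norm_kop_le_of_gmaj {k : ℝ → ℝ → ℂ} {A d r : ℝ}
    (h : KBound k fun x => A * d * gmaj r x) (hA : 0 ≤ A) (hd : 0 ≤ d) :
    ‖kop k‖ ≤ A * (∫ x, gmaj r x) * d := by
  refine h.norm_kop_le.trans_eq ?_
  simp only [norm_mul, norm_gmaj, Real.norm_of_nonneg hA, Real.norm_of_nonneg hd]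
  rw [integral_const_mul]; ring

/-- The wave operator is merely bounded uniformly in `E`, but it occurs only behind a defect
operator; every term thus carries the factor `massDecay ω`. -/
theorem Config.exists_norm_bieOp_sub_one_le (K : Config γ c C b ω₀ α) (ha : 0 < a) :
    ∃ M : ℝ, ∀ E ω : ℂ, Admissible m E ω → ω₀ ≤ ω.re → a ≤ ‖E‖ → -(α / 2) ≤ E.im →
      ‖bieOp γ m α E ω - 1‖ ≤ M * massDecay ω := by
  set I := ∫ x, gmaj (c * ω₀ / 4) x
  set B := ∫ x : ℝ, ‖m ^ 2 / a * Real.exp (-(α / 2) * |x|)‖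
  refine ⟨‖(2 * (m : ℂ))‖ * (coshConst * I) +
    ‖2 * Complex.I * (m : ℂ) ^ 2‖ * (coshConst / m * I) +
    (‖-2 * (m : ℂ)‖ * (defectConst c C * I) + ‖-2 * (m : ℂ)‖ * (defectConst c C * I * B)),
    fun E ω h h₀ hE hIm => ?_⟩
  have hd := massDecay_nonneg h.re_pos
  have h1 := (K.kbound_lineGreen h h₀).norm_kop_le_of_gmaj coshConst_nonneg hd
  have h2 := (K.kbound_lineW h h₀).norm_kop_le_of_gmaj (div_nonneg coshConst_nonneg h.m_pos.le) hd
  have h3 := (K.kbound_defectKernel h h₀ K.neg_α_le).norm_kop_le_of_gmaj K.defectConst_nonneg hd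
  have h4 := (K.kbound_defectKernel h h₀ le_rfl).norm_kop_le_of_gmaj K.defectConst_nonneg hd
  have h5 := (kbound_waveKernel (m := m) K.α_pos ha hE hIm).norm_kop_le
  have h6 : ‖kop (defectKernel γ α α ω) * kop (waveKernel m α E)‖ ≤
      defectConst c C * I * massDecay ω * B :=
    (norm_mul_le _ _).trans (mul_le_mul h4 h5 (norm_nonneg _) ((norm_nonneg _).trans h4))
  have e : bieOp γ m α E ω - 1 = -((2 * (m : ℂ)) • kop (convKernel α (lineGreen ω))) -
      (2 * Complex.I * (m : ℂ) ^ 2) • kop (convKernel α (lineW m ω E)) +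
      ((-2 * (m : ℂ)) • kop (defectKernel γ α (-α) ω) +
        (-2 * (m : ℂ)) • (kop (defectKernel γ α α ω) * kop (waveKernel m α E))) := by
    rw [bieOp, lineOp]; abel
  rw [e]
  have h7 := mul_le_mul_of_nonneg_left h1 (norm_nonneg (2 * (m : ℂ)))
  have h8 := mul_le_mul_of_nonneg_left h2 (norm_nonneg (2 * Complex.I * (m : ℂ) ^ 2))
  have h9 := mul_le_mul_of_nonneg_left h3 (norm_nonneg (-2 * (m : ℂ)))
  have h10 := mul_le_mul_of_nonneg_left h6 (norm_nonneg (-2 * (m : ℂ)))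
  rw [← norm_smul] at h7 h8 h9 h10
  refine (norm_add_le_of_le (norm_sub_le_of_le ((norm_neg _).trans_le h7) h8)
    (norm_add_le_of_le h9 h10)).trans_eq ?_
  ring

end Operator

/-! ### Holomorphy in the energy and finiteness of the exceptional set. -/

section Analytic

variable {γ : ℝ → Plane} {c C b ω₀ α m a x₁ : ℝ} {U : Set ℂ}

theorem differentiableOn_besselK0_bulkRate (hU : IsOpen U) (hx : x₁ < m)
    (hE : ∀ z ∈ U, |z.re| ≤ x₁) {r : ℝ} (hr : 0 < r) :
    DifferentiableOn ℂ (fun z => besselK0 (bulkRate m z * r)) U := by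
  simp only [besselK0_eq_expSup]
  rcases U.eq_empty_or_nonempty with rfl | ⟨z₀, hz₀⟩
  · exact differentiableOn_empty
  have hpos : 0 < √(m ^ 2 - x₁ ^ 2) := by
    have h2 : 0 ≤ x₁ := (abs_nonneg _).trans (hE z₀ hz₀)
    exact Real.sqrt_pos.2 (by nlinarith)
  refine differentiableOn_expSup hU (p := fun _ _ => 1) (p₀ := 1) (mul_pos hpos hr)
    (fun _ _ => measurable_const) (fun _ _ _ => by simp) (fun _ => differentiableOn_const _)
    (fun z hz => ?_) fun z hz => ?_
  · exact ((differentiableAt_bulkRate hx (hE z hz)).mul_const _).differentiableWithinAt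
  · rw [Complex.re_mul_ofReal]
    exact mul_le_mul_of_nonneg_right (le_re_bulkRate hx (hE z hz)) hr.le

theorem differentiableOn_lineGreen_bulkRate (hU : IsOpen U) (hx : x₁ < m)
    (hE : ∀ z ∈ U, |z.re| ≤ x₁) {r : ℝ} (hr : r ≠ 0) :
    DifferentiableOn ℂ (fun z => lineGreen (bulkRate m z) r) U :=
  (differentiableOn_besselK0_bulkRate hU hx hE (abs_pos.2 hr)).const_mul _

theorem differentiableOn_lineW_bulkRate (hU : IsOpen U) (hx : x₁ < m)
    (hE : ∀ z ∈ U, |z.re| ≤ x₁) {r : ℝ} (hr : r ≠ 0) :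
    DifferentiableOn ℂ (fun z => lineW m (bulkRate m z) z r) U := by
  rcases U.eq_empty_or_nonempty with rfl | ⟨z₀, hz₀⟩
  · exact differentiableOn_empty
  have hpos : 0 < √(m ^ 2 - x₁ ^ 2) := by
    have h2 : 0 ≤ x₁ := (abs_nonneg _).trans (hE z₀ hz₀)
    exact Real.sqrt_pos.2 (by nlinarith)
  have hd : ∀ z ∈ U, DifferentiableWithinAt ℂ (bulkRate m) U z := fun z hz =>
    (differentiableAt_bulkRate hx (hE z hz)).differentiableWithinAt
  refine DifferentiableOn.const_mul (differentiableOn_expSup hU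
    (p := fun z => resolventWeight (bulkRate m z) z) (p₀ := 1 / m ^ 2)
    (mul_pos hpos (abs_pos.2 hr)) (fun z _ => measurable_resolventWeight _ _)
    (fun z hz => (admissible_bulkRate hx (hE z hz)).norm_resolventWeight_le) (fun s z hz => ?_)
    (fun z hz => (hd z hz).mul_const _) fun z hz => ?_) _
  · unfold resolventWeight
    refine (differentiableWithinAt_const _).div ((((hd z hz).pow 2).mul_const _).add
      (differentiableWithinAt_id.pow 2)) ((admissible_bulkRate hx (hE z hz)).den_ne_zero s)
  · rw [Complex.re_mul_ofReal]
    exact mul_le_mul_of_nonneg_right (le_re_bulkRate hx (hE z hz)) (abs_nonneg _)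

theorem Config.differentiableOn_defectKernel (K : Config γ c C b ω₀ α) (hU : IsOpen U)
    (hx : x₁ < m) (hE : ∀ z ∈ U, |z.re| ≤ x₁) (α' β : ℝ) {t u : ℝ} (htu : t ≠ u) :
    DifferentiableOn ℂ (fun z => defectKernel γ α' β (bulkRate m z) t u) U := by
  have h1 : 0 < ‖γ t - γ u‖ :=
    (mul_pos K.c_pos (abs_pos.2 (sub_ne_zero.2 htu))).trans_le (K.lower t u)
  exact ((((differentiableOn_besselK0_bulkRate hU hx hE h1).const_mul _).sub
    (differentiableOn_lineGreen_bulkRate hU hx hE (sub_ne_zero.2 htu))).const_mul _).mul_const _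

theorem differentiableOn_waveKernel (hU : ∀ z ∈ U, z ≠ 0) (t u : ℝ) :
    DifferentiableOn ℂ (fun z => waveKernel m α z t u) U := by
  intro z hz
  have := hU z hz
  unfold waveKernel
  refine DifferentiableAt.differentiableWithinAt ?_
  fun_prop (disch := assumption)

theorem Config.differentiableOn_bieOp (K : Config γ c C b ω₀ α) (hU : IsOpen U)
    (hω₀ : ω₀ = √(m ^ 2 - x₁ ^ 2)) (hx : x₁ < m) (hE : ∀ z ∈ U, |z.re| ≤ x₁) (ha : 0 < a)
    (hUa : ∀ z ∈ U, a ≤ ‖z‖) (hIm : ∀ z ∈ U, -(α / 2) ≤ z.im) :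
    DifferentiableOn ℂ (fun z => bieOp γ m α z (bulkRate m z)) U := by
  have hadm : ∀ z ∈ U, Admissible m z (bulkRate m z) := fun z hz => admissible_bulkRate hx (hE z hz)
  have h₀ : ∀ z ∈ U, ω₀ ≤ (bulkRate m z).re := fun z hz => hω₀ ▸ le_re_bulkRate hx (hE z hz)
  have hmono : ∀ {A : ℝ}, 0 ≤ A → ∀ z ∈ U, ∀ x, A * massDecay (bulkRate m z) * gmaj (c * ω₀ / 4) x ≤
      A * ω₀ ^ (-(1 / 4) : ℝ) * gmaj (c * ω₀ / 4) x := fun hA z hz x =>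
    mul_le_mul_of_nonneg_right (mul_le_mul_of_nonneg_left (massDecay_le K.ω₀_pos (h₀ z hz)) hA)
      (gmaj_nonneg _ _)
  have hint : ∀ A : ℝ, Integrable fun x => A * gmaj (c * ω₀ / 4) x := fun A =>
    (integrable_gmaj K.rate_pos).const_mul A
  have hG : DifferentiableOn ℂ (fun z => kop (convKernel α (lineGreen (bulkRate m z)))) U :=
    kop_differentiableOn hU (fun z hz => (K.kbound_lineGreen (hadm z hz) (h₀ z hz)).mono (hint _)
      (hmono coshConst_nonneg z hz)) fun t u htu =>
        ((differentiableOn_lineGreen_bulkRate hU hx hE (sub_ne_zero.2 htu)).const_mul _).mul_const _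
  have hW : DifferentiableOn ℂ (fun z => kop (convKernel α (lineW m (bulkRate m z) z))) U := by
    rcases U.eq_empty_or_nonempty with rfl | ⟨z₀, hz₀⟩
    · exact differentiableOn_empty
    exact kop_differentiableOn hU (fun z hz => (K.kbound_lineW (hadm z hz) (h₀ z hz)).mono (hint _)
      (hmono (div_nonneg coshConst_nonneg (hadm z₀ hz₀).m_pos.le) z hz)) fun t u htu =>
        ((differentiableOn_lineW_bulkRate hU hx hE (sub_ne_zero.2 htu)).const_mul _).mul_const _
  have hD : ∀ β ≤ α, DifferentiableOn ℂ (fun z => kop (defectKernel γ α β (bulkRate m z))) U :=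
    fun β hβ => kop_differentiableOn hU
      (fun z hz => (K.kbound_defectKernel (hadm z hz) (h₀ z hz) hβ).mono (hint _)
        (hmono K.defectConst_nonneg z hz))
      fun t u htu => K.differentiableOn_defectKernel hU hx hE α β htu
  have hQ : DifferentiableOn ℂ (fun z => kop (waveKernel m α z)) U :=
    kop_differentiableOn hU (fun z hz => kbound_waveKernel K.α_pos ha (hUa z hz) (hIm z hz))
      fun t u _ => differentiableOn_waveKernel
        (fun z hz => norm_pos_iff.1 (ha.trans_le (hUa z hz))) t u
  have h1 : DifferentiableOn ℂ (fun z => lineOp m α z (bulkRate m z)) U :=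
    ((hG.const_smul (2 * (m : ℂ))).const_sub 1).sub (hW.const_smul (2 * Complex.I * (m : ℂ) ^ 2))
  have h2 := (hD _ K.neg_α_le).const_smul (-2 * (m : ℂ))
  have h3 := ((hD _ le_rfl).mul hQ).const_smul (-2 * (m : ℂ))
  exact h1.add (h2.add h3)

/-- The conjugated operator is invertible for all but finitely many energies in a compact subset
of the strip over an energy window. -/
theorem Config.finite_not_isUnit_bieOp (K : Config γ c C b ω₀ α)
    (hω₀ : ω₀ = √(m ^ 2 - x₁ ^ 2)) (hα : α < (m - x₁) / 2) (ha : 0 < a) {p q : ℝ} (hpq : p < q)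
    (hx₁ : ∀ x, p < x → x < q → |x| ≤ x₁) (hxa : ∀ x, p < x → x < q → a ≤ |x|) {S : Set ℂ}
    (hS : IsCompact S)
    (hSU : ∀ z ∈ S, p < z.re ∧ z.re < q ∧ -(α / 2) < z.im) :
    {z ∈ S | ¬ IsUnit (bieOp γ m α z (bulkRate m z))}.Finite := by
  -- The region is unbounded upwards, to reach energies of large imaginary part, and extends below
  -- the real axis so that real energies are interior.
  set U : Set ℂ := {z | p < z.re ∧ z.re < q ∧ -(α / 2) < z.im}
  have hα0 := K.α_pos
  have hx : x₁ < m := by linarith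
  have hE : ∀ z ∈ U, |z.re| ≤ x₁ := fun z hz => hx₁ _ hz.1 hz.2.1
  have hUa : ∀ z ∈ U, a ≤ ‖z‖ := fun z hz => (hxa _ hz.1 hz.2.1).trans (Complex.abs_re_le_norm z)
  have hIm : ∀ z ∈ U, -(α / 2) ≤ z.im := fun z hz => hz.2.2.le
  have hUo : IsOpen U := (isOpen_lt continuous_const Complex.continuous_re).inter
    ((isOpen_lt Complex.continuous_re continuous_const).inter
      (isOpen_lt continuous_const Complex.continuous_im))
  have hUc : Convex ℝ U := (convex_halfSpace_re_gt p).inter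
    ((convex_halfSpace_re_lt q).inter (convex_halfSpace_im_gt _))
  refine analytic_fredholm_finite hUo hUc.isPreconnected
    (K.differentiableOn_bieOp hUo hω₀ hx hE ha hUa hIm) (fun z hz => ?_) ?_ hS hSU
  · exact K.exists_isUnit_bieOp_sub (admissible_bulkRate hx (hE z hz))
      (hω₀ ▸ le_re_bulkRate hx (hE z hz)) (lt_re_lineRate hx (hE z hz) hα hz.2.2)
      (lineRate_sq hx (hE z hz) hα hz.2.2)
  -- At height `η` the operator is within `(|M| + 1) η^{-1/4} < 1` of the identity, which gives one
  -- invertible point.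
  · obtain ⟨M, hM⟩ := K.exists_norm_bieOp_sub_one_le (m := m) ha
    have hlim : Tendsto (fun η : ℝ => (|M| + 1) * η ^ (-(1 / 4) : ℝ)) atTop (𝓝 0) := by
      simpa using (tendsto_rpow_neg_atTop (y := 1 / 4) (by norm_num)).const_mul (|M| + 1)
    obtain ⟨η, hη1, hη⟩ := ((hlim.eventually_lt_const one_pos).and (eventually_gt_atTop 0)).exists
    obtain ⟨x, hpx, hxq⟩ := exists_between hpq
    have hz : (⟨x, η⟩ : ℂ) ∈ U := ⟨hpx, hxq, by change _ < η; linarith⟩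
    refine ⟨⟨x, η⟩, hz, ?_⟩
    have hre := im_le_re_bulkRate hx (hE _ hz)
    have h1 := hM _ _ (admissible_bulkRate hx (hE _ hz)) (hω₀ ▸ le_re_bulkRate hx (hE _ hz))
      (hUa _ hz) (hIm _ hz)
    have h2 : massDecay (bulkRate m ⟨x, η⟩) ≤ η ^ (-(1 / 4) : ℝ) := massDecay_le hη hre
    have h3 := massDecay_nonneg (admissible_bulkRate hx (hE _ hz)).re_pos
    have h4 : ‖1 - bieOp γ m α ⟨x, η⟩ (bulkRate m ⟨x, η⟩)‖ < 1 := by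
      rw [norm_sub_rev]
      refine h1.trans_lt (lt_of_le_of_lt ?_ hη1)
      exact mul_le_mul ((le_abs_self M).trans (by linarith)) h2 h3 (by positivity)
    have h5 := isUnit_one_sub_of_norm_lt_one h4
    rwa [sub_sub_cancel] at h5

end Analytic

/-! ### The integral equation as an equation for `bieOp`. -/

section Equation

variable {γ : ℝ → Plane} {c C b ω₀ α m : ℝ} {ω : ℂ}

theorem memLp_wexp_neg (hα : 0 < α) : MemLp (wexp (-α)) 2 := by
  refine memLp_two_of_lintegral_lt_top (continuous_wexp _).aestronglyMeasurable ?_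
  refine lt_of_le_of_lt (le_of_eq ?_)
    (integrable_exp_neg_abs_real (a := 2 * α) (by positivity)).lintegral_lt_top
  refine lintegral_congr fun t => ?_
  rw [← ofReal_norm, norm_wexp, ← ENNReal.ofReal_pow (Real.exp_pos _).le, ← Real.exp_nat_mul]
  congr 2
  push_cast; ring

theorem ae_eq_wexp_neg_mul {ρ : ℝ → ℂ} {ψ : L2} (hψ : ψ =ᵐ[volume] fun t => wexp α t * ρ t) :
    ρ =ᵐ[volume] fun t => wexp (-α) t * ψ t := by
  filter_upwards [hψ] with t ht
  rw [ht, ← mul_assoc, wexp_neg_mul, one_mul]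

/-- A product of two `L²` functions, `e^{-α|t|}` and `ψ`. Integrability is what makes `Qρ` well
defined and bounded for real `E`, where its kernel does not decay. -/
theorem integrable_of_weighted (hα : 0 < α) {ρ : ℝ → ℂ} {ψ : L2}
    (hψ : ψ =ᵐ[volume] fun t => wexp α t * ρ t) : Integrable ρ :=
  ((memLp_wexp_neg hα).integrable_mul (Lp.memLp ψ)).congr (ae_eq_wexp_neg_mul hψ).symm

theorem norm_outgoing_exp (E x : ℝ) : ‖Complex.exp (Complex.I * E * (|x| : ℝ))‖ = 1 := by
  rw [Complex.norm_exp]; simp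

theorem integrable_outgoing_mul {ρ : ℝ → ℂ} (hρ : Integrable ρ) (E t : ℝ) :
    Integrable fun u : ℝ => Complex.exp (Complex.I * E * (|t - u| : ℝ)) * ρ u :=
  hρ.bdd_mul (c := 1) (by fun_prop) (Eventually.of_forall fun u => (norm_outgoing_exp E _).le)

theorem norm_opQ_le (ρ : ℝ → ℂ) (E t : ℝ) :
    ‖opQ m E ρ t‖ ≤ ‖(m : ℂ) ^ 2 / (E : ℂ)‖ * ∫ u, ‖ρ u‖ := by
  rw [opQ, norm_mul]
  refine mul_le_mul_of_nonneg_left ((norm_integral_le_integral_norm _).trans_eq ?_) (norm_nonneg _)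
  simp only [norm_mul, norm_outgoing_exp, one_mul]

theorem aestronglyMeasurable_opQ {ρ : ℝ → ℂ} (hρ : AEStronglyMeasurable ρ) (E : ℝ) :
    AEStronglyMeasurable (opQ m E ρ) := by
  unfold opQ
  refine AEStronglyMeasurable.const_mul ?_ _
  have h1 : AEStronglyMeasurable (fun p : ℝ × ℝ =>
      Complex.exp (Complex.I * E * (|p.1 - p.2| : ℝ)) * ρ p.2) (volume.prod volume) :=
    AEStronglyMeasurable.mul (by fun_prop) hρ.comp_snd
  exact h1.integral_prod_right'

/-- The single layer operator on the straight line applied to an outgoing field. -/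
theorem Admissible.outgoing_opQ {E : ℝ} (hE : E ≠ 0) (h : Admissible m E ω) {ρ : ℝ → ℂ}
    (hρ : Integrable ρ) {t : ℝ} (hW : Integrable fun v => lineW m ω E (t - v) * ρ v) :
    opQ m E ρ t - 2 * m * ∫ u, lineGreen ω (t - u) * opQ m E ρ u =
      -(2 * Complex.I * (m : ℂ) ^ 2) * ∫ v, lineW m ω E (t - v) * ρ v := by
  have hm : (m : ℂ) ≠ 0 := by exact_mod_cast h.m_pos.ne'
  have hE' : (E : ℂ) ≠ 0 := by exact_mod_cast hE
  have hG : Integrable fun u => lineGreen ω (t - u) := h.integrable_lineGreen.comp_sub_left t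
  have hint : Integrable (fun p : ℝ × ℝ => lineGreen ω (t - p.1) *
      (Complex.exp (Complex.I * E * (|p.1 - p.2| : ℝ)) * ρ p.2)) (volume.prod volume) := by
    have h1 : Integrable (fun p : ℝ × ℝ => lineGreen ω (t - p.1) * ρ p.2) (volume.prod volume) :=
      hG.mul_prod hρ
    have h2 := h1.bdd_mul (c := 1) (f := fun p : ℝ × ℝ => Complex.exp (Complex.I * E * (|p.1 - p.2| : ℝ)))
      (by fun_prop) (Eventually.of_forall fun p => (norm_outgoing_exp E _).le)
    refine h2.congr (Eventually.of_forall fun p => ?_)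
    simp only; ring
  have hswap : ∫ u, lineGreen ω (t - u) * opQ m E ρ u = (m : ℂ) ^ 2 / E *
      ∫ v, (∫ u, lineGreen ω u * Complex.exp (Complex.I * E * (|t - v - u| : ℝ))) * ρ v := by
    calc ∫ u, lineGreen ω (t - u) * opQ m E ρ u
        = (m : ℂ) ^ 2 / E * ∫ u, ∫ v, lineGreen ω (t - u) *
            (Complex.exp (Complex.I * E * (|u - v| : ℝ)) * ρ v) := by
          rw [← integral_const_mul]
          refine integral_congr_ae (Eventually.of_forall fun u => ?_)
          simp only [opQ]
          rw [integral_const_mul]; ring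
      _ = (m : ℂ) ^ 2 / E * ∫ v, ∫ u, lineGreen ω (t - u) *
            (Complex.exp (Complex.I * E * (|u - v| : ℝ)) * ρ v) := by
          rw [integral_integral_swap hint]
      _ = _ := by
          congr 1
          refine integral_congr_ae (Eventually.of_forall fun v => ?_)
          simp only
          rw [← integral_mul_const, ← integral_sub_left_eq_self _ volume t]
          refine integral_congr_ae (Eventually.of_forall fun u => ?_)
          simp only [sub_sub_cancel, sub_right_comm t u v, mul_assoc]
  have hout : ∀ v, ∫ u, lineGreen ω u * Complex.exp (Complex.I * E * (|t - v - u| : ℝ)) =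
      1 / (2 * m) * Complex.exp (Complex.I * E * (|t - v| : ℝ)) +
        Complex.I * E / m * lineW m ω E (t - v) := by
    intro v
    have h1 := h.outgoing (t - v)
    field_simp
    linear_combination -h1
  rw [hswap]
  simp only [hout, add_mul]
  have hi1 : Integrable fun v : ℝ => 1 / (2 * (m : ℂ)) * Complex.exp (Complex.I * E * (|t - v| : ℝ)) * ρ v := by
    simpa only [mul_assoc] using (integrable_outgoing_mul hρ E t).const_mul (1 / (2 * (m : ℂ)))
  have hi2 : Integrable fun v : ℝ => Complex.I * E / m * lineW m ω E (t - v) * ρ v := by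
    simpa only [mul_assoc] using hW.const_mul (Complex.I * E / m)
  rw [integral_add hi1 hi2]
  simp only [mul_assoc (1 / (2 * (m : ℂ))), mul_assoc (Complex.I * E / m)]
  rw [integral_const_mul, integral_const_mul, opQ]
  field_simp
  ring

/-- The Green's function on the curve is split into line and defect, each applied to `ρ` and to
`Qρ`. The only non-decaying pieces, `Qρ` and the line part acting on it, combine into `lineW` by
`Admissible.outgoing_opQ`. -/
theorem Config.wexp_mul_opL_opP_ae {E : ℝ} (K : Config γ c C b ω₀ α) (h : Admissible m E ω)
    (h₀ : ω₀ ≤ ω.re) (hE : E ≠ 0) {ρ : ℝ → ℂ} {ψ : L2}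
    (hψ : ψ =ᵐ[volume] fun t => wexp α t * ρ t) :
    ∀ᵐ t, wexp α t * opL γ m ω (opP m E ρ) t = bieOp γ m α E ω ψ t := by
  have hα := K.α_pos
  have hρ := integrable_of_weighted hα hψ
  have hρψ := ae_eq_wexp_neg_mul hψ
  have kG := K.kbound_lineGreen h h₀
  have kW := K.kbound_lineW h h₀
  have kD1 := K.kbound_defectKernel h h₀ K.neg_α_le
  have kD2 := K.kbound_defectKernel h h₀ le_rfl
  have kQ : KBound (waveKernel m α E) _ := kbound_waveKernel (a := |E|) hα (abs_pos.2 hE)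
    (by simp) (by simp; linarith)
  set χ := kop (waveKernel m α E) ψ with hχ
  have hχq : ∀ᵐ u, χ u = wexp (-α) u * opQ m E ρ u := by
    filter_upwards [kQ.kop_ae ψ] with u hu
    rw [hχ, hu, opQ, ← mul_assoc, ← integral_const_mul]
    refine integral_congr_ae ?_
    filter_upwards [hρψ] with v hv
    rw [hv, waveKernel]; ring
  have hline : ∀ f : ℝ → ℂ, ∀ t, ∀ᵐ u, f (t - u) * ρ u =
      wexp (-α) t * (convKernel α f t u * ψ u) := by
    intro f t
    filter_upwards [hρψ] with u hu
    rw [hu, convKernel]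
    linear_combination (-(f (t - u) * wexp (-α) u * ψ u)) * wexp_neg_mul α t
  have hdef1 : ∀ t, ∀ᵐ u, defect γ ω t u * ρ u =
      wexp (-α) t * (defectKernel γ α (-α) ω t u * ψ u) := by
    intro t
    filter_upwards [hρψ] with u hu
    rw [hu, defectKernel]
    linear_combination (-(defect γ ω t u * wexp (-α) u * ψ u)) * wexp_neg_mul α t
  have hdef2 : ∀ t, ∀ᵐ u, defect γ ω t u * opQ m E ρ u =
      wexp (-α) t * (defectKernel γ α α ω t u * χ u) := by
    intro t
    filter_upwards [hχq] with u hu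
    rw [hu, defectKernel]
    linear_combination (-(defect γ ω t u * opQ m E ρ u)) * wexp_neg_mul α t -
      (wexp (-α) t * wexp α t * defect γ ω t u * opQ m E ρ u) * wexp_neg_mul α u
  -- `Qρ` is bounded but not decaying, so this uses integrability of `lineGreen` and not the
  -- weighted bounds.
  have hGq : ∀ t, Integrable fun u => lineGreen ω (t - u) * opQ m E ρ u := fun t =>
    (h.integrable_lineGreen.comp_sub_left t).mul_bdd (aestronglyMeasurable_opQ hρ.1 E)
      (Eventually.of_forall fun u => norm_opQ_le ρ E u)
  have hsum : ∀ᵐ t, bieOp γ m α E ω ψ t = ψ t - 2 * m * kop (convKernel α (lineGreen ω)) ψ t -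
      2 * Complex.I * (m : ℂ) ^ 2 * kop (convKernel α (lineW m ω E)) ψ t +
      (-2 * m * kop (defectKernel γ α (-α) ω) ψ t + -2 * m * kop (defectKernel γ α α ω) χ t) := by
    have e : bieOp γ m α E ω ψ = ψ - (2 * (m : ℂ)) • kop (convKernel α (lineGreen ω)) ψ -
        (2 * Complex.I * (m : ℂ) ^ 2) • kop (convKernel α (lineW m ω E)) ψ +
        ((-2 * (m : ℂ)) • kop (defectKernel γ α (-α) ω) ψ +
          (-2 * (m : ℂ)) • kop (defectKernel γ α α ω) χ) := rfl
    rw [e]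
    filter_upwards [Lp.coeFn_add (ψ - (2 * (m : ℂ)) • kop (convKernel α (lineGreen ω)) ψ -
        (2 * Complex.I * (m : ℂ) ^ 2) • kop (convKernel α (lineW m ω E)) ψ)
        ((-2 * (m : ℂ)) • kop (defectKernel γ α (-α) ω) ψ +
          (-2 * (m : ℂ)) • kop (defectKernel γ α α ω) χ),
      Lp.coeFn_sub (ψ - (2 * (m : ℂ)) • kop (convKernel α (lineGreen ω)) ψ)
        ((2 * Complex.I * (m : ℂ) ^ 2) • kop (convKernel α (lineW m ω E)) ψ),
      Lp.coeFn_sub ψ ((2 * (m : ℂ)) • kop (convKernel α (lineGreen ω)) ψ),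
      Lp.coeFn_add ((-2 * (m : ℂ)) • kop (defectKernel γ α (-α) ω) ψ)
          ((-2 * (m : ℂ)) • kop (defectKernel γ α α ω) χ),
      Lp.coeFn_smul (2 * (m : ℂ)) (kop (convKernel α (lineGreen ω)) ψ),
      Lp.coeFn_smul (2 * Complex.I * (m : ℂ) ^ 2) (kop (convKernel α (lineW m ω E)) ψ),
      Lp.coeFn_smul (-2 * (m : ℂ)) (kop (defectKernel γ α (-α) ω) ψ),
      Lp.coeFn_smul (-2 * (m : ℂ)) (kop (defectKernel γ α α ω) χ)] with t a1 a2 a3 a4 a5 a6 a7 a8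
    simp only [a1, a2, a3, a4, a5, a6, a7, a8, Pi.add_apply, Pi.sub_apply, Pi.smul_apply,
      smul_eq_mul]
  filter_upwards [hsum, hψ, kG.kop_ae ψ, kW.kop_ae ψ, kD1.kop_ae ψ, kD2.kop_ae χ,
    kG.ae_integrable (Lp.memLp ψ), kW.ae_integrable (Lp.memLp ψ), kD1.ae_integrable (Lp.memLp ψ),
    kD2.ae_integrable (Lp.memLp χ)] with t e1 e2 e3 e4 e5 e6 i1 i2 i3 i4
  have j1 : Integrable fun u => lineGreen ω (t - u) * ρ u :=
    (i1.const_mul (wexp (-α) t)).congr (EventuallyEq.symm (hline _ t))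
  have j2 : Integrable fun u => lineW m ω E (t - u) * ρ u :=
    (i2.const_mul (wexp (-α) t)).congr (EventuallyEq.symm (hline _ t))
  have j3 : Integrable fun u => defect γ ω t u * ρ u :=
    (i3.const_mul (wexp (-α) t)).congr (EventuallyEq.symm (hdef1 t))
  have j4 : Integrable fun u => defect γ ω t u * opQ m E ρ u :=
    (i4.const_mul (wexp (-α) t)).congr (EventuallyEq.symm (hdef2 t))
  have v1 := (integral_congr_ae (hline (lineGreen ω) t)).trans (integral_const_mul _ _)
  have v2 := (integral_congr_ae (hline (lineW m ω E) t)).trans (integral_const_mul _ _)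
  have v3 := (integral_congr_ae (hdef1 t)).trans (integral_const_mul _ _)
  have v4 := (integral_congr_ae (hdef2 t)).trans (integral_const_mul _ _)
  rw [← e3] at v1
  rw [← e4] at v2
  rw [← e5] at v3
  rw [← e6] at v4
  have hS : singleLayer γ ω (opP m E ρ) t = (∫ u, lineGreen ω (t - u) * ρ u) +
      (∫ u, defect γ ω t u * ρ u) + ((∫ u, lineGreen ω (t - u) * opQ m E ρ u) +
      ∫ u, defect γ ω t u * opQ m E ρ u) := by
    rw [← integral_add j1 j3, ← integral_add (hGq t) j4]
    refine Eq.trans ?_ (integral_add (j1.add j3) ((hGq t).add j4))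
    rw [singleLayer]
    refine integral_congr_ae (Eventually.of_forall fun u => ?_)
    simp only [opP, defect]; ring
  have hout := h.outgoing_opQ hE hρ j2
  rw [opL, hS, e1, e2, opP]
  rw [v2] at hout
  rw [v1, v3, v4]
  linear_combination wexp α t * hout +
    (-(2 * m * kop (convKernel α (lineGreen ω)) ψ t) -
      2 * Complex.I * (m : ℂ) ^ 2 * kop (convKernel α (lineW m ω E)) ψ t -
      2 * m * kop (defectKernel γ α (-α) ω) ψ t - 2 * m * kop (defectKernel γ α α ω) χ t) *
      wexp_mul_neg α t

end Equation

/-! ### The incident field lies in the weighted space. -/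

section Source

variable {γ : ℝ → Plane} {c C b ω₀ α m : ℝ} {E ω : ℂ}

/-- For a nearest parameter `t₀`, `c|t - t₀| ≤ ‖γ t - y‖ + ‖y - γ t₀‖ ≤ 2‖γ t - y‖`. The distance to
an arbitrary source is thus comparable to that from a point of the curve. -/
theorem Config.exists_nearest (K : Config γ c C b ω₀ α) (y : Plane) :
    ∃ t₀ : ℝ, c * |t₀| ≤ 2 * ‖y - γ 0‖ ∧ ∀ t, c / 2 * |t - t₀| ≤ ‖γ t - y‖ := by
  have hc := K.c_pos
  have hlim : Tendsto (fun t => ‖γ t - y‖) (cocompact ℝ) atTop := by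
    have h1 : Tendsto (fun t : ℝ => c * |t| + -‖γ 0 - y‖) (cocompact ℝ) atTop :=
      tendsto_atTop_add_const_right _ _
        ((tendsto_norm_cocompact_atTop (E := ℝ)).const_mul_atTop hc)
    refine tendsto_atTop_mono (fun t => ?_) h1
    have h2 := K.lower t 0
    rw [sub_zero] at h2
    have h3 := norm_sub_le_norm_sub_add_norm_sub (γ t) y (γ 0)
    rw [norm_sub_rev y] at h3
    linarith
  have hcont : Continuous fun t => ‖γ t - y‖ := (K.cont.sub continuous_const).norm
  obtain ⟨t₀, ht₀⟩ := hcont.exists_forall_le hlim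
  refine ⟨t₀, ?_, fun t => ?_⟩
  · have h1 := K.lower t₀ 0
    rw [sub_zero] at h1
    have h2 := norm_sub_le_norm_sub_add_norm_sub (γ t₀) y (γ 0)
    have h3 : ‖γ t₀ - y‖ ≤ ‖γ 0 - y‖ := ht₀ 0
    rw [norm_sub_rev (γ 0)] at h3
    linarith
  · have h1 := K.lower t t₀
    have h2 := norm_sub_le_norm_sub_add_norm_sub (γ t) y (γ t₀)
    have h3 : ‖γ t₀ - y‖ ≤ ‖γ t - y‖ := ht₀ t
    rw [norm_sub_rev y] at h2
    linarith

theorem Admissible.norm_green_le (h : Admissible m E ω) (h₀ : ω₀ ≤ ω.re) {x y : Plane}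
    (hxy : x ≠ y) : ‖green ω x y‖ ≤ coshConst * massDecay ω * gmaj (ω₀ / 2) ‖x - y‖ := by
  have h1 := h.norm_lineGreen_le h₀ (norm_ne_zero_iff.2 (sub_ne_zero.2 hxy))
  rwa [lineGreen, abs_norm] at h1

theorem gmaj_le_of_le {r : ℝ} (hr : 0 ≤ r) {x y : ℝ} (hx : x ≠ 0) (hxy : |x| ≤ |y|) :
    gmaj r y ≤ gmaj r x :=
  mul_le_mul (Real.rpow_le_rpow_of_nonpos (abs_pos.2 hx) hxy (by norm_num))
    (Real.exp_le_exp.2 (by nlinarith)) (Real.exp_pos _).le (Real.rpow_nonneg (abs_nonneg _) _)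

theorem gmaj_mul {a : ℝ} (ha : 0 ≤ a) (r x : ℝ) :
    gmaj r (a * x) = a ^ (-(1 / 4) : ℝ) * gmaj (r * a) x := by
  rw [gmaj, gmaj, abs_mul, abs_of_nonneg ha, Real.mul_rpow ha (abs_nonneg x)]
  ring_nf

/-- Exponential decay along the curve of the field of a point source. -/
theorem Config.exists_norm_wexp_mul_green_le (K : Config γ c C b ω₀ α) (h : Admissible m E ω)
    (h₀ : ω₀ ≤ ω.re) (R : ℝ) :
    ∃ A : ℝ, ∀ y, ‖y - γ 0‖ ≤ R → ∃ t₀, ∀ t ≠ t₀,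
      ‖wexp α t * green ω (γ t) y‖ ≤ A * gmaj (c * ω₀ / 8) (t - t₀) := by
  have hc := K.c_pos
  have hα := K.α_pos
  have hω := K.ω₀_pos
  have hd := massDecay_nonneg h.re_pos
  have hκ := coshConst_nonneg
  refine ⟨Real.exp (α * (2 * R / c)) * (coshConst * massDecay ω * (c / 2) ^ (-(1 / 4) : ℝ)),
    fun y hy => ?_⟩
  obtain ⟨t₀, h1, h2⟩ := K.exists_nearest y
  refine ⟨t₀, fun t ht => ?_⟩
  have hs : 0 < |t - t₀| := abs_pos.2 (sub_ne_zero.2 ht)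
  have hne : γ t ≠ y := fun e => by
    have := h2 t
    rw [e, sub_self, norm_zero] at this
    exact absurd this (not_le.2 (by positivity))
  have h3 : gmaj (ω₀ / 2) ‖γ t - y‖ ≤ (c / 2) ^ (-(1 / 4) : ℝ) * gmaj (c * ω₀ / 4) (t - t₀) := by
    refine (gmaj_le_of_le (by positivity) (x := c / 2 * (t - t₀)) ?_ ?_).trans_eq ?_
    · exact mul_ne_zero (by positivity) (sub_ne_zero.2 ht)
    · rw [abs_norm, abs_mul, abs_of_pos (half_pos hc)]; exact h2 t
    · rw [gmaj_mul (half_pos hc).le]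
      congr 2; ring
  have h4 : gmaj (c * ω₀ / 4) (t - t₀) ≤
      gmaj (c * ω₀ / 8) (t - t₀) * Real.exp (-α * |t - t₀|) := by
    refine gmaj_le ?_ _
    have := K.α_le
    have := K.b_le
    have := mul_pos hc hω
    linarith
  have h5 : |t₀| ≤ 2 * R / c := by
    rw [le_div_iff₀ hc]; linarith
  have h6 : |t| ≤ |t₀| + |t - t₀| := by
    have := abs_add_le t₀ (t - t₀)
    rwa [add_sub_cancel] at this
  have hP : 0 ≤ coshConst * massDecay ω * (c / 2) ^ (-(1 / 4) : ℝ) := by positivity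
  have hg := gmaj_nonneg (c * ω₀ / 8) (t - t₀)
  rw [norm_mul, norm_wexp]
  calc Real.exp (α * |t|) * ‖green ω (γ t) y‖
      ≤ Real.exp (α * |t|) * (coshConst * massDecay ω * ((c / 2) ^ (-(1 / 4) : ℝ) *
          (gmaj (c * ω₀ / 8) (t - t₀) * Real.exp (-α * |t - t₀|)))) := by
        refine mul_le_mul_of_nonneg_left ((h.norm_green_le h₀ hne).trans
          (mul_le_mul_of_nonneg_left (h3.trans (mul_le_mul_of_nonneg_left h4 (by positivity)))
            (mul_nonneg hκ hd))) (Real.exp_pos _).le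
    _ = Real.exp (α * |t| + -α * |t - t₀|) * (coshConst * massDecay ω * (c / 2) ^ (-(1 / 4) : ℝ) *
          gmaj (c * ω₀ / 8) (t - t₀)) := by rw [Real.exp_add]; ring
    _ ≤ Real.exp (α * (2 * R / c)) * (coshConst * massDecay ω * (c / 2) ^ (-(1 / 4) : ℝ) *
          gmaj (c * ω₀ / 8) (t - t₀)) := by
        refine mul_le_mul_of_nonneg_right (Real.exp_le_exp.2 ?_) (mul_nonneg hP hg)
        nlinarith
    _ = _ := by ring

/-- The source is merely integrable, so Cauchy–Schwarz is taken in `|f| dy`; it remains to bound the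
field of a point source in `L²` of the curve, uniformly over the support, singularity included. -/
theorem Config.memLp_wexp_mul_incidentField (K : Config γ c C b ω₀ α) (h : Admissible m E ω)
    (h₀ : ω₀ ≤ ω.re) {f : Plane → ℂ} (hf : Integrable f) (hfc : HasCompactSupport f) :
    MemLp (fun t => wexp α t * incidentField ω f (γ t)) 2 := by
  obtain ⟨R, hR⟩ := (hfc.isBounded.subset_closedBall (γ 0))
  obtain ⟨A, hA⟩ := K.exists_norm_wexp_mul_green_le h h₀ R
  have hrate : 0 < c * ω₀ / 8 := by have := K.rate_pos; linarith
  have hgm : Measurable fun p : ℝ × Plane => wexp α p.1 * green ω (γ p.1) p.2 := by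
    have hγ := K.cont.measurable
    have h1 := (continuous_wexp α).measurable
    unfold green
    simp only [besselK0_eq_expSup]
    exact (h1.comp measurable_fst).mul
      ((measurable_expSup measurable_const (by fun_prop)).const_mul _)
  have hm : AEStronglyMeasurable (fun t => wexp α t * incidentField ω f (γ t)) := by
    have h1 : AEStronglyMeasurable (fun p : ℝ × Plane => wexp α p.1 * green ω (γ p.1) p.2 * f p.2)
        (volume.prod volume) := hgm.aestronglyMeasurable.mul hf.1.comp_snd
    refine h1.integral_prod_right'.congr (Eventually.of_forall fun t => ?_)
    simp only [incidentField, mul_assoc]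
    rw [integral_const_mul]
  set B : ℝ≥0∞ := ∫⁻ x, ENNReal.ofReal ((A * gmaj (c * ω₀ / 8) x) ^ 2)
  have hB : B < ∞ := by
    refine Integrable.lintegral_lt_top ?_
    simp only [mul_pow]
    exact (integrable_gmaj_sq hrate).const_mul _
  have hwB : ∀ y, ‖f y‖ₑ * ∫⁻ t, ‖wexp α t * green ω (γ t) y‖ₑ ^ 2 ≤ ‖f y‖ₑ * B := by
    intro y
    by_cases hy : f y = 0
    · simp [hy]
    · gcongr
      obtain ⟨t₀, ht₀⟩ := hA y (mem_closedBall_iff_norm.1 (hR (subset_tsupport f hy)))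
      refine le_of_le_of_eq (lintegral_mono_ae ?_) (lintegral_sub_right_eq_self
        (fun x => ENNReal.ofReal ((A * gmaj (c * ω₀ / 8) x) ^ 2)) t₀)
      filter_upwards [compl_mem_ae_iff.2 (measure_singleton t₀ : volume {t₀} = 0)] with t ht
      rw [← ofReal_norm, ← ENNReal.ofReal_pow (norm_nonneg _)]
      exact ENNReal.ofReal_le_ofReal (pow_le_pow_left₀ (norm_nonneg _) (ht₀ t ht) 2)
  have hF : ∫⁻ y, ‖f y‖ₑ < ∞ := hf.2
  refine memLp_two_of_lintegral_lt_top hm ?_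
  calc ∫⁻ t, ‖wexp α t * incidentField ω f (γ t)‖ₑ ^ 2
      ≤ ∫⁻ t, (∫⁻ y, ‖f y‖ₑ) * ∫⁻ y, ‖f y‖ₑ * ‖wexp α t * green ω (γ t) y‖ₑ ^ 2 := by
        refine lintegral_mono fun t => ?_
        refine le_trans (pow_le_pow_left' ?_ 2) (sq_lintegral_mul_le volume
          (a := fun y => ‖f y‖ₑ) (b := fun y => ‖wexp α t * green ω (γ t) y‖ₑ) hf.1.enorm
          (hgm.comp measurable_prodMk_left).enorm.aemeasurable)
        rw [incidentField, ← integral_const_mul]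
        refine (enorm_integral_le_lintegral_enorm _).trans_eq (lintegral_congr fun y => ?_)
        rw [← enorm_mul]
        congr 1; ring
    _ = (∫⁻ y, ‖f y‖ₑ) * ∫⁻ y, ‖f y‖ₑ * ∫⁻ t, ‖wexp α t * green ω (γ t) y‖ₑ ^ 2 := by
        rw [lintegral_const_mul' _ _ hF.ne, lintegral_lintegral_swap]
        · congr 1
          refine lintegral_congr fun y => ?_
          rw [lintegral_const_mul' _ _ enorm_ne_top]
        · exact hf.1.enorm.comp_snd.mul ((hgm.enorm.pow_const 2).aemeasurable)
    _ ≤ (∫⁻ y, ‖f y‖ₑ) * ∫⁻ y, ‖f y‖ₑ * B := by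
        exact mul_le_mul_right (lintegral_mono hwB) _
    _ < ∞ := by
        rw [lintegral_mul_const' _ _ hB.ne]
        exact ENNReal.mul_lt_top hF (ENNReal.mul_lt_top hF hB)

end Source

/-! ### Unique solvability from invertibility. -/

section Solvability

variable {γ : ℝ → Plane} {c C b ω₀ α m x₁ : ℝ}

theorem bulkRate_ofReal {E : ℝ} (hx : x₁ < m) (hE : |E| ≤ x₁) :
    bulkRate m E = (√(m ^ 2 - E ^ 2) : ℝ) := by
  have h1 : 0 < m ^ 2 - E ^ 2 := by
    have := sq_le_sq' (by linarith [neg_abs_le E]) ((le_abs_self E).trans hE)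
    nlinarith [abs_nonneg E]
  rw [← csqrt_ofReal h1, bulkRate]
  push_cast; rfl

theorem Config.existsUnique_of_isUnit (K : Config γ c C b ω₀ α) (hω₀ : ω₀ = √(m ^ 2 - x₁ ^ 2))
    (hx : x₁ < m) {E : ℝ} (hE : |E| ≤ x₁) (hE0 : E ≠ 0)
    (hT : IsUnit (bieOp γ m α E (bulkRate m E))) {f : Plane → ℂ} (hf : Integrable f)
    (hfc : HasCompactSupport f) : ∃! ρ : L2, ρ ∈ weightedL2 α ∧ SolvesBIE γ m E f ρ := by
  have hE' : |(E : ℂ).re| ≤ x₁ := by rwa [Complex.ofReal_re]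
  have h := admissible_bulkRate hx hE'
  have h₀ : ω₀ ≤ (bulkRate m E).re := hω₀ ▸ le_re_bulkRate hx hE'
  have hF := (K.memLp_wexp_mul_incidentField h h₀ hf hfc).const_mul (2 * (m : ℂ))
  -- Multiplication by the weight identifies `L²_α` with `L²`, and never vanishes, so the two
  -- equations are equivalent.
  have hiff : ∀ (ρ ψ : L2), ψ =ᵐ[volume] (fun t => wexp α t * ρ t) →
      (SolvesBIE γ m E f ρ ↔ bieOp γ m α E (bulkRate m E) ψ = hF.toLp) := by
    intro ρ ψ hψ
    rw [SolvesBIE, ← bulkRate_ofReal hx hE]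
    constructor
    · intro hs
      apply Lp.ext
      filter_upwards [hs, K.wexp_mul_opL_opP_ae h h₀ hE0 hψ, hF.coeFn_toLp] with t h1 h2 h3
      rw [← h2, h1, h3]; ring
    · intro hs
      filter_upwards [K.wexp_mul_opL_opP_ae h h₀ hE0 hψ, hF.coeFn_toLp] with t h2 h3
      rw [hs, h3] at h2
      refine mul_left_cancel₀ (wexp_ne_zero α t) (h2.trans ?_)
      ring
  obtain ⟨T, hT⟩ := hT
  set ψ : L2 := (↑T⁻¹ : L2 →L[ℂ] L2) hF.toLp with hψ
  have hTψ : bieOp γ m α E (bulkRate m E) ψ = hF.toLp := by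
    rw [← hT, hψ, ← mul_apply_eq_comp, Units.mul_inv]; rfl
  have hρm : MemLp (fun t => wexp (-α) t * ψ t) 2 := by
    refine (Lp.memLp ψ).of_le ((continuous_wexp _).aestronglyMeasurable.mul (Lp.memLp ψ).1)
      (Eventually.of_forall fun t => ?_)
    rw [norm_mul, norm_wexp]
    refine mul_le_of_le_one_left (norm_nonneg _) (Real.exp_le_one_iff.2 ?_)
    nlinarith [K.α_pos, abs_nonneg t]
  have hψρ : ψ =ᵐ[volume] fun t => wexp α t * (hρm.toLp : L2) t := by
    filter_upwards [hρm.coeFn_toLp] with t ht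
    rw [ht, ← mul_assoc, wexp_mul_neg, one_mul]
  refine ⟨hρm.toLp, ⟨(Lp.memLp ψ).ae_eq hψρ, (hiff _ _ hψρ).2 hTψ⟩, ?_⟩
  rintro ρ ⟨hρ, hs⟩
  have hρ' : MemLp (fun t => wexp α t * ρ t) 2 := hρ
  have h1 := (hiff ρ hρ'.toLp hρ'.coeFn_toLp).1 hs
  have h2 : hρ'.toLp = ψ := by
    rw [hψ, ← h1, ← hT, ← mul_apply_eq_comp, Units.inv_mul]; rfl
  apply Lp.ext
  filter_upwards [hρ'.coeFn_toLp, hρm.coeFn_toLp] with t h3 h4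
  rw [h4, ← h2, h3, ← mul_assoc, wexp_neg_mul, one_mul]

end Solvability

end

end SingularWaveguide

/-! ### Choice of the constants and conclusion. -/

theorem mainTheorem2 (γ : ℝ → SingularWaveguide.Plane) (hγ : SingularWaveguide.IsInterface γ)
    (m : ℝ) (hm : 0 < m) (ε : ℝ) (hε : 0 < ε) :
    ∃ α₀ : ℝ, 0 < α₀ ∧ ∀ α : ℝ, 0 < α → α < α₀ →
      {E : ℝ | E ∈ Set.Icc (-m + ε) (-ε) ∪ Set.Icc ε (m - ε) ∧
        ¬ ∀ f : SingularWaveguide.Plane → ℂ,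
            MeasureTheory.Integrable f MeasureTheory.volume → HasCompactSupport f →
            ∃! ρ : MeasureTheory.Lp ℂ 2 (MeasureTheory.volume : MeasureTheory.Measure ℝ),
              ρ ∈ SingularWaveguide.weightedL2 α ∧
                SingularWaveguide.SolvesBIE γ m E f ρ}.Finite := by
  -- For `m < 2ε` both windows are empty.
  rcases lt_or_ge m (2 * ε) with hmε | hεm
  · refine ⟨1, one_pos, fun α _ _ => Set.Finite.subset Set.finite_empty ?_⟩
    rintro E ⟨⟨h1, h2⟩ | ⟨h1, h2⟩, -⟩ <;> linarith
  obtain ⟨c, C, b₀, hc, hc1, hC, hb₀, hlow, hchord⟩ := hγ.exists_geometry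
  -- Half of the margin `ε` is given up on each side, so that the closed windows are compact subsets
  -- of open strips still avoiding `0` and `±m`.
  set x₁ := m - ε / 2 with hx₁
  have hx : x₁ < m := by linarith
  have hx₁0 : 0 < x₁ := by linarith
  have hω₀ : 0 < √(m ^ 2 - x₁ ^ 2) := Real.sqrt_pos.2 (by nlinarith)
  have hb : 0 < min b₀ (c * √(m ^ 2 - x₁ ^ 2) / 8) := lt_min hb₀ (by positivity)
  -- The first bound on `α` is the one for the defect kernels, the second the one that ensures `α <
  -- Re θ`.
  refine ⟨min (min b₀ (c * √(m ^ 2 - x₁ ^ 2) / 8) / 2) ((m - x₁) / 2),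
    lt_min (half_pos hb) (by linarith), fun α hα hα₀ => ?_⟩
  have K : SingularWaveguide.Config γ c C (min b₀ (c * √(m ^ 2 - x₁ ^ 2) / 8)) (√(m ^ 2 - x₁ ^ 2)) α :=
    { cont := hγ.continuous
      c_pos := hc
      c_le := hc1
      C_pos := hC
      b_pos := hb
      ω₀_pos := hω₀
      lower := hlow
      upper := hγ.norm_chord_le
      chord := hchord _ (min_le_left _ _)
      b_le := min_le_right _ _
      α_pos := hα
      α_le := (hα₀.trans_le (min_le_left _ _)).le }
  have hα' : α < (m - x₁) / 2 := hα₀.trans_le (min_le_right _ _)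
  have hfin : ∀ p q p' q' : ℝ, p < p' → q' < q → p < q → (∀ x, p < x → x < q → |x| ≤ x₁) →
      (∀ x, p < x → x < q → ε / 2 ≤ |x|) →
      {E : ℝ | E ∈ Set.Icc p' q' ∧ ¬ IsUnit (SingularWaveguide.bieOp γ m α E (SingularWaveguide.bulkRate m E))}.Finite := by
    intro p q p' q' hp hq hpq h1 h2
    have hS : IsCompact (Complex.ofReal '' Set.Icc p' q') :=
      isCompact_Icc.image Complex.continuous_ofReal
    have h3 := K.finite_not_isUnit_bieOp (m := m) rfl hα' (half_pos hε) hpq h1 h2 hS (by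
      rintro _ ⟨x, ⟨hx1, hx2⟩, rfl⟩
      rw [Complex.ofReal_re, Complex.ofReal_im]
      exact ⟨by linarith, by linarith, by linarith⟩)
    refine (h3.preimage Complex.ofReal_injective.injOn).subset ?_
    rintro E ⟨hE, hu⟩
    exact ⟨⟨E, hE, rfl⟩, hu⟩
  have hpos := hfin (ε / 2) x₁ ε (m - ε) (by linarith) (by linarith) (by linarith)
    (fun x h1 h2 => abs_le.2 ⟨by linarith, h2.le⟩) (fun x h1 _ => h1.le.trans (le_abs_self x))
  have hneg := hfin (-x₁) (-(ε / 2)) (-m + ε) (-ε) (by linarith) (by linarith) (by linarith)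
    (fun x h1 h2 => abs_le.2 ⟨h1.le, by linarith⟩)
    (fun x _ h2 => (by linarith : ε / 2 ≤ -x).trans (neg_le_abs x))
  refine (hneg.union hpos).subset ?_
  rintro E ⟨hE, hnot⟩
  have hEabs : |E| ≤ x₁ ∧ E ≠ 0 := by
    rcases hE with ⟨h1, h2⟩ | ⟨h1, h2⟩
    · exact ⟨abs_le.2 ⟨by linarith, by linarith⟩, by linarith⟩
    · exact ⟨abs_le.2 ⟨by linarith, by linarith⟩, by linarith⟩
  have hu : ¬ IsUnit (SingularWaveguide.bieOp γ m α E (SingularWaveguide.bulkRate m E)) := fun hT => hnot fun f hf hfc =>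
    K.existsUnique_of_isUnit rfl hx hEabs.1 hEabs.2 hT hf hfc
  exact hE.imp (fun h => ⟨h, hu⟩) (fun h => ⟨h, hu⟩)
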